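/- Let $u_0\in C(0,1)$ take values in $[0,1]$ and let $v_{0,-},v_{0,+}\in[0,1]$. Then there is a unique bounded function $u\in C^{2,1}([0,1]\times(0,\infty))$ (that is, $u,u_r,u_{rr},u_t$ exist and are continuous on $[0,1]\times(0,\infty)$, with one-sided spatial derivatives at $r=0,1$) such that $$u_t=\tfrac12u_{rr}\ \text{ on }(0,1)\times(0,\infty),\qquad \lim_{t\downarrow0}u(r,t)=u_0(r)\ \text{ for } r\in(0,1),$$ and such that the boundary values $v_-(t):=u(0,t)$ and $v_+(t):=u(1,t)$ satisfy, for all $t>0$, $$\frac{d}{dt}v_-(t)=\tfrac12u_r(0,t),\qquad \frac{d}{dt}v_+(t)=-\tfrac12u_r(1,t),\qquad \lim_{t\downarrow0}v_\pm(t)=v_{0,\pm}.$$ Moreover, $u$ is obtained as the following limit. For $\sigma>0$ let $u_0^\sigma\in C(0,1)$ take values in $[0,1]$ and let $v^\sigma_{0,\pm}\in[0,1]$, such that as $\sigma\downarrow0$, $u_0^\sigma\to u_0$ uniformly on compact subsets of $(0,1)$ and $v^\sigma_{0,\pm}\to v_{0,\pm}$. Then for every $\sigma>0$ there are a bounded $u^\sigma\in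 C^{2,1}((0,1)\times(0,\infty))$, extending continuously to $[0,1]\times(0,\infty)$ with boundary values $u^\sigma(0,\cdot),u^\sigma(1,\cdot)$ in $[0,1]$, and $\rho^\sigma_\pm\in C^1(0,\infty)\cap C([0,\infty))$ with $\rho^\sigma_\pm(0)=v^\sigma_{0,\pm}$, which satisfy $u^\sigma_t=\tfrac12u^\sigma_{rr}$ on $(0,1)\times(0,\infty)$, $\lim_{t\downarrow0}u^\sigma(r,t)=u^\sigma_0(r)$ for $r\in(0,1)$, and for all $t>0$ $$\frac{d}{dt}\rho^\sigma_-(t)=\sigma^{-1}\big[u^\sigma(0,t)-\rho^\sigma_-(t)\big],\qquad \frac{d}{dt}\rho^\sigma_+(t)=\sigma^{-1}\big[u^\sigma(1,t)-\rho^\sigma_+(t)\big],$$ $$\rho^\sigma_-(t)=\rho^\sigma_-(0)+\lim_{l\to0}\lim_{t_0\downarrow0}\int_{t_0}^t\tfrac12u^\sigma_r(l,s)\,ds,\qquad \rho^\sigma_+(t)=\rho^\sigma_+(0)-\lim_{l\to1}\lim_{t_0\downarrow0}\int_{t_0}^t\tfrac12u^\sigma_r(l,s)\,ds;$$ and for any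 such solutions, as $\sigma\downarrow0$, $u^\sigma(r,t)\to u(r,t)$ for all $(r,t)\in[0,1]\times(0,\infty)$ and $\rho^\sigma_\pm(t)\to v_\pm(t)$ for all $t>0$. -/

import Mathlib

open Set Filter Topology MeasureTheory

/-- The spatial derivative `u_r(r,t)` of `u : (r,t) ↦ u r t`, taken within the spatial interval `I`
(so it is one-sided at an endpoint that belongs to `I`). -/
noncomputable def spaceDeriv (I : Set ℝ) (u : ℝ → ℝ → ℝ) (r t : ℝ) : ℝ :=
  derivWithin (fun x => u x t) I r

/-- The second spatial derivative `u_rr(r,t)`, taken within the spatial interval `I`. -/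
noncomputable def spaceDeriv2 (I : Set ℝ) (u : ℝ → ℝ → ℝ) (r t : ℝ) : ℝ :=
  derivWithin (fun x => spaceDeriv I u x t) I r

/-- The time derivative `u_t(r,t)`. -/
noncomputable def timeDeriv (u : ℝ → ℝ → ℝ) (r t : ℝ) : ℝ :=
  deriv (fun s => u r s) t

/-- `u ∈ C^{2,1}(I × (0,∞))`: the derivatives `u_r`, `u_rr`, `u_t` exist on `I × (0,∞)`, and
`u`, `u_r`, `u_rr`, `u_t` are jointly continuous there. -/
structure IsC21 (I : Set ℝ) (u : ℝ → ℝ → ℝ) : Prop where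
  diff_r : ∀ r ∈ I, ∀ t : ℝ, 0 < t → DifferentiableWithinAt ℝ (fun x => u x t) I r
  diff_rr : ∀ r ∈ I, ∀ t : ℝ, 0 < t →
    DifferentiableWithinAt ℝ (fun x => spaceDeriv I u x t) I r
  diff_t : ∀ r ∈ I, ∀ t : ℝ, 0 < t → DifferentiableAt ℝ (fun s => u r s) t
  cont : ContinuousOn (fun p : ℝ × ℝ => u p.1 p.2) (I ×ˢ Ioi 0)
  cont_r : ContinuousOn (fun p : ℝ × ℝ => spaceDeriv I u p.1 p.2) (I ×ˢ Ioi 0)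
  cont_rr : ContinuousOn (fun p : ℝ × ℝ => spaceDeriv2 I u p.1 p.2) (I ×ˢ Ioi 0)
  cont_t : ContinuousOn (fun p : ℝ × ℝ => timeDeriv u p.1 p.2) (I ×ˢ Ioi 0)

/-- `u₀ ∈ C(0,1)` with values in `[0,1]`. -/
def IsInitialDatum (u₀ : ℝ → ℝ) : Prop :=
  ContinuousOn u₀ (Ioo 0 1) ∧ ∀ r ∈ Ioo (0 : ℝ) 1, u₀ r ∈ Icc (0 : ℝ) 1

/-- `u` is bounded on `[0,1] × (0,∞)`. -/
def IsBoundedSol (u : ℝ → ℝ → ℝ) : Prop :=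
  ∃ C : ℝ, ∀ r ∈ Icc (0 : ℝ) 1, ∀ t : ℝ, 0 < t → |u r t| ≤ C

/-- `u` is a bounded solution in `C^{2,1}([0,1] × (0,∞))` of the heat equation `u_t = u_rr / 2` with
initial datum `u₀` on `(0,1)`, whose boundary values `v₋(t) = u(0,t)` and `v₊(t) = u(1,t)` satisfy
`v₋' = u_r(0,·)/2`, `v₊' = -u_r(1,·)/2`, `v₋(0+) = vm` and `v₊(0+) = vp`. -/
structure IsStickySolution (u₀ : ℝ → ℝ) (vm vp : ℝ) (u : ℝ → ℝ → ℝ) : Prop where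
  regular : IsC21 (Icc 0 1) u
  bounded : IsBoundedSol u
  heat : ∀ r ∈ Ioo (0 : ℝ) 1, ∀ t : ℝ, 0 < t →
    timeDeriv u r t = 1 / 2 * spaceDeriv2 (Icc 0 1) u r t
  initial : ∀ r ∈ Ioo (0 : ℝ) 1, Tendsto (fun t => u r t) (𝓝[>] 0) (𝓝 (u₀ r))
  left_flux : ∀ t : ℝ, 0 < t →
    HasDerivAt (fun s => u 0 s) (1 / 2 * spaceDeriv (Icc 0 1) u 0 t) t
  right_flux : ∀ t : ℝ, 0 < t →
    HasDerivAt (fun s => u 1 s) (-(1 / 2 * spaceDeriv (Icc 0 1) u 1 t)) t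
  left_initial : Tendsto (fun t => u 0 t) (𝓝[>] 0) (𝓝 vm)
  right_initial : Tendsto (fun t => u 1 t) (𝓝[>] 0) (𝓝 vp)

/-- The iterated limit of `F l t₀`, first as `t₀ ↓ 0` and then as `l` tends along `L`, exists and
equals `a`. -/
def HasIteratedLimit (F : ℝ → ℝ → ℝ) (L : Filter ℝ) (a : ℝ) : Prop :=
  ∃ Φ : ℝ → ℝ, (∀ᶠ l in L, Tendsto (fun t₀ => F l t₀) (𝓝[>] 0) (𝓝 (Φ l))) ∧
    Tendsto Φ L (𝓝 a)

/-- `(u, ρm, ρp)` solves the boundary value problem with parameter `σ`, in which a reservoir is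
coupled to the heat equation at each endpoint. Here `u ∈ C^{2,1}((0,1) × (0,∞))` is bounded and has
the continuous boundary values `u(0,·)`, `u(1,·)`, with values in `[0,1]`, and
`ρm, ρp ∈ C¹(0,∞) ∩ C([0,∞))`. -/
structure IsReservoirSolution (σ : ℝ) (u₀ : ℝ → ℝ) (vm vp : ℝ)
    (u : ℝ → ℝ → ℝ) (ρm ρp : ℝ → ℝ) : Prop where
  regular : IsC21 (Ioo 0 1) u
  bounded : IsBoundedSol u
  cont_closed : ContinuousOn (fun p : ℝ × ℝ => u p.1 p.2) (Icc 0 1 ×ˢ Ioi 0)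
  left_mem : ∀ t : ℝ, 0 ≤ t → u 0 t ∈ Icc (0 : ℝ) 1
  right_mem : ∀ t : ℝ, 0 ≤ t → u 1 t ∈ Icc (0 : ℝ) 1
  left_cont : ContinuousOn ρm (Ici 0)
  right_cont : ContinuousOn ρp (Ici 0)
  left_C1 : ContDiffOn ℝ 1 ρm (Ioi 0)
  right_C1 : ContDiffOn ℝ 1 ρp (Ioi 0)
  left_initial : ρm 0 = vm
  right_initial : ρp 0 = vp
  heat : ∀ r ∈ Ioo (0 : ℝ) 1, ∀ t : ℝ, 0 < t →
    timeDeriv u r t = 1 / 2 * spaceDeriv2 (Ioo 0 1) u r t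
  initial : ∀ r ∈ Ioo (0 : ℝ) 1, Tendsto (fun t => u r t) (𝓝[>] 0) (𝓝 (u₀ r))
  left_exchange : ∀ t : ℝ, 0 < t → HasDerivAt ρm (σ⁻¹ * (u 0 t - ρm t)) t
  right_exchange : ∀ t : ℝ, 0 < t → HasDerivAt ρp (σ⁻¹ * (u 1 t - ρp t)) t
  left_flux : ∀ t : ℝ, 0 < t →
    HasIteratedLimit (fun l t₀ => ∫ s in t₀..t, 1 / 2 * spaceDeriv (Ioo 0 1) u l s)
      (𝓝[>] 0) (ρm t - ρm 0)
  right_flux : ∀ t : ℝ, 0 < t →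
    HasIteratedLimit (fun l t₀ => ∫ s in t₀..t, 1 / 2 * spaceDeriv (Ioo 0 1) u l s)
      (𝓝[<] 1) (-(ρp t - ρp 0))

/-! Work in the Hilbert space L²(0,1) ⊕ ℂ ⊕ ℂ of a bulk density and two reservoir contents. Both
problems are the evolution under A_σ(u, a, b) = (u''/2, u'(0)/2, -u'(1)/2) on the domain u(0) - a =
σu'(0)/2, u(1) - b = -σu'(1)/2. The sticky problem is the case σ = 0, where the reservoir content is
the boundary value.

The unbounded operator A_σ is never constructed. Its negative is inverted explicitly on states of
mean zero: if `kap y` measures the mass in (y,1) plus the right reservoir, then -A_σ(u, a, b) = F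
forces u'(y)/2 = ⟨kap y, F⟩. The inverse therefore has the quadratic form 2∫₀¹|⟨kap z, F⟩|² dz +
σ(|⟨kap 0, F⟩|² + |⟨kap 1, F⟩|²). Centred, this is `green σ`: bounded, positive, affine in σ up to
and including σ = 0, with kernel the constants.

The evolution is exp(-tN⁻¹) with N = `green σ`, given by the continuous functional calculus for x ↦
exp(-t/x), extended by zero. The operators N⁻ʲexp(-tN⁻¹) are bounded for t > 0 and supply the time
derivatives. Elements of the range of N have the explicit differentiable density `val`, which
supplies the space derivatives and the boundary conditions. Norm continuity of σ ↦ `green σ` gives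
the limit σ ↓ 0 (`tendsto_flow`).

Three facts are invisible to L² theory. Values in [0,1] come from a minimum principle for smooth
bumps (`heat_reservoir_nonneg`), carried to general data by self-adjointness (`temp_nonneg`).
Pointwise attainment of the initial datum comes from comparison with bumps (`eventually_temp_lt`).
Uniqueness cannot use a maximum principle for u itself, which may be discontinuous at the corners
(0,0) and (1,0). It uses the integrated quantity m(y,t) = ∫_y¹ u dx + (right reservoir), which for
zero data is continuous down to t = 0 and solves the heat equation with dynamic Robin conditions
(`integrated_heat_nonpos`, `IsFluxSolution.unique`). Hence every reservoir solution is the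
constructed one, and the limit statement follows. -/

set_option linter.unusedSectionVars false

/-! ### The functions x⁻ʲ exp(-t/x) and bounds uniform in x. -/

/-- `decay j t x = x⁻ʲ exp (-t / x)` for `x, t > 0`, extended by zero. -/
noncomputable def decay (j : ℕ) (t x : ℝ) : ℝ := (x⁻¹) ^ j * expNegInvGlue (x / t)

theorem decay_of_nonpos {x : ℝ} (j : ℕ) {t : ℝ} (ht : 0 ≤ t) (hx : x ≤ 0) : decay j t x = 0 := by
  rw [decay, expNegInvGlue.zero_of_nonpos (div_nonpos_of_nonpos_of_nonneg hx ht), mul_zero]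

theorem decay_of_pos {x t : ℝ} (j : ℕ) (ht : 0 < t) (hx : 0 < x) :
    decay j t x = (x⁻¹) ^ j * Real.exp (-(t * x⁻¹)) := by
  rw [decay, expNegInvGlue, if_neg (not_le.2 (div_pos hx ht)), inv_div, div_eq_mul_inv]

/-- Here x / 0 = 0, so the operators at time 0 are zero and not the identity. The density at time 0
is then the constant mean, an admissible value at the one instant where the boundary value is
constrained only to lie in [0,1]. -/
theorem decay_time_zero (j : ℕ) : decay j 0 = fun _ => 0 := by
  funext x
  simp [decay, expNegInvGlue.zero]

theorem decay_nonneg {x t : ℝ} (j : ℕ) (ht : 0 < t) : 0 ≤ decay j t x := by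
  rcases le_or_gt x 0 with hx | hx
  · rw [decay_of_nonpos j ht.le hx]
  · rw [decay_of_pos j ht hx]; positivity

theorem mul_decay_succ (j : ℕ) (t x : ℝ) : x * decay (j + 1) t x = decay j t x := by
  by_cases hx : x = 0
  · simp [decay, hx, expNegInvGlue.zero]
  · rw [decay, decay, pow_succ]; field_simp

/-- Continuity at x = 0 holds because exp(-t/x) beats every inverse power of x. This is what lets
the functional calculus treat an N whose spectrum contains 0. -/
theorem continuous_decay (j : ℕ) {t : ℝ} (ht : 0 < t) : Continuous (decay j t) := by
  have h := (expNegInvGlue.continuous_polynomial_eval_inv_mul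
    ((Polynomial.X : Polynomial ℝ) ^ j)).comp (continuous_id.div_const t)
  have h2 : decay j t = fun x => (t⁻¹) ^ j *
      ((fun x => ((Polynomial.X : Polynomial ℝ) ^ j).eval x⁻¹ * expNegInvGlue x) ∘
        (fun x => id x / t)) x := by
    funext x
    simp only [decay, Polynomial.eval_pow, Polynomial.eval_X, Function.comp, id, inv_div]
    rw [← mul_assoc, ← mul_pow]
    congr 2
    field_simp
  rw [h2]
  exact continuous_const.mul h

/-- From y^j / j! ≤ exp y at y = δ/x. Uniformity in x turns these estimates into operator norm
bounds that need no knowledge of the spectrum. -/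
theorem decay_le {δ t x : ℝ} (j : ℕ) (hδ : 0 < δ) (ht : δ ≤ t) :
    decay j t x ≤ j.factorial / δ ^ j := by
  rcases le_or_gt x 0 with hx | hx
  · rw [decay_of_nonpos j (hδ.le.trans ht) hx]; positivity
  · rw [decay_of_pos j (hδ.trans_le ht) hx]
    have h1 : (δ * x⁻¹) ^ j / j.factorial ≤ Real.exp (δ * x⁻¹) :=
      Real.pow_div_factorial_le_exp _ (by positivity) j
    have h2 : Real.exp (-(t * x⁻¹)) ≤ Real.exp (-(δ * x⁻¹)) := by
      apply Real.exp_le_exp.2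
      have : δ * x⁻¹ ≤ t * x⁻¹ := by gcongr
      linarith
    have h3 : (x⁻¹) ^ j ≤ j.factorial / δ ^ j * Real.exp (δ * x⁻¹) := by
      rw [div_le_iff₀ (by positivity), mul_pow] at h1
      rw [div_mul_eq_mul_div, le_div_iff₀ (by positivity)]
      linarith
    calc (x⁻¹) ^ j * Real.exp (-(t * x⁻¹))
        ≤ (j.factorial / δ ^ j * Real.exp (δ * x⁻¹)) * Real.exp (-(δ * x⁻¹)) := by gcongr
      _ = j.factorial / δ ^ j := by
        rw [mul_assoc, ← Real.exp_add, add_neg_cancel, Real.exp_zero, mul_one]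

theorem abs_decay_le {δ t x : ℝ} (j : ℕ) (hδ : 0 < δ) (ht : δ ≤ t) :
    |decay j t x| ≤ j.factorial / δ ^ j := by
  rw [abs_of_nonneg (decay_nonneg j (hδ.trans_le ht))]
  exact decay_le j hδ ht

theorem hasDerivAt_decay (j : ℕ) {t : ℝ} (ht : 0 < t) (x : ℝ) :
    HasDerivAt (fun s => decay j s x) (-decay (j + 1) t x) t := by
  rcases le_or_gt x 0 with hx | hx
  · rw [decay_of_nonpos _ ht.le hx, neg_zero]
    refine (hasDerivAt_const t (0 : ℝ)).congr_of_eventuallyEq ?_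
    filter_upwards [lt_mem_nhds ht] with s hs
    exact decay_of_nonpos j hs.le hx
  · have h : HasDerivAt (fun s => (x⁻¹) ^ j * Real.exp (-(s * x⁻¹)))
        ((x⁻¹) ^ j * (Real.exp (-(t * x⁻¹)) * (-(1 * x⁻¹)))) t :=
      ((((hasDerivAt_id t).mul_const x⁻¹).neg).exp).const_mul _
    refine (h.congr_of_eventuallyEq ?_).congr_deriv ?_
    · filter_upwards [lt_mem_nhds ht] with s hs
      exact decay_of_pos j hs hx
    · rw [decay_of_pos _ ht hx, pow_succ]; ring

theorem abs_decay_sub_le {δ s t x : ℝ} (j : ℕ) (hδ : 0 < δ) (hs : δ ≤ s) (ht : δ ≤ t) :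
    |decay j s x - decay j t x| ≤ (j + 1).factorial / δ ^ (j + 1) * |s - t| := by
  have := (convex_Ici δ).norm_image_sub_le_of_norm_hasDerivWithin_le
    (f := fun s => decay j s x) (f' := fun s => -decay (j + 1) s x) (x := t) (y := s)
    (fun r hr => (hasDerivAt_decay j (hδ.trans_le hr) x).hasDerivWithinAt)
    (fun r hr => by rw [norm_neg]; exact abs_decay_le (j + 1) hδ hr) ht hs
  simpa using this

/-- The mean value inequality applied to the first-order remainder, whose derivative is controlled
by `abs_decay_sub_le`. The quadratic error, uniform in x, gives differentiability in operator norm.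
-/
theorem abs_decay_taylor_le {δ s t x : ℝ} (j : ℕ) (hδ : 0 < δ) (hs : δ ≤ s) (ht : δ ≤ t) :
    |decay j s x - decay j t x + (s - t) * decay (j + 1) t x| ≤
      (j + 2).factorial / δ ^ (j + 2) * |s - t| * |s - t| := by
  have hsub : uIcc t s ⊆ Ici δ := fun r hr => (le_min ht hs).trans hr.1
  have := (convex_uIcc t s).norm_image_sub_le_of_norm_hasDerivWithin_le
    (f := fun s => decay j s x - decay j t x + (s - t) * decay (j + 1) t x)
    (f' := fun s => -decay (j + 1) s x + 1 * decay (j + 1) t x) (x := t) (y := s)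
    (C := (j + 2).factorial / δ ^ (j + 2) * |s - t|)
    (fun r hr => (((hasDerivAt_decay j (hδ.trans_le (hsub hr)) x).sub_const _).add
      (((hasDerivAt_id r).sub_const t).mul_const _)).hasDerivWithinAt)
    (fun r hr => by
      have h1 := abs_decay_sub_le (x := x) (j + 1) hδ ht (hsub hr)
      have h2 : |t - r| ≤ |s - t| := by
        rw [abs_sub_comm t r]
        exact abs_sub_left_of_mem_uIcc hr
      rw [Real.norm_eq_abs, one_mul, neg_add_eq_sub]
      exact h1.trans (by gcongr)) left_mem_uIcc right_mem_uIcc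
  simpa using this

/-! ### The semigroup exp(-tN⁻¹) of a bounded self-adjoint N. -/

section Operators

variable {H : Type*} [NormedAddCommGroup H] [InnerProductSpace ℂ H] [CompleteSpace H]

/-- The operator `N⁻ʲ exp (-t N⁻¹)`. -/
noncomputable def heatOp (N : H →L[ℂ] H) (j : ℕ) (t : ℝ) : H →L[ℂ] H := cfc (decay j t) N

variable {N : H →L[ℂ] H}

theorem heatOp_time_zero (N : H →L[ℂ] H) (j : ℕ) : heatOp N j 0 = 0 := by
  rw [heatOp, decay_time_zero]
  exact cfc_zero (R := ℝ) N

theorem hasDerivAt_heatOp (hN : IsSelfAdjoint N) (j : ℕ) {t : ℝ} (ht : 0 < t) :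
    HasDerivAt (heatOp N j) (-heatOp N (j + 1) t) t := by
  have hδ : 0 < t / 2 := by positivity
  rw [hasDerivAt_iff_isLittleO]
  have hO : (fun s => heatOp N j s - heatOp N j t - (s - t) • (-heatOp N (j + 1) t)) =O[𝓝 t]
      (fun s => (s - t) ^ 2) := by
    refine Asymptotics.IsBigO.of_bound ((j + 2).factorial / (t / 2) ^ (j + 2)) ?_
    filter_upwards [lt_mem_nhds (half_lt_self ht)] with s hs
    have hs0 : 0 < s := hδ.trans hs
    have h1 : heatOp N j s - heatOp N j t - (s - t) • (-heatOp N (j + 1) t) =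
        cfc (fun x => decay j s x - decay j t x + (s - t) * decay (j + 1) t x) N := by
      rw [cfc_add N (fun x => decay j s x - decay j t x) (fun x => (s - t) * decay (j + 1) t x)
        (((continuous_decay j hs0).sub (continuous_decay j ht)).continuousOn)
        ((continuous_const.mul (continuous_decay (j + 1) ht)).continuousOn),
        cfc_sub (decay j s) (decay j t) N (continuous_decay j hs0).continuousOn
        (continuous_decay j ht).continuousOn,
        cfc_const_mul (s - t) (decay (j + 1) t) N (continuous_decay (j + 1) ht).continuousOn]
      simp only [heatOp, smul_neg, sub_neg_eq_add]
    rw [h1]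
    refine norm_cfc_le (by positivity) fun x _ => ?_
    refine (abs_decay_taylor_le j hδ hs.le (half_lt_self ht).le).trans (le_of_eq ?_)
    rw [norm_pow, Real.norm_eq_abs]; ring
  refine hO.trans_isLittleO ?_
  have := (Asymptotics.isLittleO_pow_id (𝕜 := ℝ) one_lt_two)
  have h2 := this.comp_tendsto (k := fun s => s - t) (l' := 𝓝 t) (by
    have : Tendsto (fun s => s - t) (𝓝 t) (𝓝 (t - t)) := tendsto_id.sub_const t
    simpa using this)
  simpa [Function.comp_def] using h2

theorem mul_heatOp_succ (hN : IsSelfAdjoint N) (j : ℕ) {t : ℝ} (ht : 0 < t) :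
    N * heatOp N (j + 1) t = heatOp N j t := by
  have h := cfc_mul (fun x => x) (decay (j + 1) t) N continuous_id.continuousOn
    (continuous_decay _ ht).continuousOn
  rw [cfc_id' ℝ N] at h
  rw [heatOp, ← h]
  simp only [mul_decay_succ]
  rfl

theorem heatOp_succ_mul (hN : IsSelfAdjoint N) (j : ℕ) {t : ℝ} (ht : 0 < t) :
    heatOp N (j + 1) t * N = heatOp N j t := by
  have h := cfc_mul (decay (j + 1) t) (fun x => x) N 
    (continuous_decay _ ht).continuousOn continuous_id.continuousOn
  rw [cfc_id' ℝ N] at h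
  rw [heatOp, ← h]
  simp only [mul_comm (decay _ _ _), mul_decay_succ]
  rfl

theorem isSelfAdjoint_heatOp (j : ℕ) (t : ℝ) : IsSelfAdjoint (heatOp N j t) :=
  cfc_predicate _ _

theorem norm_heatOp_zero_le {t : ℝ} (ht : 0 < t) : ‖heatOp N 0 t‖ ≤ 1 := by
  refine norm_cfc_le zero_le_one fun x _ => ?_
  simpa using abs_decay_le (x := x) 0 ht le_rfl

/-- On the spectrum, x(1 - exp(-t/x)) ≤ t, because 1 - exp(-y) ≤ y. -/
theorem norm_heatOp_mul_sub_le (hN : IsSelfAdjoint N) (hpos : ∀ x ∈ spectrum ℝ N, 0 ≤ x)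
    {t : ℝ} (ht : 0 < t) : ‖heatOp N 0 t * N - N‖ ≤ t := by
  have h := cfc_mul (decay 0 t) (fun x => x) N 
    (continuous_decay _ ht).continuousOn continuous_id.continuousOn
  have h2 := cfc_sub (fun x => decay 0 t x * x) (fun x => x) N 
    ((continuous_decay _ ht).mul continuous_id).continuousOn continuous_id.continuousOn
  rw [h, cfc_id' ℝ N] at h2
  rw [heatOp, ← h2]
  refine norm_cfc_le ht.le fun x hx => ?_
  rcases (hpos x hx).eq_or_lt with rfl | hx
  · simp [ht.le]
  · rw [decay_of_pos 0 ht hx, pow_zero, one_mul, Real.norm_eq_abs, abs_le]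
    have h1 : Real.exp (-(t * x⁻¹)) ≤ 1 := Real.exp_le_one_iff.2 (by
      have : 0 ≤ t * x⁻¹ := by positivity
      linarith)
    have h3 := Real.add_one_le_exp (-(t * x⁻¹))
    have h4 : t * x⁻¹ * x = t := by field_simp
    constructor <;> nlinarith

/-- On the range of N the convergence has rate t by `norm_heatOp_mul_sub_le`. The range is dense in
(ker N)ᗮ since N is self-adjoint, and the operators are contractions. -/
theorem tendsto_heatOp_zero_apply (hN : IsSelfAdjoint N) (hpos : ∀ x ∈ spectrum ℝ N, 0 ≤ x)
    {F : H} (hF : F ∈ N.kerᗮ) :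
    Tendsto (fun t => heatOp N 0 t F) (𝓝[>] 0) (𝓝 F) := by
  have hrange : (N.kerᗮ : Submodule ℂ H) = N.range.topologicalClosure := by
    have h := ContinuousLinearMap.orthogonal_ker N
    rw [h, (ContinuousLinearMap.isSelfAdjoint_iff'.1 hN)]
  rw [hrange] at hF
  rw [Metric.tendsto_nhds]
  intro ε hε
  obtain ⟨_, ⟨G, rfl⟩, hG⟩ := Metric.mem_closure_iff.1 hF (ε / 3) (by positivity)
  have hlim : Tendsto (fun t : ℝ => t * ‖G‖) (𝓝[>] 0) (𝓝 0) := by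
    have : Tendsto (fun t : ℝ => t * ‖G‖) (𝓝 0) (𝓝 (0 * ‖G‖)) := tendsto_id.mul_const _
    rw [zero_mul] at this
    exact this.mono_left nhdsWithin_le_nhds
  filter_upwards [self_mem_nhdsWithin, hlim.eventually (gt_mem_nhds (show 0 < ε / 3 by positivity))]
    with t ht htε
  have h1 : ‖heatOp N 0 t (F - N G)‖ ≤ ‖F - N G‖ := by
    refine (ContinuousLinearMap.le_opNorm _ _).trans ?_
    have := norm_heatOp_zero_le (N := N) ht
    nlinarith [norm_nonneg (F - N G)]
  have h2 : ‖heatOp N 0 t (N G) - N G‖ ≤ t * ‖G‖ := by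
    have := ((heatOp N 0 t * N - N).le_opNorm G)
    refine le_trans this ?_
    gcongr
    exact norm_heatOp_mul_sub_le hN hpos ht
  rw [dist_eq_norm] at hG ⊢
  have h3 : heatOp N 0 t F - F =
    heatOp N 0 t (F - N G) + (heatOp N 0 t (N G) - N G) - (F - N G) := by
    rw [map_sub]; abel
  rw [h3]
  calc _ ≤ ‖heatOp N 0 t (F - N G)‖ + ‖heatOp N 0 t (N G) - N G‖ + ‖F - N G‖ :=
        (norm_sub_le _ _).trans (by gcongr; exact norm_add_le _ _)
    _ < ε := by linarith [show ‖F - N G‖ < ε / 3 from hG]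

theorem heatOp_apply_of_mem_ker (hN : IsSelfAdjoint N) (j : ℕ) {t : ℝ} (ht : 0 < t) {F : H}
    (hF : N F = 0) : heatOp N j t F = 0 := by
  rw [← heatOp_succ_mul hN j ht, mul_apply_eq_comp, hF, map_zero]

/-- The spectra eventually lie in one compact ball, where the function is continuous, so the
functional calculus is continuous in the operator. The limit σ ↓ 0 rests on this: it concerns
bounded Green operators, not generators with varying domains. -/
theorem tendsto_heatOp [Nontrivial H] {ι : Type*} {l : Filter ι} {M : ι → H →L[ℂ] H} (j : ℕ) {t : ℝ} (ht : 0 < t)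
    (hM : ∀ i, IsSelfAdjoint (M i)) (hN : IsSelfAdjoint N) (h : Tendsto M l (𝓝 N)) :
    Tendsto (fun i => heatOp (M i) j t) l (𝓝 (heatOp N j t)) := by
  have hb : ∀ᶠ i in l, ‖M i‖ ≤ ‖N‖ + 1 := by
    filter_upwards [h.norm.eventually (gt_mem_nhds (lt_add_one ‖N‖))] with i hi using hi.le
  refine Tendsto.cfc (𝕜 := ℝ) (isCompact_closedBall (0 : ℝ) (‖N‖ + 1)) (decay j t) h ?_
    (.of_forall hM) ?_ hN (continuous_decay j ht).continuousOn
  · filter_upwards [hb] with i hi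
    intro x hx
    exact mem_closedBall_zero_iff.2 ((spectrum.norm_le_norm_of_mem hx).trans hi)
  · intro x hx
    exact mem_closedBall_zero_iff.2 ((spectrum.norm_le_norm_of_mem hx).trans (by linarith))

end Operators

/-! ### The state space and its model. -/

/-- A complex Hilbert space whose elements `state g a b` model states with density `g` on `(0,1)` and
with masses `a`, `b` in two reservoirs. -/
structure StateSpace (H : Type*) [NormedAddCommGroup H] [InnerProductSpace ℂ H] where
  state : (ℝ → ℝ) → ℝ → ℝ → H
  inner_state : ∀ {g g' : ℝ → ℝ} (a b a' b' : ℝ), MemLp g 2 (volume.restrict (Ioo (0 : ℝ) 1)) →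
    MemLp g' 2 (volume.restrict (Ioo (0 : ℝ) 1)) →
    inner ℂ (state g a b) (state g' a' b') =
      (((∫ x in (0 : ℝ)..1, g x * g' x) + a * a' + b * b' : ℝ) : ℂ)
  total : ∀ F : H, (∀ y ∈ Icc (0 : ℝ) 1, inner ℂ (state ((Ioo y 1).indicator 1) 0 1) F = 0) →
    inner ℂ (state 0 1 0) F = 0 → F = 0
  -- The evolution of a real state is not shown to be real, so densities and contents are read off
  -- by real parts of pairings. This field says that the real parts against the test states
  -- determine those against every real state.
  total_re : ∀ F : H, (∀ y ∈ Icc (0 : ℝ) 1,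
      (inner ℂ (state ((Ioo y 1).indicator 1) 0 1) F).re = 0) →
    (inner ℂ (state 0 1 0) F).re = 0 → ∀ (g : ℝ → ℝ) (a b : ℝ),
    MemLp g 2 (volume.restrict (Ioo (0 : ℝ) 1)) → (inner ℂ (state g a b) F).re = 0

/-- The concrete model `L²(0,1) ⊕ ℂ ⊕ ℂ`. -/
abbrev StateModel : Type :=
  WithLp 2 (WithLp 2 (Lp ℂ 2 (volume.restrict (Ioo (0 : ℝ) 1)) × ℂ) × ℂ)

/-- The primitive vanishes identically, and by Lebesgue differentiation f is almost everywhere its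
derivative. -/
theorem MeasureTheory.ae_eq_zero_of_integral_Ioo_one {f : ℝ → ℂ}
    (hf : Integrable f (volume.restrict (Ioo (0 : ℝ) 1)))
    (h : ∀ y ∈ Icc (0 : ℝ) 1, ∫ x in Ioo y 1, f x ∂(volume.restrict (Ioo (0 : ℝ) 1)) = 0) :
    f =ᵐ[volume.restrict (Ioo (0 : ℝ) 1)] 0 := by
  have hii : IntervalIntegrable f volume 0 1 :=
    (intervalIntegrable_iff_integrableOn_Ioo_of_le zero_le_one).2 hf
  have h0 : ∀ y ∈ Icc (0 : ℝ) 1, ∫ x in (1 : ℝ)..y, f x = 0 := by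
    intro y hy
    rw [intervalIntegral.integral_symm, intervalIntegral.integral_of_le hy.2,
      integral_Ioc_eq_integral_Ioo]
    have := h y hy
    rw [Measure.restrict_restrict measurableSet_Ioo,
      inter_eq_left.2 (Ioo_subset_Ioo_left hy.1)] at this
    rw [this, neg_zero]
  rw [EventuallyEq, ae_restrict_iff' measurableSet_Ioo]
  filter_upwards [hii.ae_hasDerivAt_integral] with x hx hx01
  have h1 := hx (by rw [uIcc_of_le zero_le_one]; exact Ioo_subset_Icc_self hx01) 1
    (right_mem_uIcc)
  refine h1.unique ((hasDerivAt_const x (0 : ℂ)).congr_of_eventuallyEq ?_)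
  filter_upwards [Ioo_mem_nhds hx01.1 hx01.2] with y hy
  exact h0 y (Ioo_subset_Icc_self hy)

open Classical in
/-- The embedding of states with a real density into `StateModel`. -/
noncomputable def StateModel.ofState (g : ℝ → ℝ) (a b : ℝ) : StateModel :=
  WithLp.toLp 2 (WithLp.toLp 2 ((if h : MemLp (fun x => (g x : ℂ)) 2
    (volume.restrict (Ioo (0 : ℝ) 1)) then h.toLp else 0), (a : ℂ)), (b : ℂ))

theorem StateModel.inner_ofState {g : ℝ → ℝ} (a b : ℝ)
    (hg : MemLp g 2 (volume.restrict (Ioo (0 : ℝ) 1))) (F : StateModel) :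
    inner ℂ (StateModel.ofState g a b) F =
      (∫ x in Ioo (0 : ℝ) 1, (g x : ℂ) * (F.fst.fst : ℝ → ℂ) x) + a * F.fst.snd + b * F.snd := by
  have h : MemLp (fun x => (g x : ℂ)) 2 (volume.restrict (Ioo (0 : ℝ) 1)) := hg.ofReal
  have h1 : inner ℂ (h.toLp) F.fst.fst =
      ∫ x in Ioo (0 : ℝ) 1, (g x : ℂ) * (F.fst.fst : ℝ → ℂ) x := by
    rw [L2.inner_def]
    refine integral_congr_ae ?_
    filter_upwards [h.coeFn_toLp] with x hx
    rw [hx]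
    simp [mul_comm]
  rw [WithLp.prod_inner_apply, WithLp.prod_inner_apply]
  simp only [StateModel.ofState, dif_pos h]
  erw [h1]
  simp [mul_comm]

theorem memLp_indicator_Ioo (y : ℝ) : MemLp ((Ioo y 1).indicator (1 : ℝ → ℝ)) 2
    (volume.restrict (Ioo (0 : ℝ) 1)) :=
  (memLp_const (1 : ℝ)).indicator measurableSet_Ioo

/-- `L²(0,1) ⊕ ℂ ⊕ ℂ` is a state space. -/
noncomputable def StateModel.stateSpace : StateSpace StateModel where
  state := StateModel.ofState
  inner_state := by
    intro g g' a b a' b' hg hg'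
    have h : MemLp (fun x => (g' x : ℂ)) 2 (volume.restrict (Ioo (0 : ℝ) 1)) := hg'.ofReal
    rw [StateModel.inner_ofState a b hg, intervalIntegral.integral_of_le zero_le_one,
      integral_Ioc_eq_integral_Ioo]
    have h1 : (∫ x in Ioo (0 : ℝ) 1, (g x : ℂ) * (h.toLp : ℝ → ℂ) x) =
        ((∫ x in Ioo (0 : ℝ) 1, g x * g' x : ℝ) : ℂ) := by
      rw [← integral_complex_ofReal]
      refine integral_congr_ae ?_
      filter_upwards [h.coeFn_toLp] with x hx
      rw [hx, Complex.ofReal_mul]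
    simp only [StateModel.ofState, dif_pos h]
    erw [h1]
    push_cast
    rfl
  total := by
    intro F hF h0
    have hint : Integrable (F.fst.fst : ℝ → ℂ) (volume.restrict (Ioo (0 : ℝ) 1)) :=
      (Lp.memLp F.fst.fst).integrable (by norm_num)
    have ha : F.fst.snd = 0 := by
      rw [StateModel.inner_ofState 1 0 MemLp.zero] at h0
      simpa using h0
    have hy : ∀ y ∈ Icc (0 : ℝ) 1,
        (∫ x in Ioo y 1, (F.fst.fst : ℝ → ℂ) x ∂(volume.restrict (Ioo (0 : ℝ) 1))) + F.snd = 0 := by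
      intro y hy
      have := hF y hy
      rw [StateModel.inner_ofState 0 1 (memLp_indicator_Ioo y)] at this
      rw [← integral_indicator measurableSet_Ioo]
      have h2 : ∀ x, ((Ioo y 1).indicator (F.fst.fst : ℝ → ℂ) x) =
          (((Ioo y 1).indicator (1 : ℝ → ℝ) x : ℝ) : ℂ) * (F.fst.fst : ℝ → ℂ) x := by
        intro x
        by_cases hx : x ∈ Ioo y 1 <;> simp [hx]
      simp only [h2]
      simpa using this
    have hb : F.snd = 0 := by simpa using hy 1 (by simp)
    have hz := ae_eq_zero_of_integral_Ioo_one hint (fun y h => by simpa [hb] using hy y h)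
    have hz2 : F.fst.fst = 0 := (Lp.eq_zero_iff_ae_eq_zero).2 hz
    apply WithLp.ofLp_injective
    refine Prod.ext ?_ hb
    apply WithLp.ofLp_injective
    exact Prod.ext hz2 ha

  total_re := by
    intro F hF h0 g a b hg
    have hmem : MemLp (F.fst.fst : ℝ → ℂ) 2 (volume.restrict (Ioo (0 : ℝ) 1)) :=
      Lp.memLp F.fst.fst
    have hint := hmem.integrable (by norm_num)
    have ha : F.fst.snd.re = 0 := by
      rw [StateModel.inner_ofState 1 0 MemLp.zero] at h0
      simpa using h0
    have hre : ∀ k : ℝ → ℝ, MemLp k 2 (volume.restrict (Ioo (0 : ℝ) 1)) →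
        (∫ x in Ioo (0 : ℝ) 1, (k x : ℂ) * (F.fst.fst : ℝ → ℂ) x).re =
        ∫ x in Ioo (0 : ℝ) 1, k x * ((F.fst.fst : ℝ → ℂ) x).re := by
      intro k hk
      have hi : Integrable (fun x => (k x : ℂ) * (F.fst.fst : ℝ → ℂ) x)
        (volume.restrict (Ioo (0 : ℝ) 1)) := hk.ofReal.integrable_mul hmem
      have := integral_re hi
      simp only [RCLike.re_eq_complex_re, Complex.re_ofReal_mul] at this
      rw [this]
    have hy : ∀ y ∈ Icc (0 : ℝ) 1,
        (∫ x in Ioo y 1, ((F.fst.fst : ℝ → ℂ) x).re ∂(volume.restrict (Ioo (0 : ℝ) 1)))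
          + F.snd.re = 0 := by
      intro y hy
      have := hF y hy
      rw [StateModel.inner_ofState 0 1 (memLp_indicator_Ioo y), Complex.add_re, Complex.add_re,
        hre _ (memLp_indicator_Ioo y)] at this
      rw [← integral_indicator measurableSet_Ioo]
      have h2 : ∀ x, ((Ioo y 1).indicator (fun x => ((F.fst.fst : ℝ → ℂ) x).re) x) =
          (Ioo y 1).indicator (1 : ℝ → ℝ) x * ((F.fst.fst : ℝ → ℂ) x).re := by
        intro x
        by_cases hx : x ∈ Ioo y 1 <;> simp [hx]
      simp only [h2]
      simpa using this
    have hb : F.snd.re = 0 := by simpa using hy 1 (by simp)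
    have hz := ae_eq_zero_of_integral_Ioo_one (f := fun x => (((F.fst.fst : ℝ → ℂ) x).re : ℂ))
      hint.re.ofReal (fun y h => by
        rw [integral_complex_ofReal]
        have := hy y h
        rw [hb, add_zero] at this
        rw [this, Complex.ofReal_zero])
    rw [StateModel.inner_ofState a b hg, Complex.add_re, Complex.add_re, hre g hg,
      Complex.re_ofReal_mul, Complex.re_ofReal_mul, ha, hb, mul_zero, mul_zero, add_zero, add_zero]
    refine integral_eq_zero_of_ae ?_
    filter_upwards [hz] with x hx
    have : ((F.fst.fst : ℝ → ℂ) x).re = 0 := by simpa using hx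
    simp [this]

instance : Nontrivial StateModel := ⟨0, StateModel.ofState 0 1 0, fun h => by
  have := StateModel.inner_ofState 1 0 MemLp.zero (StateModel.ofState 0 1 0)
  rw [← h] at this
  have h2 := congrArg (fun F : StateModel => F.fst.snd) h
  simp [StateModel.ofState] at h2⟩

-- The mass functionals and their inner products.

attribute [local instance] InnerProductSpace.complexToReal

namespace StateSpace

variable {H : Type*} [NormedAddCommGroup H] [InnerProductSpace ℂ H] (X : StateSpace H)

theorem inner_state_real {g g' : ℝ → ℝ} (a b a' b' : ℝ)
    (hg : MemLp g 2 (volume.restrict (Ioo (0 : ℝ) 1)))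
    (hg' : MemLp g' 2 (volume.restrict (Ioo (0 : ℝ) 1))) :
    inner ℝ (X.state g a b) (X.state g' a' b') =
      (∫ x in (0 : ℝ)..1, g x * g' x) + a * a' + b * b' := by
  rw [real_inner_eq_re_inner ℂ, X.inner_state a b a' b' hg hg']
  exact Complex.ofReal_re _

/-- The functional `kap y` measures the mass in `(y,1)` together with the right reservoir. -/
noncomputable def kap (y : ℝ) : H := X.state ((Ioo (max 0 (min y 1)) 1).indicator 1) 0 1

/-- The left reservoir. -/
noncomputable def leftMass : H := X.state 0 1 0

/-- The constant state. -/
noncomputable def one : H := X.state 1 1 1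

theorem kap_of_mem {y : ℝ} (hy : y ∈ Icc (0 : ℝ) 1) :
    X.kap y = X.state ((Ioo y 1).indicator 1) 0 1 := by
  rw [kap, min_eq_left hy.2, max_eq_right hy.1]

theorem memLp_one : MemLp (1 : ℝ → ℝ) 2 (volume.restrict (Ioo (0 : ℝ) 1)) := memLp_const 1

theorem clamp_mem (y : ℝ) : max 0 (min y 1) ∈ Icc (0 : ℝ) 1 :=
  ⟨le_max_left _ _, max_le zero_le_one (min_le_right _ _)⟩

theorem kap_clamp (y : ℝ) : X.kap (max 0 (min y 1)) = X.kap y := by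
  rw [X.kap_of_mem (clamp_mem y), kap]

theorem integral_indicator_mul {y : ℝ} (hy : y ∈ Icc (0 : ℝ) 1) (g : ℝ → ℝ) :
    ∫ x in (0 : ℝ)..1, (Ioo y 1).indicator (1 : ℝ → ℝ) x * g x = ∫ x in y..1, g x := by
  rw [intervalIntegral.integral_of_le zero_le_one, intervalIntegral.integral_of_le hy.2,
    integral_Ioc_eq_integral_Ioo, integral_Ioc_eq_integral_Ioo]
  have h : ∀ x, (Ioo y 1).indicator (1 : ℝ → ℝ) x * g x = (Ioo y 1).indicator g x := by
    intro x
    by_cases hx : x ∈ Ioo y 1 <;> simp [hx]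
  simp only [h]
  rw [integral_indicator measurableSet_Ioo, Measure.restrict_restrict measurableSet_Ioo,
    inter_eq_left.2 (Ioo_subset_Ioo_left hy.1)]

theorem inner_kap_state {y : ℝ} (hy : y ∈ Icc (0 : ℝ) 1) {g : ℝ → ℝ} (a b : ℝ)
    (hg : MemLp g 2 (volume.restrict (Ioo (0 : ℝ) 1))) :
    inner ℂ (X.kap y) (X.state g a b) = (((∫ x in y..1, g x) + b : ℝ) : ℂ) := by
  rw [X.kap_of_mem hy, X.inner_state _ _ _ _ (memLp_indicator_Ioo y) hg, integral_indicator_mul hy]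
  simp

theorem inner_kap_state_real {y : ℝ} (hy : y ∈ Icc (0 : ℝ) 1) {g : ℝ → ℝ} (a b : ℝ)
    (hg : MemLp g 2 (volume.restrict (Ioo (0 : ℝ) 1))) :
    inner ℝ (X.kap y) (X.state g a b) = (∫ x in y..1, g x) + b := by
  rw [real_inner_eq_re_inner ℂ, X.inner_kap_state hy a b hg]
  exact Complex.ofReal_re _

theorem inner_leftMass_state {g : ℝ → ℝ} (a b : ℝ)
    (hg : MemLp g 2 (volume.restrict (Ioo (0 : ℝ) 1))) :
    inner ℂ X.leftMass (X.state g a b) = ((a : ℝ) : ℂ) := by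
  rw [leftMass, X.inner_state _ _ _ _ MemLp.zero hg]
  simp

theorem inner_leftMass_state_real {g : ℝ → ℝ} (a b : ℝ)
    (hg : MemLp g 2 (volume.restrict (Ioo (0 : ℝ) 1))) :
    inner ℝ X.leftMass (X.state g a b) = a := by
  rw [real_inner_eq_re_inner ℂ, X.inner_leftMass_state a b hg]
  exact Complex.ofReal_re _

theorem integral_indicator_Ioo {y z : ℝ} (hy : y ∈ Icc (0 : ℝ) 1) (hz : z ∈ Icc (0 : ℝ) 1) :
    ∫ x in y..1, (Ioo z 1).indicator (1 : ℝ → ℝ) x = 1 - max y z := by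
  rw [intervalIntegral.integral_of_le hy.2, integral_Ioc_eq_integral_Ioo,
    integral_indicator measurableSet_Ioo, Measure.restrict_restrict measurableSet_Ioo,
    Ioo_inter_Ioo]
  simp only [Pi.one_apply, min_self, integral_const, smul_eq_mul, mul_one, measureReal_restrict_apply,
    MeasurableSet.univ, univ_inter, Real.volume_real_Ioo]
  rw [max_comm z y]
  exact max_eq_left (sub_nonneg.2 (max_le hy.2 hz.2))

theorem inner_kap_kap {y z : ℝ} (hy : y ∈ Icc (0 : ℝ) 1) (hz : z ∈ Icc (0 : ℝ) 1) :
    inner ℂ (X.kap y) (X.kap z) = ((2 - max y z : ℝ) : ℂ) := by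
  rw [X.kap_of_mem hz, X.inner_kap_state hy 0 1 (memLp_indicator_Ioo z),
    integral_indicator_Ioo hy hz]
  congr 1; ring

theorem inner_kap_one {y : ℝ} (hy : y ∈ Icc (0 : ℝ) 1) :
    inner ℂ (X.kap y) X.one = ((2 - y : ℝ) : ℂ) := by
  rw [one, X.inner_kap_state hy 1 1 memLp_one]
  simp only [Pi.one_apply, intervalIntegral.integral_const, smul_eq_mul, mul_one]
  congr 1; ring

theorem inner_leftMass_kap (y : ℝ) : inner ℂ X.leftMass (X.kap y) = ((0 : ℝ) : ℂ) :=
  X.inner_leftMass_state 0 1 (memLp_indicator_Ioo _)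

theorem inner_leftMass_one : inner ℂ X.leftMass X.one = ((1 : ℝ) : ℂ) :=
  X.inner_leftMass_state 1 1 memLp_one

theorem inner_one_one : inner ℂ X.one X.one = ((3 : ℝ) : ℂ) := by
  rw [one, X.inner_state _ _ _ _ memLp_one memLp_one]
  congr 1
  simp only [Pi.one_apply, intervalIntegral.integral_const, smul_eq_mul]
  norm_num

/-- The masses of (y,1) with the right reservoir, together with the left reservoir, separate points.
Every identity between states below is checked on these functionals. -/
theorem ext {F G : H} (h : ∀ y ∈ Icc (0 : ℝ) 1, inner ℂ (X.kap y) F = inner ℂ (X.kap y) G)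
    (h0 : inner ℂ X.leftMass F = inner ℂ X.leftMass G) : F = G := by
  rw [← sub_eq_zero]
  refine X.total _ (fun y hy => ?_) ?_
  · rw [← X.kap_of_mem hy, inner_sub_right, h y hy, sub_self]
  · exact (inner_sub_right _ _ _).trans (sub_eq_zero.2 h0)

theorem ext_real {F G : H} (h : ∀ y ∈ Icc (0 : ℝ) 1, inner ℝ (X.kap y) F = inner ℝ (X.kap y) G)
    (h0 : inner ℝ X.leftMass F = inner ℝ X.leftMass G) {g : ℝ → ℝ} (a b : ℝ)
    (hg : MemLp g 2 (volume.restrict (Ioo (0 : ℝ) 1))) :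
    inner ℝ (X.state g a b) F = inner ℝ (X.state g a b) G := by
  rw [← sub_eq_zero, ← inner_sub_right, real_inner_eq_re_inner ℂ]
  refine X.total_re _ (fun y hy => ?_) ?_ g a b hg
  · rw [← X.kap_of_mem hy]
    have := sub_eq_zero.2 (h y hy)
    rwa [← inner_sub_right, real_inner_eq_re_inner ℂ] at this
  · have := sub_eq_zero.2 h0
    rwa [← inner_sub_right, real_inner_eq_re_inner ℂ] at this

theorem leftMass_add_kap_zero : X.leftMass + X.kap 0 = X.one := by
  have h0 : (0 : ℝ) ∈ Icc (0 : ℝ) 1 := ⟨le_rfl, zero_le_one⟩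
  refine X.ext (fun y hy => ?_) ?_
  · rw [inner_add_right, X.inner_kap_kap hy h0, X.inner_kap_one hy, leftMass,
      X.inner_kap_state hy 1 0 MemLp.zero]
    simp [hy.1]
  · rw [inner_add_right, X.inner_leftMass_kap, X.inner_leftMass_one, leftMass,
      ← leftMass, leftMass, X.inner_state _ _ _ _ MemLp.zero MemLp.zero]
    simp

/-- The two states differ by an indicator, whose squared norm is the distance between the clamped
points. Clamping to [0,1] makes `kap` continuous on the whole line. -/
theorem norm_kap_sub_sq (y z : ℝ) : ‖X.kap y - X.kap z‖ ^ 2 ≤ |y - z| := by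
  have hb : |max 0 (min y 1) - max 0 (min z 1)| ≤ |y - z| := by
    have h1 := abs_max_sub_max_le_max 0 (min y 1) 0 (min z 1)
    have h2 := abs_min_sub_min_le_max y 1 z 1
    exact h1.trans (max_le (by simp) (h2.trans (max_le le_rfl (by simp))))
  refine le_trans (le_of_eq ?_) hb
  rw [← X.kap_clamp y, ← X.kap_clamp z]
  generalize hy' : max 0 (min y 1) = y'
  generalize hz' : max 0 (min z 1) = z'
  have hy : y' ∈ Icc (0 : ℝ) 1 := hy' ▸ clamp_mem y
  have hz : z' ∈ Icc (0 : ℝ) 1 := hz' ▸ clamp_mem z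
  have h := norm_sub_sq (𝕜 := ℂ) (X.kap y') (X.kap z')
  have e1 := inner_self_eq_norm_sq (𝕜 := ℂ) (X.kap y')
  have e2 := inner_self_eq_norm_sq (𝕜 := ℂ) (X.kap z')
  rw [X.inner_kap_kap hy hy] at e1
  rw [X.inner_kap_kap hz hz] at e2
  rw [X.inner_kap_kap hy hz, ← e1, ← e2] at h
  simp only [RCLike.re_eq_complex_re, Complex.ofReal_re, max_self] at h
  rw [h]
  rcases le_total y' z' with hh | hh
  · rw [max_eq_right hh, abs_of_nonpos (by linarith)]; ring
  · rw [max_eq_left hh, abs_of_nonneg (by linarith)]; ring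

theorem continuous_kap : Continuous X.kap := by
  rw [Metric.continuous_iff]
  intro y ε hε
  refine ⟨ε ^ 2, by positivity, fun z hz => ?_⟩
  rw [dist_eq_norm]
  refine lt_of_pow_lt_pow_left₀ 2 hε.le ((X.norm_kap_sub_sq z y).trans_lt ?_)
  rwa [Real.dist_eq] at hz

end StateSpace

/-! ### The Green operator: positivity and kernel. -/

namespace StateSpace

variable {H : Type*} [NormedAddCommGroup H] [InnerProductSpace ℂ H] [CompleteSpace H]
  (X : StateSpace H)

open InnerProductSpace ContinuousLinearMap
open scoped ComplexOrder

/-- The primitive of `kap` vanishing at `0`. -/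
noncomputable def kapInt (r : ℝ) : H := ∫ z in (0 : ℝ)..r, X.kap z

theorem hasDerivAt_kapInt (r : ℝ) : HasDerivAt X.kapInt (X.kap r) r :=
  intervalIntegral.integral_hasDerivAt_right (X.continuous_kap.intervalIntegrable _ _)
    (X.continuous_kap.stronglyMeasurableAtFilter _ _) X.continuous_kap.continuousAt

theorem continuous_kapInt : Continuous X.kapInt :=
  continuous_iff_continuousAt.2 fun r => (X.hasDerivAt_kapInt r).continuousAt

theorem kapInt_zero : X.kapInt 0 = 0 := intervalIntegral.integral_same

/-- The operator `∫₀¹ kap z ⊗ kap z dz`. -/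
noncomputable def bulkOp : H →L[ℂ] H := ∫ z in (0 : ℝ)..1, rankOne ℂ (X.kap z) (X.kap z)

theorem continuous_rankOne_kap : Continuous fun z => rankOne ℂ (X.kap z) (X.kap z) := by
  have h := X.continuous_kap
  have h2 : Continuous fun z => (innerSL ℂ (X.kap z)) := (innerSL ℂ).continuous.comp h
  have h3 : Continuous fun z => ContinuousLinearMap.toSpanSingleton ℂ (X.kap z) :=
    (ContinuousLinearMap.toSpanSingletonCLE (𝕜 := ℂ) (E := H)).continuous.comp h
  simp only [rankOne_def']
  exact h3.clm_comp h2

theorem bulkOp_apply (F : H) : X.bulkOp F = ∫ z in (0 : ℝ)..1, inner ℂ (X.kap z) F • X.kap z := by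
  rw [bulkOp, ContinuousLinearMap.intervalIntegral_apply
    (X.continuous_rankOne_kap.intervalIntegrable _ _)]
  simp only [rankOne_apply]

theorem inner_bulkOp (G F : H) : inner ℂ G (X.bulkOp F) =
    ∫ z in (0 : ℝ)..1, inner ℂ (X.kap z) F * inner ℂ G (X.kap z) := by
  have hc : Continuous fun z => inner ℂ (X.kap z) F • X.kap z :=
    (X.continuous_kap.inner continuous_const).smul X.continuous_kap
  have := (innerSL ℂ G).intervalIntegral_comp_comm (hc.intervalIntegrable (μ := volume) 0 1)
  rw [X.bulkOp_apply, ← innerSL_apply_apply ℂ, ← this]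
  simp only [innerSL_apply_apply, inner_smul_right]

theorem inner_rankOne_real {G x : H} {c : ℝ} (h : inner ℂ G x = (c : ℂ)) (y F : H) :
    inner ℝ G (rankOne ℂ x y F) = c * inner ℝ y F := by
  rw [rankOne_apply, real_inner_eq_re_inner ℂ, inner_smul_right, h, mul_comm,
    RCLike.re_eq_complex_re, Complex.re_ofReal_mul, real_inner_eq_re_inner ℂ]
  rfl

theorem inner_bulkOp_real {G : H} {g : ℝ → ℝ}
    (h : ∀ z ∈ Icc (0 : ℝ) 1, inner ℂ G (X.kap z) = (g z : ℂ)) (F : H) :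
    inner ℝ G (X.bulkOp F) = ∫ z in (0 : ℝ)..1, g z * inner ℝ (X.kap z) F := by
  have hc : Continuous fun z => inner ℂ (X.kap z) F * inner ℂ G (X.kap z) :=
    (X.continuous_kap.inner continuous_const).mul (continuous_const.inner X.continuous_kap)
  rw [real_inner_eq_re_inner ℂ, X.inner_bulkOp]
  have := Complex.reCLM.intervalIntegral_comp_comm (hc.intervalIntegrable (μ := volume) 0 1)
  rw [RCLike.re_eq_complex_re, ← Complex.reCLM_apply, ← this]
  refine intervalIntegral.integral_congr fun z hz => ?_
  rw [uIcc_of_le zero_le_one] at hz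
  simp only [h z hz, Complex.reCLM_apply, Complex.re_mul_ofReal]
  rw [mul_comm, real_inner_eq_re_inner ℂ]
  rfl

theorem inner_self_bulkOp (F : H) : inner ℂ F (X.bulkOp F) =
    ((∫ z in (0 : ℝ)..1, ‖inner ℂ (X.kap z) F‖ ^ 2 : ℝ) : ℂ) := by
  rw [X.inner_bulkOp, ← intervalIntegral.integral_ofReal]
  refine intervalIntegral.integral_congr fun z _ => ?_
  rw [← inner_conj_symm F, RCLike.mul_conj]
  norm_cast

theorem isPositive_bulkOp : X.bulkOp.IsPositive := by
  rw [isPositive_iff_complex]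
  intro F
  have h : inner ℂ (X.bulkOp F) F =
      ((∫ z in (0 : ℝ)..1, ‖inner ℂ (X.kap z) F‖ ^ 2 : ℝ) : ℂ) := by
    rw [← inner_conj_symm, X.inner_self_bulkOp, Complex.conj_ofReal]
  rw [h]
  refine ⟨rfl, ?_⟩
  rw [RCLike.re_eq_complex_re, Complex.ofReal_re]
  exact intervalIntegral.integral_nonneg zero_le_one fun z _ => sq_nonneg _

/-- The contribution of the reservoir exchange. -/
noncomputable def edgeOp : H →L[ℂ] H :=
  rankOne ℂ (X.kap 0) (X.kap 0) + rankOne ℂ (X.kap 1) (X.kap 1)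

/-- The projection onto states of mean zero. -/
noncomputable def centre : H →L[ℂ] H := 1 - (1 / 3 : ℂ) • rankOne ℂ X.one X.one

theorem centre_apply (F : H) : X.centre F = F - ((1 / 3 : ℂ) * inner ℂ X.one F) • X.one := by
  simp [centre, smul_smul]

/-- The Green operator before centring. -/
noncomputable def preGreen (σ : ℝ) : H →L[ℂ] H := (2 : ℂ) • X.bulkOp + (σ : ℂ) • X.edgeOp

/-- The Green operator: the pseudo-inverse of minus the generator with parameter `σ`. -/
noncomputable def green (σ : ℝ) : H →L[ℂ] H := X.centre ∘L X.preGreen σ ∘L X.centre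

theorem isPositive_rankOne_one : (rankOne ℂ X.one X.one).IsPositive := isPositive_rankOne_self _

theorem adjoint_centre : adjoint X.centre = X.centre := by
  rw [← isSelfAdjoint_iff', centre]
  refine IsSelfAdjoint.sub (.one _) ?_
  have h : (0 : ℂ) ≤ 1 / 3 := by
    rw [Complex.le_def]; norm_num
  exact (X.isPositive_rankOne_one.smul_of_nonneg h).isSelfAdjoint

theorem centre_one : X.centre X.one = 0 := by
  rw [X.centre_apply, X.inner_one_one]
  norm_num

theorem centre_centre (F : H) : X.centre (X.centre F) = X.centre F := by
  conv_lhs => rw [X.centre_apply F, map_sub, map_smul, X.centre_one, smul_zero, sub_zero]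

theorem inner_one_centre (F : H) : inner ℂ X.one (X.centre F) = 0 := by
  conv_lhs => rw [← X.adjoint_centre]
  rw [adjoint_inner_right, X.centre_one, inner_zero_left]

theorem isPositive_preGreen {σ : ℝ} (hσ : 0 ≤ σ) : (X.preGreen σ).IsPositive := by
  refine (X.isPositive_bulkOp.smul_of_nonneg (by rw [Complex.le_def]; norm_num)).add
    (IsPositive.smul_of_nonneg ?_ (by rw [Complex.le_def]; simpa using hσ))
  exact (isPositive_rankOne_self _).add (isPositive_rankOne_self _)

theorem isPositive_green {σ : ℝ} (hσ : 0 ≤ σ) : (X.green σ).IsPositive := by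
  have h := (X.isPositive_preGreen hσ).conj_adjoint X.centre
  rwa [X.adjoint_centre] at h

theorem isSelfAdjoint_green {σ : ℝ} (hσ : 0 ≤ σ) : IsSelfAdjoint (X.green σ) :=
  (X.isPositive_green hσ).isSelfAdjoint

theorem spectrum_green_nonneg {σ : ℝ} (hσ : 0 ≤ σ) : ∀ x ∈ spectrum ℝ (X.green σ), 0 ≤ x :=
  fun _ hx => spectrum_nonneg_of_nonneg ((nonneg_iff_isPositive _).2 (X.isPositive_green hσ)) hx

theorem green_one (σ : ℝ) : X.green σ X.one = 0 := by
  simp [green, X.centre_one]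

theorem centre_green (σ : ℝ) (F : H) : X.centre (X.green σ F) = X.green σ F := by
  simp only [green, ContinuousLinearMap.comp_apply, X.centre_centre]

/-- The quadratic form vanishes, so by continuity ⟨kap z, centre F⟩ = 0 for all z in [0,1]. Mean
zero then removes the left reservoir as well. For σ = 0 the bulk integral alone suffices. -/
theorem centre_eq_zero_of_green_eq_zero {σ : ℝ} (hσ : 0 ≤ σ) {F : H} (hF : X.green σ F = 0) :
    X.centre F = 0 := by
  have h1 : inner ℂ (X.centre F) (X.preGreen σ (X.centre F)) = 0 := by
    rw [← adjoint_inner_right, X.adjoint_centre]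
    change inner ℂ F (X.green σ F) = 0
    rw [hF, inner_zero_right]
  have hedge : X.edgeOp.IsPositive := (isPositive_rankOne_self _).add (isPositive_rankOne_self _)
  have h3 : (∫ z in (0 : ℝ)..1, ‖inner ℂ (X.kap z) (X.centre F)‖ ^ 2) = 0 := by
    have h2 := congrArg Complex.re h1
    have h4 := hedge.re_inner_nonneg_right (X.centre F)
    rw [preGreen, add_apply, smul_apply, smul_apply, inner_add_right, inner_smul_right,
      inner_smul_right, X.inner_self_bulkOp, Complex.add_re, Complex.re_ofReal_mul] at h2
    rw [RCLike.re_eq_complex_re] at h4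
    have h5 : 0 ≤ ∫ z in (0 : ℝ)..1, ‖inner ℂ (X.kap z) (X.centre F)‖ ^ 2 :=
      intervalIntegral.integral_nonneg zero_le_one fun z _ => sq_nonneg _
    have h6 := mul_nonneg hσ h4
    have h7 : ((2 : ℂ) * ((∫ z in (0 : ℝ)..1, ‖inner ℂ (X.kap z) (X.centre F)‖ ^ 2 : ℝ) : ℂ)).re =
      2 * ∫ z in (0 : ℝ)..1, ‖inner ℂ (X.kap z) (X.centre F)‖ ^ 2 := by simp
    rw [h7, Complex.zero_re] at h2
    linarith
  have hc : Continuous fun z => ‖inner ℂ (X.kap z) (X.centre F)‖ ^ 2 :=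
    ((X.continuous_kap.inner continuous_const).norm).pow 2
  have h8 : ∀ z ∈ Icc (0 : ℝ) 1, inner ℂ (X.kap z) (X.centre F) = 0 := by
    intro z hz
    by_contra hne
    have := intervalIntegral.integral_pos (zero_lt_one (α := ℝ)) hc.continuousOn
      (fun x _ => sq_nonneg _) ⟨z, hz, by positivity⟩
    exact this.ne' h3
  refine X.ext (fun y hy => ?_) ?_
  · rw [h8 y hy, inner_zero_right]
  · have := X.inner_one_centre F
    rw [← X.leftMass_add_kap_zero, inner_add_left, h8 0 (by simp), add_zero] at this
    rw [this, inner_zero_right]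

theorem centre_mem_ker_orthogonal {σ : ℝ} (hσ : 0 ≤ σ) (F : H) :
    X.centre F ∈ (X.green σ).kerᗮ := by
  rw [Submodule.mem_orthogonal]
  intro G hG
  rw [← X.adjoint_centre, adjoint_inner_right,
    X.centre_eq_zero_of_green_eq_zero hσ (LinearMap.mem_ker.1 hG), inner_zero_left]

end StateSpace

/-! ### The density and the reservoir contents of `green σ F`. -/

namespace StateSpace

variable {H : Type*} [NormedAddCommGroup H] [InnerProductSpace ℂ H] [CompleteSpace H]
  (X : StateSpace H)

open InnerProductSpace ContinuousLinearMap

/-- The mean of a state. -/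
noncomputable def mean (F : H) : ℝ := 1 / 3 * inner ℝ X.one F

theorem inner_ofReal_smul (c : ℝ) (x F : H) : inner ℝ x ((c : ℂ) • F) = c * inner ℝ x F := by
  rw [real_inner_eq_re_inner ℂ, inner_smul_right, RCLike.re_eq_complex_re, Complex.re_ofReal_mul,
    real_inner_eq_re_inner ℂ]
  rfl

theorem inner_centre_real {x : H} {c : ℝ} (h : inner ℂ x X.one = (c : ℂ)) (F : H) :
    inner ℝ x (X.centre F) = inner ℝ x F - c * X.mean F := by
  have h1 : (1 / 3 : ℂ) = ((1 / 3 : ℝ) : ℂ) := by norm_num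
  rw [centre, sub_apply, smul_apply, inner_sub_right, h1, inner_ofReal_smul,
    inner_rankOne_real h, mean]
  simp only [one_apply_eq_self]
  ring

theorem inner_kap_centre {y : ℝ} (hy : y ∈ Icc (0 : ℝ) 1) (F : H) :
    inner ℝ (X.kap y) (X.centre F) = inner ℝ (X.kap y) F - (2 - y) * X.mean F :=
  X.inner_centre_real (X.inner_kap_one hy) F

theorem inner_kapInt (r : ℝ) (F : H) :
    inner ℝ (X.kapInt r) F = ∫ z in (0 : ℝ)..r, inner ℝ (X.kap z) F := by
  have := (innerSL ℝ F).intervalIntegral_comp_comm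
    (X.continuous_kap.intervalIntegrable (μ := volume) 0 r)
  rw [real_inner_comm, kapInt, ← innerSL_apply_apply ℝ, ← this]
  simp only [innerSL_apply_apply, real_inner_comm]

/-- The mean of the uncentred Green potential. -/
noncomputable def offset (σ : ℝ) (F : H) : ℝ := X.mean (X.preGreen σ (X.centre F))

/-- The density of `green σ F` on `(0,1)`. -/
noncomputable def val (σ : ℝ) (F : H) (r : ℝ) : ℝ :=
  2 * inner ℝ (X.kapInt r) (X.centre F) + σ * inner ℝ (X.kap 0) (X.centre F) - X.offset σ F

theorem zero_mem_unit : (0 : ℝ) ∈ Icc (0 : ℝ) 1 := ⟨le_rfl, zero_le_one⟩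

theorem one_mem_unit : (1 : ℝ) ∈ Icc (0 : ℝ) 1 := ⟨zero_le_one, le_rfl⟩

theorem inner_preGreen_real {G : H} {g : ℝ → ℝ}
    (h : ∀ z ∈ Icc (0 : ℝ) 1, inner ℂ G (X.kap z) = (g z : ℂ)) (σ : ℝ) (F : H) :
    inner ℝ G (X.preGreen σ F) = 2 * (∫ z in (0 : ℝ)..1, g z * inner ℝ (X.kap z) F) +
      σ * (g 0 * inner ℝ (X.kap 0) F + g 1 * inner ℝ (X.kap 1) F) := by
  have h2 : (2 : ℂ) = ((2 : ℝ) : ℂ) := by norm_num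
  rw [preGreen, add_apply, smul_apply, smul_apply, inner_add_right, h2, inner_ofReal_smul,
    inner_ofReal_smul, X.inner_bulkOp_real h, edgeOp, add_apply, inner_add_right,
    inner_rankOne_real (h 0 zero_mem_unit), inner_rankOne_real (h 1 one_mem_unit)]

theorem inner_green_real {G : H} {c : ℝ} (h : inner ℂ G X.one = (c : ℂ)) (σ : ℝ) (F : H) :
    inner ℝ G (X.green σ F) = inner ℝ G (X.preGreen σ (X.centre F)) - c * X.offset σ F :=
  X.inner_centre_real h _

theorem inner_leftMass_green (σ : ℝ) (F : H) :
    inner ℝ X.leftMass (X.green σ F) = -X.offset σ F := by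
  rw [X.inner_green_real X.inner_leftMass_one,
    X.inner_preGreen_real (fun z _ => X.inner_leftMass_kap z)]
  simp

theorem inner_kap_green {y : ℝ} (hy : y ∈ Icc (0 : ℝ) 1) (σ : ℝ) (F : H) :
    inner ℝ (X.kap y) (X.green σ F) =
      2 * (∫ z in (0 : ℝ)..1, (2 - max y z) * inner ℝ (X.kap z) (X.centre F)) +
      σ * ((2 - y) * inner ℝ (X.kap 0) (X.centre F) + inner ℝ (X.kap 1) (X.centre F)) -
      (2 - y) * X.offset σ F := by
  rw [X.inner_green_real (X.inner_kap_one hy),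
    X.inner_preGreen_real (fun z hz => X.inner_kap_kap hy hz), max_eq_left hy.1,
    max_eq_right hy.2]
  ring

theorem inner_kap_one_green (σ : ℝ) (F : H) :
    inner ℝ (X.kap 1) (X.green σ F) = X.val σ F 1 + σ * inner ℝ (X.kap 1) (X.centre F) := by
  rw [X.inner_kap_green one_mem_unit, val, X.inner_kapInt]
  have : ∫ z in (0 : ℝ)..1, (2 - max 1 z) * inner ℝ (X.kap z) (X.centre F) =
      ∫ z in (0 : ℝ)..1, inner ℝ (X.kap z) (X.centre F) := by
    refine intervalIntegral.integral_congr fun z hz => ?_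
    rw [uIcc_of_le zero_le_one] at hz
    simp only [max_eq_left hz.2]
    ring
  rw [this]
  ring

theorem val_zero (σ : ℝ) (F : H) :
    X.val σ F 0 = -X.offset σ F + σ * inner ℝ (X.kap 0) (X.centre F) := by
  rw [val, X.kapInt_zero, inner_zero_left]
  ring

theorem hasDerivAt_val (σ : ℝ) (F : H) (r : ℝ) :
    HasDerivAt (X.val σ F) (2 * inner ℝ (X.kap r) (X.centre F)) r := by
  have h : HasDerivAt (fun r => inner ℝ (X.kapInt r) (X.centre F))
      (inner ℝ (X.kap r) (X.centre F)) r := by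
    simpa using (X.hasDerivAt_kapInt r).inner ℝ (hasDerivAt_const r (X.centre F))
  exact ((h.const_mul 2).add_const _).sub_const _

theorem continuous_val (σ : ℝ) (F : H) : Continuous (X.val σ F) :=
  continuous_iff_continuousAt.2 fun r => (X.hasDerivAt_val σ F r).continuousAt

/-- A smooth extension of `y ↦ ⟪kap y, green σ F⟫`. -/
noncomputable def massExt (σ : ℝ) (F : H) (y : ℝ) : ℝ :=
  2 * ((2 - y) * (∫ z in (0 : ℝ)..y, inner ℝ (X.kap z) (X.centre F)) +
    ((∫ z in (0 : ℝ)..1, (2 - z) * inner ℝ (X.kap z) (X.centre F)) -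
      ∫ z in (0 : ℝ)..y, (2 - z) * inner ℝ (X.kap z) (X.centre F))) +
  σ * ((2 - y) * inner ℝ (X.kap 0) (X.centre F) + inner ℝ (X.kap 1) (X.centre F)) -
  (2 - y) * X.offset σ F

theorem massExt_eq {y : ℝ} (hy : y ∈ Icc (0 : ℝ) 1) (σ : ℝ) (F : H) :
    X.massExt σ F y = inner ℝ (X.kap y) (X.green σ F) := by
  have hm : Continuous fun z => inner ℝ (X.kap z) (X.centre F) :=
    X.continuous_kap.inner continuous_const
  have hc1 : Continuous fun z => (2 - max y z) * inner ℝ (X.kap z) (X.centre F) := by fun_prop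
  have hc2 : Continuous fun z => (2 - z) * inner ℝ (X.kap z) (X.centre F) := by fun_prop
  rw [X.inner_kap_green hy, massExt,
    ← intervalIntegral.integral_add_adjacent_intervals (hc1.intervalIntegrable 0 y)
      (hc1.intervalIntegrable y 1),
    intervalIntegral.integral_interval_sub_left (hc2.intervalIntegrable 0 1)
      (hc2.intervalIntegrable 0 y), ← intervalIntegral.integral_const_mul]
  congr 4
  · refine intervalIntegral.integral_congr fun z hz => ?_
    rw [uIcc_of_le hy.1] at hz
    simp only [max_eq_left hz.2]
  · refine intervalIntegral.integral_congr fun z hz => ?_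
    rw [uIcc_of_le hy.2] at hz
    simp only [max_eq_right hz.1]

/-- Since `kap` is constant outside [0,1], the pairing itself may have kinks at the endpoints.
Splitting the kernel 2 - max y z at z = y gives a formula differentiable on the whole line, in which
the terms from the moving limit y cancel. -/
theorem hasDerivAt_massExt (σ : ℝ) (F : H) (y : ℝ) :
    HasDerivAt (X.massExt σ F) (-X.val σ F y) y := by
  have hm : Continuous fun z => inner ℝ (X.kap z) (X.centre F) :=
    X.continuous_kap.inner continuous_const
  have hc2 : Continuous fun z => (2 - z) * inner ℝ (X.kap z) (X.centre F) := by fun_prop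
  have h1 := intervalIntegral.integral_hasDerivAt_right (hm.intervalIntegrable 0 y)
    (hm.stronglyMeasurableAtFilter _ _) hm.continuousAt
  have h2 := intervalIntegral.integral_hasDerivAt_right (hc2.intervalIntegrable 0 y)
    (hc2.stronglyMeasurableAtFilter _ _) hc2.continuousAt
  have h3 : HasDerivAt (fun y : ℝ => 2 - y) (-1) y := (hasDerivAt_id y).const_sub 2
  refine ((((h3.mul h1).add (h2.const_sub _)).const_mul 2).add
    (((h3.mul_const (inner ℝ (X.kap 0) (X.centre F))).add_const _).const_mul σ) |>.sub
    (h3.mul_const (X.offset σ F))).congr_deriv ?_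
  rw [val, X.inner_kapInt]
  ring

theorem hasDerivWithinAt_inner_kap_green {r : ℝ} (hr : r ∈ Icc (0 : ℝ) 1) (σ : ℝ) (F : H) :
    HasDerivWithinAt (fun y => inner ℝ (X.kap y) (X.green σ F)) (-X.val σ F r) (Icc 0 1) r :=
  (X.hasDerivAt_massExt σ F r).hasDerivWithinAt.congr
    (fun _ hy => (X.massExt_eq hy σ F).symm) (X.massExt_eq hr σ F).symm

theorem inner_kap_green_eq_integral {y : ℝ} (hy : y ∈ Icc (0 : ℝ) 1) (σ : ℝ) (F : H) :
    inner ℝ (X.kap y) (X.green σ F) =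
      (∫ r in y..1, X.val σ F r) + inner ℝ (X.kap 1) (X.green σ F) := by
  have h := intervalIntegral.integral_eq_sub_of_hasDerivAt
    (fun r _ => X.hasDerivAt_massExt σ F r) ((X.continuous_val σ F).neg.intervalIntegrable y 1)
  rw [intervalIntegral.integral_neg, X.massExt_eq one_mem_unit, X.massExt_eq hy] at h
  linarith

theorem memLp_of_continuous {g : ℝ → ℝ} (hg : Continuous g) :
    MemLp g 2 (volume.restrict (Ioo (0 : ℝ) 1)) := by
  obtain ⟨C, hC⟩ := isCompact_Icc.exists_bound_of_continuousOn (s := Icc (0 : ℝ) 1) hg.continuousOn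
  refine MemLp.of_bound hg.aestronglyMeasurable C ?_
  filter_upwards [ae_restrict_mem measurableSet_Ioo] with x hx
  exact hC x (Ioo_subset_Icc_self hx)

/-- In real pairings with `kap y` and `leftMass`, `green σ F` agrees with the state of density
`val`, and by `ext_real` these decide all real pairings. Thus `val` really is the density. -/
theorem inner_state_green {g : ℝ → ℝ} (a b : ℝ)
    (hg : MemLp g 2 (volume.restrict (Ioo (0 : ℝ) 1))) (σ : ℝ) (F : H) :
    inner ℝ (X.state g a b) (X.green σ F) = (∫ r in (0 : ℝ)..1, g r * X.val σ F r) +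
      a * inner ℝ X.leftMass (X.green σ F) + b * inner ℝ (X.kap 1) (X.green σ F) := by
  have hv := memLp_of_continuous (X.continuous_val σ F)
  rw [← X.inner_state_real a b _ _ hg hv]
  refine X.ext_real (fun y hy => ?_) ?_ a b hg
  · rw [X.inner_kap_state_real hy _ _ hv, ← X.inner_kap_green_eq_integral hy]
  · rw [X.inner_leftMass_state_real _ _ hv]

theorem mean_green (σ : ℝ) (F : H) : X.mean (X.green σ F) = 0 := by
  rw [← X.centre_green, mean, real_inner_eq_re_inner ℂ, X.inner_one_centre]
  simp

theorem mean_one : X.mean X.one = 1 := by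
  rw [mean, real_inner_eq_re_inner ℂ, X.inner_one_one, RCLike.re_eq_complex_re, Complex.ofReal_re]
  norm_num

theorem mean_eq (F : H) : X.mean F = 1 / 3 * (inner ℝ X.leftMass F + inner ℝ (X.kap 0) F) := by
  rw [mean, ← X.leftMass_add_kap_zero, inner_add_left]

end StateSpace

/-! ### The evolution: density, currents and reservoirs. -/

namespace StateSpace

variable {H : Type*} [NormedAddCommGroup H] [InnerProductSpace ℂ H] [CompleteSpace H]
  (X : StateSpace H)

open InnerProductSpace ContinuousLinearMap

theorem hasDerivAt_clm_apply (A : H →L[ℂ] H) {G : ℝ → H} {G' : H} {t : ℝ}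
    (h : HasDerivAt G G' t) : HasDerivAt (fun s => A (G s)) (A G') t :=
  (A.restrictScalars ℝ).hasFDerivAt.comp_hasDerivAt t h

theorem hasDerivAt_inner_const {G : ℝ → H} {G' : H} {t : ℝ} (x : H)
    (h : HasDerivAt G G' t) : HasDerivAt (fun s => inner ℝ x (G s)) (inner ℝ x G') t := by
  simpa using (hasDerivAt_const t x).inner ℝ h

theorem hasDerivAt_val_comp (σ r : ℝ) {G : ℝ → H} {G' : H} {t : ℝ} (h : HasDerivAt G G' t) :
    HasDerivAt (fun s => X.val σ (G s) r) (X.val σ G' r) t := by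
  have hc := hasDerivAt_clm_apply X.centre h
  exact (((hasDerivAt_inner_const (X.kapInt r) hc).const_mul 2).add
    ((hasDerivAt_inner_const (X.kap 0) hc).const_mul σ)).sub
    ((hasDerivAt_inner_const X.one (hasDerivAt_clm_apply (X.preGreen σ) hc)).const_mul (1 / 3))

theorem val_neg (σ r : ℝ) (F : H) : X.val σ (-F) r = -X.val σ F r := by
  simp only [val, offset, mean, map_neg, inner_neg_right]; ring

theorem continuous_preGreen : Continuous X.preGreen := by
  unfold preGreen
  exact continuous_const.add ((Complex.continuous_ofReal).smul continuous_const)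

theorem continuous_green : Continuous X.green :=
  continuous_const.clm_comp (X.continuous_preGreen.clm_comp continuous_const)

theorem continuous_val_uncurry : Continuous fun p : ℝ × H × ℝ => X.val p.1 p.2.1 p.2.2 := by
  have hQ : Continuous fun p : ℝ × H × ℝ => X.centre p.2.1 :=
    X.centre.continuous.comp (continuous_fst.comp continuous_snd)
  have hK : Continuous fun p : ℝ × H × ℝ => X.kapInt p.2.2 :=
    X.continuous_kapInt.comp (continuous_snd.comp continuous_snd)
  have hP : Continuous fun p : ℝ × H × ℝ => X.preGreen p.1 (X.centre p.2.1) :=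
    (X.continuous_preGreen.comp continuous_fst).clm_apply hQ
  exact ((continuous_const.mul (hK.inner hQ)).add
    (continuous_fst.mul (continuous_const.inner hQ))).sub
    (continuous_const.mul (continuous_const.inner hP))

/-- The mean-zero part of the evolution of `f`, with `j` applications of the generator. -/
noncomputable def flow (σ : ℝ) (j : ℕ) (f : H) (t : ℝ) : H := heatOp (X.green σ) j t f

variable {σ : ℝ} (hσ : 0 ≤ σ) (f : H)
include hσ

theorem hasDerivAt_flow (j : ℕ) {t : ℝ} (ht : 0 < t) :
    HasDerivAt (X.flow σ j f) (-X.flow σ (j + 1) f t) t := by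
  have h := hasDerivAt_heatOp (X.isSelfAdjoint_green hσ) j ht
  exact (((ContinuousLinearMap.apply ℂ H f).restrictScalars ℝ).hasFDerivAt.comp_hasDerivAt t h)

theorem continuousOn_flow (j : ℕ) : ContinuousOn (X.flow σ j f) (Ioi 0) := fun _ ht =>
  (X.hasDerivAt_flow hσ f j ht).continuousAt.continuousWithinAt

/-- This exhibits the evolution at positive times as a Green potential, so it has a density defined
at every point, and the formulas for `green` become the equations of the problem. -/
theorem green_flow (j : ℕ) {t : ℝ} (ht : 0 < t) :
    X.green σ (X.flow σ (j + 1) f t) = X.flow σ j f t := by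
  rw [flow, flow, ← mul_heatOp_succ (X.isSelfAdjoint_green hσ) j ht]
  rfl

theorem centre_flow (j : ℕ) {t : ℝ} (ht : 0 < t) :
    X.centre (X.flow σ j f t) = X.flow σ j f t := by
  rw [← X.green_flow hσ f j ht, X.centre_green]

omit hσ in
theorem flow_time_zero (j : ℕ) : X.flow σ j f 0 = 0 := by
  rw [flow, heatOp_time_zero]; rfl

theorem flow_one {t : ℝ} (ht : 0 < t) (j : ℕ) : X.flow σ j X.one t = 0 :=
  heatOp_apply_of_mem_ker (X.isSelfAdjoint_green hσ) j ht (X.green_one σ)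

theorem tendsto_flow_zero : Tendsto (X.flow σ 0 f) (𝓝[>] 0) (𝓝 (X.centre f)) := by
  refine (tendsto_heatOp_zero_apply (X.isSelfAdjoint_green hσ) (X.spectrum_green_nonneg hσ)
    (X.centre_mem_ker_orthogonal hσ f)).congr' ?_
  filter_upwards [self_mem_nhdsWithin] with t ht
  rw [X.centre_apply, map_sub, map_smul,
    heatOp_apply_of_mem_ker (X.isSelfAdjoint_green hσ) 0 ht (X.green_one σ), smul_zero, sub_zero]
  rfl

omit hσ in
theorem inner_flow_comm (f g : H) (j : ℕ) (t : ℝ) :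
    inner ℝ (X.flow σ j f t) g = inner ℝ f (X.flow σ j g t) := by
  rw [real_inner_eq_re_inner ℂ, real_inner_eq_re_inner ℂ, flow, flow]
  have h := isSelfAdjoint_heatOp (N := X.green σ) j t
  rw [isSelfAdjoint_iff'] at h
  conv_lhs => rw [← h]
  rw [adjoint_inner_left]

/-- The density at time `t` of the evolution of `f`. -/
noncomputable def temp (σ : ℝ) (f : H) (r t : ℝ) : ℝ := X.mean f + X.val σ (X.flow σ 1 f t) r

/-- The left reservoir. -/
noncomputable def resLeft (σ : ℝ) (f : H) (t : ℝ) : ℝ :=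
  X.mean f + inner ℝ X.leftMass (X.flow σ 0 f t)

/-- The right reservoir. -/
noncomputable def resRight (σ : ℝ) (f : H) (t : ℝ) : ℝ :=
  X.mean f + inner ℝ (X.kap 1) (X.flow σ 0 f t)

/-- The current `u_r / 2`. -/
noncomputable def current (σ : ℝ) (f : H) (r t : ℝ) : ℝ := inner ℝ (X.kap r) (X.flow σ 1 f t)

/-- The mass in `(y,1)` and the right reservoir. -/
noncomputable def mass (σ : ℝ) (f : H) (y t : ℝ) : ℝ :=
  (2 - y) * X.mean f + inner ℝ (X.kap y) (X.flow σ 0 f t)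

theorem hasDerivAt_temp_space {t : ℝ} (ht : 0 < t) (r : ℝ) :
    HasDerivAt (fun x => X.temp σ f x t) (2 * X.current σ f r t) r := by
  have h := X.hasDerivAt_val σ (X.flow σ 1 f t) r
  rw [X.centre_flow hσ f 1 ht] at h
  exact h.const_add _

theorem hasDerivWithinAt_current {t : ℝ} (ht : 0 < t) {r : ℝ} (hr : r ∈ Icc (0 : ℝ) 1) :
    HasDerivWithinAt (fun x => X.current σ f x t) (-X.val σ (X.flow σ 2 f t) r) (Icc 0 1) r := by
  have h := X.hasDerivWithinAt_inner_kap_green hr σ (X.flow σ 2 f t)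
  rwa [X.green_flow hσ f 1 ht] at h

theorem hasDerivAt_temp_time {t : ℝ} (ht : 0 < t) (r : ℝ) :
    HasDerivAt (fun s => X.temp σ f r s) (-X.val σ (X.flow σ 2 f t) r) t := by
  rw [← X.val_neg]
  exact (X.hasDerivAt_val_comp σ r (X.hasDerivAt_flow hσ f 1 ht)).const_add _

theorem hasDerivAt_mass_time {t : ℝ} (ht : 0 < t) (y : ℝ) :
    HasDerivAt (fun s => X.mass σ f y s) (-X.current σ f y t) t := by
  have h := hasDerivAt_inner_const (X.kap y) (X.hasDerivAt_flow hσ f 0 ht)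
  rw [inner_neg_right] at h
  exact h.const_add _

theorem hasDerivAt_resRight {t : ℝ} (ht : 0 < t) :
    HasDerivAt (X.resRight σ f) (-X.current σ f 1 t) t := by
  have h := hasDerivAt_inner_const (X.kap 1) (X.hasDerivAt_flow hσ f 0 ht)
  rw [inner_neg_right] at h
  exact h.const_add _

/-- Conservation of mass: the flow has mean zero, and `leftMass + kap 0` is the total. -/
theorem inner_leftMass_flow (j : ℕ) {t : ℝ} (ht : 0 < t) :
    inner ℝ X.leftMass (X.flow σ j f t) = -inner ℝ (X.kap 0) (X.flow σ j f t) := by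
  have h := X.mean_green σ (X.flow σ (j + 1) f t)
  rw [X.green_flow hσ f j ht, X.mean_eq] at h
  linarith

theorem hasDerivAt_resLeft {t : ℝ} (ht : 0 < t) :
    HasDerivAt (X.resLeft σ f) (X.current σ f 0 t) t := by
  have h := hasDerivAt_inner_const X.leftMass (X.hasDerivAt_flow hσ f 0 ht)
  rw [inner_neg_right, X.inner_leftMass_flow hσ f 1 ht, neg_neg] at h
  exact h.const_add _

/-- By `val_zero` a Green potential has at 0 a density exceeding its left content by σ times the
pairing with `kap 0`, which is here the current. At σ = 0 the boundary value equals the reservoir.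
-/
theorem temp_zero_sub {t : ℝ} (ht : 0 < t) :
    X.temp σ f 0 t - X.resLeft σ f t = σ * X.current σ f 0 t := by
  rw [temp, resLeft, current, ← X.green_flow hσ f 0 ht, X.inner_leftMass_green, X.val_zero,
    X.centre_flow hσ f 1 ht]
  ring

theorem temp_one_sub {t : ℝ} (ht : 0 < t) :
    X.temp σ f 1 t - X.resRight σ f t = -(σ * X.current σ f 1 t) := by
  rw [temp, resRight, current, ← X.green_flow hσ f 0 ht, X.inner_kap_one_green,
    X.centre_flow hσ f 1 ht]
  ring

theorem resLeft_add_mass {t : ℝ} (ht : 0 < t) :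
    X.resLeft σ f t + X.mass σ f 0 t = 3 * X.mean f := by
  rw [mass, resLeft, X.inner_leftMass_flow hσ f 0 ht]
  ring

theorem continuousOn_val_flow (j : ℕ) :
    ContinuousOn (fun p : ℝ × ℝ => X.val σ (X.flow σ j f p.2) p.1) (univ ×ˢ Ioi 0) := by
  have h : ContinuousOn (fun p : ℝ × ℝ => X.flow σ j f p.2) (univ ×ˢ Ioi 0) :=
    (X.continuousOn_flow hσ f j).comp continuousOn_snd fun p hp => hp.2
  have h2 : ContinuousOn (fun p : ℝ × ℝ => (σ, X.flow σ j f p.2, p.1)) (univ ×ˢ Ioi 0) :=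
    continuousOn_const.prodMk (h.prodMk continuousOn_fst)
  have h3 := Continuous.comp_continuousOn (g := fun p : ℝ × H × ℝ => X.val p.1 p.2.1 p.2.2)
    X.continuous_val_uncurry h2
  simpa only [Function.comp_def] using h3

theorem continuousOn_temp :
    ContinuousOn (fun p : ℝ × ℝ => X.temp σ f p.1 p.2) (univ ×ˢ Ioi 0) :=
  (continuousOn_const (c := X.mean f)).add (X.continuousOn_val_flow hσ f 1)

theorem continuousOn_current :
    ContinuousOn (fun p : ℝ × ℝ => X.current σ f p.1 p.2) (univ ×ˢ Ioi 0) := by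
  have h1 : ContinuousOn (fun p : ℝ × ℝ => X.kap p.1) (univ ×ˢ Ioi 0) :=
    X.continuous_kap.comp_continuousOn continuousOn_fst
  have h2 : ContinuousOn (fun p : ℝ × ℝ => X.flow σ 1 f p.2) (univ ×ˢ Ioi 0) :=
    (X.continuousOn_flow hσ f 1).comp continuousOn_snd fun _ hp => hp.2
  exact h1.inner (𝕜 := ℝ) h2

theorem continuous_temp_space {t : ℝ} (ht : 0 < t) : Continuous fun r => X.temp σ f r t :=
  continuous_iff_continuousAt.2 fun r => (X.hasDerivAt_temp_space hσ f ht r).continuousAt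

theorem tendsto_mass {y : ℝ} (hy : y ∈ Icc (0 : ℝ) 1) :
    Tendsto (fun t => X.mass σ f y t) (𝓝[>] 0) (𝓝 (inner ℝ (X.kap y) f)) := by
  have h := (tendsto_const_nhds (x := X.kap y)).inner (𝕜 := ℝ) (X.tendsto_flow_zero hσ f)
  rw [X.inner_kap_centre hy] at h
  have h2 := h.const_add ((2 - y) * X.mean f)
  rwa [add_sub_cancel] at h2

theorem tendsto_resRight : Tendsto (X.resRight σ f) (𝓝[>] 0) (𝓝 (inner ℝ (X.kap 1) f)) := by
  have h := (tendsto_const_nhds (x := X.kap 1)).inner (𝕜 := ℝ) (X.tendsto_flow_zero hσ f)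
  rw [X.inner_kap_centre one_mem_unit] at h
  have h2 := h.const_add (X.mean f)
  rwa [show X.mean f + (inner ℝ (X.kap 1) f - (2 - 1) * X.mean f) = inner ℝ (X.kap 1) f by ring]
    at h2

theorem tendsto_resLeft : Tendsto (X.resLeft σ f) (𝓝[>] 0) (𝓝 (inner ℝ X.leftMass f)) := by
  have h := (tendsto_const_nhds (x := X.leftMass)).inner (𝕜 := ℝ) (X.tendsto_flow_zero hσ f)
  rw [X.inner_centre_real X.inner_leftMass_one] at h
  have h2 := h.const_add (X.mean f)
  rwa [show X.mean f + (inner ℝ X.leftMass f - 1 * X.mean f) = inner ℝ X.leftMass f by ring]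
    at h2

/-- Pairing with the evolution of `f`. -/
theorem inner_state_flow {g : ℝ → ℝ} (a b : ℝ)
    (hg : MemLp g 2 (volume.restrict (Ioo (0 : ℝ) 1))) {t : ℝ} (ht : 0 < t) :
    inner ℝ (X.state g a b) (X.flow σ 0 f t) + X.mean f * inner ℝ (X.state g a b) X.one =
      (∫ r in (0 : ℝ)..1, g r * X.temp σ f r t) + a * X.resLeft σ f t +
        b * X.resRight σ f t := by
  have hi : IntervalIntegrable g volume 0 1 := by
    rw [intervalIntegrable_iff_integrableOn_Ioo_of_le zero_le_one]
    exact hg.integrable (by norm_num)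
  rw [resLeft, resRight, ← X.green_flow hσ f 0 ht, X.inner_state_green a b hg, one,
    X.inner_state_real _ _ _ _ hg memLp_one]
  simp only [temp, mul_add, Pi.one_apply, mul_one]
  rw [intervalIntegral.integral_add (hi.mul_const _)
    (hi.mul_continuousOn (X.continuous_val _ _).continuousOn),
    intervalIntegral.integral_mul_const]
  ring

end StateSpace

/-! ### Minimum and maximum principles. -/

theorem HasDerivAt.nonpos_of_left_min {φ : ℝ → ℝ} {d t : ℝ} (h : HasDerivAt φ d t)
    (hmin : ∀ᶠ s in 𝓝[<] t, φ t ≤ φ s) : d ≤ 0 := by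
  have h1 := (hasDerivWithinAt_iff_tendsto_slope' (s := Iio t) (notMem_Iio.2 le_rfl)).1
    h.hasDerivWithinAt
  refine le_of_tendsto h1 ?_
  filter_upwards [hmin, self_mem_nhdsWithin] with s hs hst
  rw [slope_def_field]
  exact div_nonpos_of_nonneg_of_nonpos (by linarith) (by linarith [mem_Iio.1 hst])

theorem HasDerivWithinAt.nonneg_of_right_min {φ : ℝ → ℝ} {d t : ℝ}
    (h : HasDerivWithinAt φ d (Ioi t) t) (hmin : ∀ᶠ s in 𝓝[>] t, φ t ≤ φ s) : 0 ≤ d := by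
  have h1 := (hasDerivWithinAt_iff_tendsto_slope' (s := Ioi t) (notMem_Ioi.2 le_rfl)).1 h
  refine ge_of_tendsto h1 ?_
  filter_upwards [hmin, self_mem_nhdsWithin] with s hs hst
  rw [slope_def_field]
  exact div_nonneg (by linarith) (by linarith [mem_Ioi.1 hst])

theorem HasDerivWithinAt.nonneg_of_min_zero {φ : ℝ → ℝ} {d : ℝ}
    (h : HasDerivWithinAt φ d (Icc 0 1) 0) (hmin : ∀ x ∈ Icc (0 : ℝ) 1, φ 0 ≤ φ x) : 0 ≤ d := by
  refine HasDerivWithinAt.nonneg_of_right_min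
    (h.mono_of_mem_nhdsWithin (Icc_mem_nhdsGT zero_lt_one)) ?_
  filter_upwards [Icc_mem_nhdsGT (zero_lt_one (α := ℝ))] with x hx using hmin x hx

theorem HasDerivWithinAt.reflect {φ : ℝ → ℝ} {d : ℝ}
    (h : HasDerivWithinAt φ d (Icc 0 1) 1) :
    HasDerivWithinAt (fun x => φ (1 - x)) (-d) (Icc 0 1) 0 := by
  have h2 : HasDerivWithinAt (fun x : ℝ => 1 - x) (-1) (Icc 0 1) 0 :=
    ((hasDerivAt_id (0 : ℝ)).const_sub 1).hasDerivWithinAt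
  have h3 : HasDerivWithinAt φ d (Icc 0 1) (1 - 0) := by rwa [sub_zero]
  have h4 := h3.comp (0 : ℝ) h2 (fun x hx => ⟨by linarith [hx.2], by linarith [hx.1]⟩)
  simpa [Function.comp_def] using h4

theorem HasDerivWithinAt.nonpos_of_min_one {φ : ℝ → ℝ} {d : ℝ}
    (h : HasDerivWithinAt φ d (Icc 0 1) 1) (hmin : ∀ x ∈ Icc (0 : ℝ) 1, φ 1 ≤ φ x) : d ≤ 0 := by
  have := h.reflect.nonneg_of_min_zero fun x hx => by
    simpa using hmin (1 - x) ⟨by linarith [hx.2], by linarith [hx.1]⟩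
  linarith

/-- Were c negative, f' would be negative just to the right of r, and the mean value theorem would
give a smaller value of f there. -/
theorem second_deriv_nonneg_of_min {f f' : ℝ → ℝ} {r c : ℝ} (hr : r ∈ Ioo (0 : ℝ) 1)
    (hf : ∀ x ∈ Ioo (0 : ℝ) 1, HasDerivAt f (f' x) x) (hf' : HasDerivAt f' c r)
    (hmin : ∀ x ∈ Ioo (0 : ℝ) 1, f r ≤ f x) : 0 ≤ c := by
  have hloc : IsLocalMin f r := by
    filter_upwards [Ioo_mem_nhds hr.1 hr.2] with x hx using hmin x hx
  have h0 : f' r = 0 := hloc.hasDerivAt_eq_zero (hf r hr)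
  by_contra! hc
  have h1 := (hasDerivWithinAt_iff_tendsto_slope' (s := Ioi r) (notMem_Ioi.2 le_rfl)).1
    hf'.hasDerivWithinAt
  have h2 : ∀ᶠ x in 𝓝[>] r, f' x < 0 := by
    filter_upwards [h1.eventually (gt_mem_nhds hc), self_mem_nhdsWithin] with x hx hxr
    rw [slope_def_field, h0, sub_zero] at hx
    have hpos : 0 < x - r := sub_pos.2 hxr
    by_contra! hcon
    exact absurd hx (not_lt.2 (div_nonneg hcon hpos.le))
  obtain ⟨u, hu, hsub⟩ := (mem_nhdsGT_iff_exists_Ioo_subset' hr.2).1 h2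
  have hu' : r < u := hu
  set v := min ((r + u) / 2) ((r + 1) / 2) with hv
  have hrv : r < v := lt_min (by linarith) (by linarith [hr.2])
  have hvu : v < u := (min_le_left _ _).trans_lt (by linarith)
  have hv1 : v < 1 := (min_le_right _ _).trans_lt (by linarith [hr.2])
  have hsub01 : Icc r v ⊆ Ioo (0 : ℝ) 1 := fun x hx => ⟨hr.1.trans_le hx.1, hx.2.trans_lt hv1⟩
  obtain ⟨x, hx, hxe⟩ := exists_hasDerivAt_eq_slope f f' hrv
    (fun x hx => (hf x (hsub01 hx)).continuousAt.continuousWithinAt)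
    (fun x hx => hf x (hsub01 (Ioo_subset_Icc_self hx)))
  have h3 : f' x < 0 := hsub ⟨hx.1, hx.2.trans hvu⟩
  rw [hxe] at h3
  have h4 := hmin v (hsub01 ⟨hrv.le, le_rfl⟩)
  exact absurd h3 (not_lt.2 (div_nonneg (by linarith) (by linarith)))

/-- At a minimum on the left edge the density and the reservoir cannot both be minimal. -/
theorem edge_min_false {σ ε t L T j : ℝ} {a f : ℝ → ℝ} (hσ : 0 ≤ σ) (hε : 0 < ε) (ht : t ∈ Ioc 0 T)
    (ha : HasDerivAt a j t) (hf : HasDerivWithinAt f (2 * j) (Icc 0 1) 0)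
    (hex : f 0 - a t = σ * j) (hfL : ∀ x ∈ Icc (0 : ℝ) 1, L ≤ f x + ε * t)
    (haL : ∀ s ∈ Icc (0 : ℝ) T, L ≤ a s + ε * s) (h : f 0 + ε * t = L ∨ a t + ε * t = L) :
    False := by
  have htime : a t + ε * t = L → j ≤ -ε := by
    intro he
    have h1 : HasDerivAt (fun s => a s + ε * s) (j + ε * 1) t :=
      ha.add ((hasDerivAt_id t).const_mul ε)
    have h2 := h1.nonpos_of_left_min (by
      filter_upwards [Ioo_mem_nhdsLT ht.1] with s hs
      rw [he]
      exact haL s ⟨hs.1.le, hs.2.le.trans ht.2⟩)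
    linarith
  have hspace : f 0 + ε * t = L → 0 ≤ j := by
    intro he
    have h2 := hf.nonneg_of_min_zero (fun x hx => by linarith [hfL x hx])
    linarith
  -- If the density attains L, then j ≥ 0 and the exchange law puts the reservoir no higher, so it
  -- attains L too and j ≤ -ε. If the reservoir attains L, then j ≤ -ε puts the density no higher,
  -- so it attains L too and j ≥ 0.
  rcases h with h | h
  · have h1 := hspace h
    have h2 : 0 ≤ σ * j := mul_nonneg hσ h1
    have h3 := haL t ⟨ht.1.le, ht.2⟩
    have h4 := htime (by linarith)
    linarith
  · have h1 := htime h
    have h2 : σ * j ≤ 0 := mul_nonpos_of_nonneg_of_nonpos hσ (by linarith)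
    have h3 := hfL 0 ⟨le_rfl, zero_le_one⟩
    have h4 := hspace (by linarith)
    linarith

/-- The minimum principle for the heat equation coupled to two reservoirs. -/
theorem heat_reservoir_nonneg {σ T : ℝ} (hσ : 0 ≤ σ) (hT : 0 ≤ T) {U J w : ℝ → ℝ → ℝ}
    {a b : ℝ → ℝ}
    (hU : ContinuousOn (fun p : ℝ × ℝ => U p.1 p.2) (Icc 0 1 ×ˢ Icc 0 T))
    (ha : ContinuousOn a (Icc 0 T)) (hb : ContinuousOn b (Icc 0 T))
    (hUt : ∀ r ∈ Ioo (0 : ℝ) 1, ∀ t ∈ Ioc 0 T, HasDerivAt (fun s => U r s) (w r t) t)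
    (hUr : ∀ r ∈ Icc (0 : ℝ) 1, ∀ t ∈ Ioc 0 T,
      HasDerivWithinAt (fun x => U x t) (2 * J r t) (Icc 0 1) r)
    (hJr : ∀ r ∈ Ioo (0 : ℝ) 1, ∀ t ∈ Ioc 0 T, HasDerivAt (fun x => J x t) (w r t) r)
    (hat : ∀ t ∈ Ioc 0 T, HasDerivAt a (J 0 t) t)
    (hbt : ∀ t ∈ Ioc 0 T, HasDerivAt b (-J 1 t) t)
    (hea : ∀ t ∈ Ioc 0 T, U 0 t - a t = σ * J 0 t)
    (heb : ∀ t ∈ Ioc 0 T, U 1 t - b t = -(σ * J 1 t))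
    (hU0 : ∀ r ∈ Icc (0 : ℝ) 1, 0 ≤ U r 0) (ha0 : 0 ≤ a 0) (hb0 : 0 ≤ b 0) :
    (∀ r ∈ Icc (0 : ℝ) 1, ∀ t ∈ Icc 0 T, 0 ≤ U r t) ∧ (∀ t ∈ Icc 0 T, 0 ≤ a t) ∧
      ∀ t ∈ Icc 0 T, 0 ≤ b t := by
  -- Adding εt makes the time derivative at a minimum strictly negative after it is removed, which
  -- excludes degenerate minima at positive times.
  suffices key : ∀ ε > 0, (∀ r ∈ Icc (0 : ℝ) 1, ∀ t ∈ Icc 0 T, 0 ≤ U r t + ε * t) ∧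
      (∀ t ∈ Icc 0 T, 0 ≤ a t + ε * t) ∧ ∀ t ∈ Icc 0 T, 0 ≤ b t + ε * t by
    have lim : ∀ x t : ℝ, (∀ ε > 0, 0 ≤ x + ε * t) → 0 ≤ x := by
      intro x t h
      have h1 : Tendsto (fun ε : ℝ => x + ε * t) (𝓝[>] 0) (𝓝 (x + 0 * t)) :=
        ((tendsto_id.mul_const t).const_add x).mono_left nhdsWithin_le_nhds
      rw [zero_mul, add_zero] at h1
      refine ge_of_tendsto h1 ?_
      filter_upwards [self_mem_nhdsWithin] with ε hε using h ε hε
    exact ⟨fun r hr t ht => lim _ t fun ε hε => (key ε hε).1 r hr t ht,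
      fun t ht => lim _ t fun ε hε => (key ε hε).2.1 t ht,
      fun t ht => lim _ t fun ε hε => (key ε hε).2.2 t ht⟩
  intro ε hε
  have hne : (Icc (0 : ℝ) T).Nonempty := nonempty_Icc.2 hT
  obtain ⟨p, hp, hpmin⟩ := (isCompact_Icc.prod isCompact_Icc).exists_isMinOn
    ((nonempty_Icc.2 zero_le_one).prod hne)
    (hU.add (continuousOn_const.mul continuousOn_snd) :
      ContinuousOn (fun p : ℝ × ℝ => U p.1 p.2 + ε * p.2) (Icc (0 : ℝ) 1 ×ˢ Icc 0 T))
  obtain ⟨s, hs, hsmin⟩ := isCompact_Icc.exists_isMinOn hne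
    (ha.add (continuousOn_const.mul continuousOn_id) :
      ContinuousOn (fun s : ℝ => a s + ε * s) (Icc 0 T))
  obtain ⟨q, hq, hqmin⟩ := isCompact_Icc.exists_isMinOn hne
    (hb.add (continuousOn_const.mul continuousOn_id) :
      ContinuousOn (fun s : ℝ => b s + ε * s) (Icc 0 T))
  set L := min (U p.1 p.2 + ε * p.2) (min (a s + ε * s) (b q + ε * q)) with hL
  have hUL : ∀ t ∈ Icc 0 T, ∀ x ∈ Icc (0 : ℝ) 1, L ≤ U x t + ε * t := fun t ht x hx =>
    (min_le_left _ _).trans (hpmin (show (x, t) ∈ Icc (0 : ℝ) 1 ×ˢ Icc 0 T from ⟨hx, ht⟩))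
  have haL : ∀ t ∈ Icc 0 T, L ≤ a t + ε * t := fun t ht =>
    (min_le_right _ _).trans ((min_le_left _ _).trans (hsmin ht))
  have hbL : ∀ t ∈ Icc 0 T, L ≤ b t + ε * t := fun t ht =>
    (min_le_right _ _).trans ((min_le_right _ _).trans (hqmin ht))
  suffices hL0 : 0 ≤ L from ⟨fun r hr t ht => hL0.trans (hUL t ht r hr),
    fun t ht => hL0.trans (haL t ht), fun t ht => hL0.trans (hbL t ht)⟩
  have left : ∀ t ∈ Ioc 0 T, ¬ (U 0 t + ε * t = L ∨ a t + ε * t = L) := fun t ht h =>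
    edge_min_false (f := fun x => U x t) hσ hε ht (hat t ht) (hUr 0 ⟨le_rfl, zero_le_one⟩ t ht)
      (hea t ht) (hUL t (Ioc_subset_Icc_self ht)) haL h
  have right : ∀ t ∈ Ioc 0 T, ¬ (U 1 t + ε * t = L ∨ b t + ε * t = L) := by
    intro t ht h
    -- The reflection x ↦ 1 - x turns the right edge into a left edge with current -J.
    have hr := (hUr 1 ⟨zero_le_one, le_rfl⟩ t ht).reflect
    rw [← mul_neg] at hr
    refine edge_min_false (f := fun x => U (1 - x) t) hσ hε ht (hbt t ht) hr ?_
      (fun x hx => hUL t (Ioc_subset_Icc_self ht) _ ⟨by linarith [hx.2], by linarith [hx.1]⟩)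
      hbL ?_
    · simp only [sub_zero, heb t ht, mul_neg]
    · simpa only [sub_zero] using h
  rcases min_choice (U p.1 p.2 + ε * p.2) (min (a s + ε * s) (b q + ε * q)) with h | h
  · rw [← hL] at h
    rcases hp.2.1.eq_or_lt with h0 | h0
    · rw [h, ← h0, mul_zero, add_zero]; exact hU0 _ hp.1
    exfalso
    have ht : p.2 ∈ Ioc 0 T := ⟨h0, hp.2.2⟩
    rcases hp.1.1.eq_or_lt with hr | hr
    · exact left p.2 ht (Or.inl (by rw [h, ← hr]))
    rcases hp.1.2.eq_or_lt with hr1 | hr1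
    · exact right p.2 ht (Or.inl (by rw [h, hr1]))
    have hint : p.1 ∈ Ioo (0 : ℝ) 1 := ⟨hr, hr1⟩
    have h1 : HasDerivAt (fun s => U p.1 s + ε * s) (w p.1 p.2 + ε * 1) p.2 :=
      (hUt p.1 hint p.2 ht).add ((hasDerivAt_id _).const_mul ε)
    have h2 := h1.nonpos_of_left_min (by
      filter_upwards [Ioo_mem_nhdsLT h0] with s hs
      rw [← h]
      exact hUL s ⟨hs.1.le, hs.2.le.trans hp.2.2⟩ p.1 hp.1)
    -- At an interior minimum the time direction gives w ≤ -ε and the space direction w ≥ 0.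
    have h3 := second_deriv_nonneg_of_min (f := fun x => U x p.2) (f' := fun x => 2 * J x p.2)
      hint (fun x hx => (hUr x (Ioo_subset_Icc_self hx) p.2 ht).hasDerivAt
        (Icc_mem_nhds hx.1 hx.2)) ((hJr p.1 hint p.2 ht).const_mul 2)
      (fun x hx => by linarith [hUL p.2 hp.2 x (Ioo_subset_Icc_self hx)])
    linarith
  rw [← hL] at h
  rcases min_choice (a s + ε * s) (b q + ε * q) with h' | h'
  · rw [h'] at h
    rcases hs.1.eq_or_lt with h0 | h0
    · rw [h, ← h0, mul_zero, add_zero]; exact ha0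
    · exact absurd (Or.inr h.symm) (left s ⟨h0, hs.2⟩)
  · rw [h'] at h
    rcases hq.1.eq_or_lt with h0 | h0
    · rw [h, ← h0, mul_zero, add_zero]; exact hb0
    · exact absurd (Or.inr h.symm) (right q ⟨h0, hq.2⟩)

/-- The maximum principle for the integrated equation, with dynamic Robin boundary conditions. -/
theorem integrated_heat_nonpos {σ T : ℝ} (hσ : 0 ≤ σ) (hT : 0 ≤ T) {m D J : ℝ → ℝ → ℝ}
    (hm : ContinuousOn (fun p : ℝ × ℝ => m p.1 p.2) (Icc 0 1 ×ˢ Icc 0 T))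
    (hmt : ∀ r ∈ Ioo (0 : ℝ) 1, ∀ t ∈ Ioc 0 T, HasDerivAt (fun s => m r s) (-J r t) t)
    (hmr : ∀ r ∈ Icc (0 : ℝ) 1, ∀ t ∈ Ioc 0 T,
      HasDerivWithinAt (fun x => m x t) (-D r t) (Icc 0 1) r)
    (hDr : ∀ r ∈ Ioo (0 : ℝ) 1, ∀ t ∈ Ioc 0 T, HasDerivAt (fun x => D x t) (2 * J r t) r)
    (h0 : ∀ t ∈ Ioc 0 T, ∃ d, HasDerivAt (fun s => m 0 s) d t ∧ D 0 t + m 0 t = -(σ * d))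
    (h1 : ∀ t ∈ Ioc 0 T, ∃ d, HasDerivAt (fun s => m 1 s) d t ∧ D 1 t - m 1 t = σ * d)
    (hinit : ∀ r ∈ Icc (0 : ℝ) 1, m r 0 ≤ 0) :
    ∀ r ∈ Icc (0 : ℝ) 1, ∀ t ∈ Icc 0 T, m r t ≤ 0 := by
  intro r₀ hr₀ t₀ ht₀
  by_contra! hpos
  -- The penalty εt may remove at most half of the positive value at t₀.
  obtain ⟨ε, hε, hε0⟩ : ∃ ε > 0, 0 < m r₀ t₀ - ε * t₀ := by
    rcases ht₀.1.eq_or_lt with h | h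
    · exact ⟨1, one_pos, by rw [← h]; rw [← h] at hpos; linarith⟩
    · refine ⟨m r₀ t₀ / (2 * t₀), by positivity, ?_⟩
      have : m r₀ t₀ / (2 * t₀) * t₀ = m r₀ t₀ / 2 := by field_simp
      rw [this]; linarith
  obtain ⟨⟨r, t⟩, hp, hmax⟩ := (isCompact_Icc.prod isCompact_Icc).exists_isMaxOn
    ((nonempty_Icc.2 zero_le_one).prod (nonempty_Icc.2 hT))
    (hm.sub (continuousOn_const.mul continuousOn_snd) :
      ContinuousOn (fun p : ℝ × ℝ => m p.1 p.2 - ε * p.2) (Icc (0 : ℝ) 1 ×ˢ Icc 0 T))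
  have hle : ∀ x ∈ Icc (0 : ℝ) 1, ∀ s ∈ Icc 0 T, m x s - ε * s ≤ m r t - ε * t := fun x hx s hs =>
    hmax (show (x, s) ∈ Icc (0 : ℝ) 1 ×ˢ Icc 0 T from ⟨hx, hs⟩)
  obtain ⟨hr, ht⟩ : r ∈ Icc (0 : ℝ) 1 ∧ t ∈ Icc 0 T := hp
  have hmpos := hε0.trans_le (hle r₀ hr₀ t₀ ht₀)
  have htpos : 0 < t := by
    rcases ht.1.eq_or_lt with h | h
    · rw [← h] at hmpos
      linarith [hinit r hr]
    · exact h
  have ht' : t ∈ Ioc 0 T := ⟨htpos, ht.2⟩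
  have hmpos' : 0 < m r t := by nlinarith
  have time : ∀ d, HasDerivAt (fun s => m r s) d t → ε ≤ d := by
    intro d hd
    have h2 : HasDerivAt (fun s => -(m r s - ε * s)) (-(d - ε * 1)) t :=
      (hd.sub ((hasDerivAt_id t).const_mul ε)).neg
    have := h2.nonpos_of_left_min (by
      filter_upwards [Ioo_mem_nhdsLT htpos] with s hs
      exact neg_le_neg (hle r hr s ⟨hs.1.le, hs.2.le.trans ht.2⟩))
    linarith
  have space : ∀ x ∈ Icc (0 : ℝ) 1, -m r t ≤ -m x t := fun x hx => by linarith [hle x hx t ht]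
  -- At the left edge a maximum forces D ≥ 0, so D + m > 0, whereas -σd ≤ 0. At the right edge D ≤
  -- 0, so D - m < 0, whereas σd ≥ 0.
  rcases hr.1.eq_or_lt with hr0 | hr0
  · subst hr0
    obtain ⟨d, hd, he⟩ := h0 t ht'
    have h2 := time d hd
    have h3 := (hmr 0 hr t ht').neg.nonneg_of_min_zero space
    have h4 : 0 ≤ σ * d := mul_nonneg hσ (hε.le.trans h2)
    linarith
  rcases hr.2.eq_or_lt with hr1 | hr1
  · subst hr1
    obtain ⟨d, hd, he⟩ := h1 t ht'
    have h2 := time d hd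
    have h3 := (hmr 1 hr t ht').neg.nonpos_of_min_one space
    have h4 : 0 ≤ σ * d := mul_nonneg hσ (hε.le.trans h2)
    linarith
  have hint : r ∈ Ioo (0 : ℝ) 1 := ⟨hr0, hr1⟩
  have h2 := time _ (hmt r hint t ht')
  have h3 := second_deriv_nonneg_of_min (f := fun x => -m x t) (f' := fun x => D x t) hint
    (fun x hx => by
      have := ((hmr x (Ioo_subset_Icc_self hx) t ht').hasDerivAt (Icc_mem_nhds hx.1 hx.2)).neg
      rwa [neg_neg] at this) (hDr r hint t ht')
    (fun x hx => space x (Ioo_subset_Icc_self hx))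
  linarith

/-! ### Smooth bumps and positivity of the evolution. -/

namespace StateSpace

variable {H : Type*} [NormedAddCommGroup H] [InnerProductSpace ℂ H] [CompleteSpace H]
  (X : StateSpace H)

open InnerProductSpace ContinuousLinearMap

/-- Real pairings of `green σ d` involve only integrals and endpoint values of the real pairings of
`kap` with `centre d`, all zero here. The lemma disposes of a possible imaginary part of d. -/
theorem inner_state_green_of_null {d : H} (h : ∀ y ∈ Icc (0 : ℝ) 1, inner ℝ (X.kap y) d = 0)
    (h0 : inner ℝ X.leftMass d = 0) (σ : ℝ) {g : ℝ → ℝ} (a b : ℝ)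
    (hg : MemLp g 2 (volume.restrict (Ioo (0 : ℝ) 1))) :
    inner ℝ (X.state g a b) (X.green σ d) = 0 := by
  have hmean : X.mean d = 0 := by rw [X.mean_eq, h0, h 0 zero_mem_unit]; norm_num
  have hc : ∀ y ∈ Icc (0 : ℝ) 1, inner ℝ (X.kap y) (X.centre d) = 0 := fun y hy => by
    rw [X.inner_kap_centre hy, h y hy, hmean, mul_zero, sub_zero]
  have hint : ∀ g : ℝ → ℝ, ∫ z in (0 : ℝ)..1, g z * inner ℝ (X.kap z) (X.centre d) = 0 := by
    intro g
    rw [intervalIntegral.integral_congr (g := fun _ => (0 : ℝ)), intervalIntegral.integral_zero]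
    intro z hz
    rw [uIcc_of_le zero_le_one] at hz
    simp only [hc z hz, mul_zero]
  have hoff : X.offset σ d = 0 := by
    rw [offset, X.mean_eq, X.inner_preGreen_real (fun z _ => X.inner_leftMass_kap z),
      X.inner_preGreen_real (fun z hz => X.inner_kap_kap zero_mem_unit hz), hint, hint,
      hc 0 zero_mem_unit, hc 1 one_mem_unit]
    ring
  rw [← inner_zero_right (𝕜 := ℝ) (X.state g a b)]
  refine X.ext_real (fun y hy => ?_) ?_ a b hg
  · rw [X.inner_kap_green hy, hint, hc 0 zero_mem_unit, hc 1 one_mem_unit, hoff, inner_zero_right]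
    ring
  · rw [X.inner_leftMass_green, hoff, inner_zero_right, neg_zero]

section Bump

variable {ψ : ℝ → ℝ} (hψ : ContDiff ℝ 2 ψ) (h0 : ψ =ᶠ[𝓝 0] 0) (h1 : ψ =ᶠ[𝓝 1] 0)

/-- The image of the state with density `ψ` under minus the generator. -/
noncomputable def source (ψ : ℝ → ℝ) : H := X.state (fun x => -(1 / 2 * deriv (deriv ψ) x)) 0 0

include hψ

omit [CompleteSpace H] in
theorem _root_.ContDiff.continuous_deriv_deriv : Continuous (deriv (deriv ψ)) := by
  have h : ContDiff ℝ 1 (deriv ψ) := ((contDiff_succ_iff_deriv (n := 1)).1 hψ).2.2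
  exact h.continuous_deriv le_rfl

theorem memLp_source : MemLp (fun x => -(1 / 2 * deriv (deriv ψ) x)) 2
    (volume.restrict (Ioo (0 : ℝ) 1)) :=
  memLp_of_continuous (by have := hψ.continuous_deriv_deriv; fun_prop)

include h1

theorem inner_kap_source {y : ℝ} (hy : y ∈ Icc (0 : ℝ) 1) :
    inner ℂ (X.kap y) (X.source ψ) = ((1 / 2 * deriv ψ y : ℝ) : ℂ) := by
  have hd : ContDiff ℝ 1 (deriv ψ) := ((contDiff_succ_iff_deriv (n := 1)).1 hψ).2.2
  have hz : deriv ψ 1 = 0 := by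
    rw [h1.deriv_eq]; simp
  rw [source, X.inner_kap_state hy 0 0 (memLp_source hψ), intervalIntegral.integral_neg,
    intervalIntegral.integral_const_mul, intervalIntegral.integral_deriv_eq_sub
      (fun x _ => (hd.differentiable one_ne_zero) x)
      (hψ.continuous_deriv_deriv.intervalIntegrable _ _), hz]
  congr 1
  ring

theorem inner_kap_source_real {y : ℝ} (hy : y ∈ Icc (0 : ℝ) 1) :
    inner ℝ (X.kap y) (X.source ψ) = 1 / 2 * deriv ψ y := by
  rw [real_inner_eq_re_inner ℂ, X.inner_kap_source hψ h1 hy]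
  exact Complex.ofReal_re _

include h0

theorem centre_source : X.centre (X.source ψ) = X.source ψ := by
  have hz : deriv ψ 0 = 0 := by
    rw [h0.deriv_eq]; simp
  have h : inner ℂ X.one (X.source ψ) = 0 := by
    rw [← X.leftMass_add_kap_zero, inner_add_left, X.inner_kap_source hψ h1 zero_mem_unit, hz,
      source, X.inner_leftMass_state _ _ (memLp_source hψ)]
    simp
  rw [X.centre_apply, h, mul_zero, zero_smul, sub_zero]

theorem val_source (σ : ℝ) {r : ℝ} (hr : r ∈ Icc (0 : ℝ) 1) :
    X.val σ (X.source ψ) r = ψ r - X.offset σ (X.source ψ) := by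
  have hz : deriv ψ 0 = 0 := by
    rw [h0.deriv_eq]; simp
  have hd : ContDiff ℝ 1 (deriv ψ) := ((contDiff_succ_iff_deriv (n := 1)).1 hψ).2.2
  have hi : ∫ z in (0 : ℝ)..r, inner ℝ (X.kap z) (X.source ψ) = 1 / 2 * ψ r := by
    have : ∫ z in (0 : ℝ)..r, inner ℝ (X.kap z) (X.source ψ) =
        ∫ z in (0 : ℝ)..r, 1 / 2 * deriv ψ z := by
      refine intervalIntegral.integral_congr fun z hz => ?_
      rw [uIcc_of_le hr.1] at hz
      exact X.inner_kap_source_real hψ h1 ⟨hz.1, hz.2.trans hr.2⟩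
    rw [this, intervalIntegral.integral_const_mul, intervalIntegral.integral_deriv_eq_sub
      (fun x _ => (hψ.differentiable two_ne_zero) x) (hd.continuous.intervalIntegrable _ _),
      show ψ 0 = 0 from h0.self_of_nhds, sub_zero]
  rw [val, X.centre_source hψ h0 h1, X.inner_kapInt, hi,
    X.inner_kap_source_real hψ h1 zero_mem_unit, hz]
  ring

theorem inner_kap_one_green_source (σ : ℝ) :
    inner ℝ (X.kap 1) (X.green σ (X.source ψ)) = -X.offset σ (X.source ψ) := by
  have hz : deriv ψ 1 = 0 := by
    rw [h1.deriv_eq]; simp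
  rw [X.inner_kap_one_green, X.val_source hψ h0 h1 σ one_mem_unit, X.centre_source hψ h0 h1,
    X.inner_kap_source_real hψ h1 one_mem_unit, hz, show ψ 1 = 0 from h1.self_of_nhds]
  ring

/-- A bump vanishing near both endpoints lies in the domain of the generator for every σ, so it is a
constant plus a Green potential. The difference d of the two sides has zero real pairing with all
real states. In ⟨d, d⟩ the Green term is moved onto d by self-adjointness and vanishes by
`inner_state_green_of_null`. -/
theorem state_eq_green_source {σ : ℝ} (hσ : 0 ≤ σ) : X.state ψ 0 0 =
    (X.offset σ (X.source ψ) : ℂ) • X.one + X.green σ (X.source ψ) := by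
  set c := X.offset σ (X.source ψ) with hc
  have hψm : MemLp ψ 2 (volume.restrict (Ioo (0 : ℝ) 1)) := memLp_of_continuous hψ.continuous
  set d := X.state ψ 0 0 - ((c : ℂ) • X.one + X.green σ (X.source ψ)) with hd
  have k : ∀ y ∈ Icc (0 : ℝ) 1, inner ℝ (X.kap y) d = 0 := by
    intro y hy
    have hv : ∫ r in y..1, X.val σ (X.source ψ) r = (∫ r in y..1, ψ r) - (1 - y) * c := by
      have : ∫ r in y..1, X.val σ (X.source ψ) r = ∫ r in y..1, (ψ r - c) := by
        refine intervalIntegral.integral_congr fun r hr => ?_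
        rw [uIcc_of_le hy.2] at hr
        exact X.val_source hψ h0 h1 σ ⟨hy.1.trans hr.1, hr.2⟩
      rw [this, intervalIntegral.integral_sub (hψ.continuous.intervalIntegrable _ _)
        intervalIntegrable_const, intervalIntegral.integral_const, smul_eq_mul]
    have hone : inner ℝ (X.kap y) X.one = 2 - y := by
      rw [real_inner_eq_re_inner ℂ, X.inner_kap_one hy]; exact Complex.ofReal_re _
    rw [hd, inner_sub_right, inner_add_right, X.inner_kap_state_real hy _ _ hψm,
      inner_ofReal_smul, hone, X.inner_kap_green_eq_integral hy, hv,
      X.inner_kap_one_green_source hψ h0 h1]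
    ring
  have l : inner ℝ X.leftMass d = 0 := by
    have hone : inner ℝ X.leftMass X.one = 1 := by
      rw [real_inner_eq_re_inner ℂ, X.inner_leftMass_one]; exact Complex.ofReal_re _
    rw [hd, inner_sub_right, inner_add_right, X.inner_leftMass_state_real _ _ hψm,
      inner_ofReal_smul, hone, X.inner_leftMass_green]
    ring
  have hstate : ∀ (g : ℝ → ℝ) (a b : ℝ), MemLp g 2 (volume.restrict (Ioo (0 : ℝ) 1)) →
      inner ℝ (X.state g a b) d = 0 := fun g a b hg => by
    rw [← inner_zero_right (𝕜 := ℝ) (X.state g a b)]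
    exact X.ext_real (fun y hy => by rw [k y hy, inner_zero_right])
      (by rw [l, inner_zero_right]) a b hg
  have hsa : inner ℝ (X.green σ (X.source ψ)) d = inner ℝ (X.source ψ) (X.green σ d) := by
    have h := X.isSelfAdjoint_green hσ
    rw [isSelfAdjoint_iff'] at h
    rw [real_inner_eq_re_inner ℂ, real_inner_eq_re_inner ℂ, ← adjoint_inner_left, h]
  have hdd : inner ℝ d d = 0 := by
    conv_lhs => rw [hd, ← hd, inner_sub_left, inner_add_left]
    rw [hstate ψ 0 0 hψm, hsa, real_inner_comm, inner_ofReal_smul]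
    have e1 : inner ℝ X.one d = 0 := hstate 1 1 1 memLp_one
    have e2 : inner ℝ (X.source ψ) (X.green σ d) = 0 :=
      X.inner_state_green_of_null k l σ 0 0 (memLp_source hψ)
    rw [e2, real_inner_comm X.one d, e1]
    ring
  exact sub_eq_zero.1 (inner_self_eq_zero.1 hdd)

theorem mean_state_bump {σ : ℝ} (hσ : 0 ≤ σ) :
    X.mean (X.state ψ 0 0) = X.offset σ (X.source ψ) := by
  rw [X.state_eq_green_source hψ h0 h1 hσ, mean, inner_add_right, inner_ofReal_smul, mul_add]
  have e1 := X.mean_green σ (X.source ψ)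
  have e2 := X.mean_one
  rw [mean] at e1 e2
  rw [e1, add_zero, mul_left_comm, e2, mul_one]

/-- The generator commutes with the evolution and kills constants. Hence `flow 1` of a bump,
singular at time 0 for general data, has the limit `source ψ` there. -/
theorem flow_bump {σ : ℝ} (hσ : 0 ≤ σ) {t : ℝ} (ht : 0 < t) :
    X.flow σ 1 (X.state ψ 0 0) t = X.flow σ 0 (X.source ψ) t := by
  have hg := X.flow_one hσ ht 1
  rw [flow] at hg
  rw [flow, X.state_eq_green_source hψ h0 h1 hσ, map_add, map_smul, hg, smul_zero, zero_add, flow,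
    ← heatOp_succ_mul (X.isSelfAdjoint_green hσ) 0 ht]
  rfl

theorem tendsto_flow_bump {σ : ℝ} (hσ : 0 ≤ σ) :
    Tendsto (X.flow σ 1 (X.state ψ 0 0)) (𝓝[>] 0) (𝓝 (X.source ψ)) := by
  have h := X.tendsto_flow_zero hσ (X.source ψ)
  rw [X.centre_source hψ h0 h1] at h
  refine h.congr' ?_
  filter_upwards [self_mem_nhdsWithin] with t ht
  exact (X.flow_bump hψ h0 h1 hσ ht).symm

theorem tendsto_temp_bump {σ : ℝ} (hσ : 0 ≤ σ) {r : ℝ} (hr : r ∈ Icc (0 : ℝ) 1) :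
    Tendsto (fun t => X.temp σ (X.state ψ 0 0) r t) (𝓝[>] 0) (𝓝 (ψ r)) := by
  have hc : Continuous fun F : H => X.val σ F r :=
    X.continuous_val_uncurry.comp (continuous_const.prodMk (continuous_id.prodMk continuous_const))
  have h := ((hc.tendsto _).comp (X.tendsto_flow_bump hψ h0 h1 hσ)).const_add
    (X.mean (X.state ψ 0 0))
  rw [X.val_source hψ h0 h1 σ hr, X.mean_state_bump hψ h0 h1 hσ, add_sub_cancel] at h
  simpa only [temp, X.mean_state_bump hψ h0 h1 hσ, Function.comp_def] using h

/-- Positivity of the evolution of a bump. -/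
theorem evolution_bump_nonneg {σ : ℝ} (hσ : 0 ≤ σ) (hpos : ∀ x, 0 ≤ ψ x) {t : ℝ} (ht : 0 < t) :
    (∀ r ∈ Icc (0 : ℝ) 1, 0 ≤ X.temp σ (X.state ψ 0 0) r t) ∧
      0 ≤ X.resLeft σ (X.state ψ 0 0) t ∧ 0 ≤ X.resRight σ (X.state ψ 0 0) t := by
  set g := X.state ψ 0 0 with hg
  -- Assigning `source ψ` at time 0 makes `flow 1` continuous on [0,∞), so the density is jointly
  -- continuous on the closed rectangle, as the minimum principle requires.
  set E : ℝ → H := Function.update (X.flow σ 1 g) 0 (X.source ψ) with hE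
  have hE0 : E 0 = X.source ψ := Function.update_self ..
  have hEpos : ∀ s, 0 < s → E s = X.flow σ 1 g s := fun s hs => Function.update_of_ne hs.ne' _ _
  have hEev : ∀ s, 0 < s → E =ᶠ[𝓝 s] X.flow σ 1 g := fun s hs => by
    filter_upwards [lt_mem_nhds hs] with x hx using hEpos x hx
  have hEc : ContinuousOn E (Ici 0) := by
    intro s hs
    rcases (show (0 : ℝ) ≤ s from hs).eq_or_lt with rfl | hs
    · rw [← continuousWithinAt_Ioi_iff_Ici, ContinuousWithinAt, hE0]
      refine (X.tendsto_flow_bump hψ h0 h1 hσ).congr' ?_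
      filter_upwards [self_mem_nhdsWithin] with x hx using (hEpos x hx).symm
    · exact (((X.hasDerivAt_flow hσ g 1 hs).continuousAt).congr
        (hEev s hs).symm).continuousWithinAt
  have hsub : Icc 0 t ⊆ Ici (0 : ℝ) := Icc_subset_Ici_self
  have hmean := X.mean_state_bump hψ h0 h1 hσ
  rw [← hg] at hmean
  have hcU : ContinuousOn (fun p : ℝ × ℝ => X.mean g + X.val σ (E p.2) p.1)
      (Icc 0 1 ×ˢ Icc 0 t) := by
    have e1 : ContinuousOn (fun p : ℝ × ℝ => E p.2) (Icc (0 : ℝ) 1 ×ˢ Icc 0 t) :=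
      hEc.comp continuousOn_snd fun p hp => hsub hp.2
    have e2 : ContinuousOn (fun p : ℝ × ℝ => (σ, E p.2, p.1)) (Icc (0 : ℝ) 1 ×ˢ Icc 0 t) :=
      continuousOn_const.prodMk (e1.prodMk continuousOn_fst)
    have e3 := Continuous.comp_continuousOn (g := fun p : ℝ × H × ℝ => X.val p.1 p.2.1 p.2.2)
      X.continuous_val_uncurry e2
    simp only [Function.comp_def] at e3
    exact (continuousOn_const (c := X.mean g)).add e3
  have hcG : ∀ x : H, ContinuousOn (fun s => X.mean g + inner ℝ x (X.green σ (E s)))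
      (Icc 0 t) := fun x => by
    have e1 : ContinuousOn (fun s => X.green σ (E s)) (Icc 0 t) :=
      (X.green σ).continuous.comp_continuousOn (hEc.mono hsub)
    exact (continuousOn_const (c := X.mean g)).add
      ((continuousOn_const (c := x)).inner (𝕜 := ℝ) e1)
  have hresL : ∀ s, 0 < s →
      X.mean g + inner ℝ X.leftMass (X.green σ (E s)) = X.resLeft σ g s := fun s hs => by
    rw [hEpos s hs, X.green_flow hσ g 0 hs]; rfl
  have hresR : ∀ s, 0 < s →
      X.mean g + inner ℝ (X.kap 1) (X.green σ (E s)) = X.resRight σ g s := fun s hs => by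
    rw [hEpos s hs, X.green_flow hσ g 0 hs]; rfl
  have hU : ∀ r s, 0 < s → X.mean g + X.val σ (E s) r = X.temp σ g r s := fun r s hs => by
    rw [hEpos s hs]; rfl
  have main := heat_reservoir_nonneg (σ := σ) (T := t) hσ ht.le
    (U := fun r s => X.mean g + X.val σ (E s) r)
    (J := fun r s => X.current σ g r s) (w := fun r s => -X.val σ (X.flow σ 2 g s) r)
    (a := fun s => X.mean g + inner ℝ X.leftMass (X.green σ (E s)))
    (b := fun s => X.mean g + inner ℝ (X.kap 1) (X.green σ (E s)))
    hcU (hcG _) (hcG _)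
    (fun r _ s hs => (X.hasDerivAt_temp_time hσ g hs.1 r).congr_of_eventuallyEq (by
      filter_upwards [lt_mem_nhds hs.1] with x hx using hU r x hx))
    (fun r _ s hs => by
      simp only [hU _ s hs.1]
      exact (X.hasDerivAt_temp_space hσ g hs.1 r).hasDerivWithinAt)
    (fun r hr s hs => (X.hasDerivWithinAt_current hσ g hs.1
      (Ioo_subset_Icc_self hr)).hasDerivAt (Icc_mem_nhds hr.1 hr.2))
    (fun s hs => (X.hasDerivAt_resLeft hσ g hs.1).congr_of_eventuallyEq (by
      filter_upwards [lt_mem_nhds hs.1] with x hx using hresL x hx))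
    (fun s hs => (X.hasDerivAt_resRight hσ g hs.1).congr_of_eventuallyEq (by
      filter_upwards [lt_mem_nhds hs.1] with x hx using hresR x hx))
    (fun s hs => by rw [hU _ s hs.1, hresL s hs.1]; exact X.temp_zero_sub hσ g hs.1)
    (fun s hs => by rw [hU _ s hs.1, hresR s hs.1]; exact X.temp_one_sub hσ g hs.1)
    (fun r hr => by
      rw [hE0, X.val_source hψ h0 h1 σ hr, hmean, add_sub_cancel]
      exact hpos r)
    (by rw [hE0, X.inner_leftMass_green, hmean, add_neg_cancel])
    (by rw [hE0, X.inner_kap_one_green_source hψ h0 h1, hmean, add_neg_cancel])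
  have ht' : t ∈ Icc 0 t := ⟨ht.le, le_rfl⟩
  refine ⟨fun r hr => ?_, ?_, ?_⟩
  · rw [← hU r t ht]; exact main.1 r hr t ht'
  · rw [← hresL t ht]; exact main.2.1 t ht'
  · rw [← hresR t ht]; exact main.2.2 t ht'

end Bump

/-- The evolution of a nonnegative state is nonnegative. -/
theorem temp_nonneg {σ : ℝ} (hσ : 0 ≤ σ) {f : ℝ → ℝ} {a b : ℝ}
    (hf : MemLp f 2 (volume.restrict (Ioo (0 : ℝ) 1))) (hf0 : ∀ x ∈ Ioo (0 : ℝ) 1, 0 ≤ f x)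
    (ha : 0 ≤ a) (hb : 0 ≤ b) {r t : ℝ} (hr : r ∈ Icc (0 : ℝ) 1) (ht : 0 < t) :
    0 ≤ X.temp σ (X.state f a b) r t := by
  set F := X.state f a b with hF
  have hcont := X.continuous_temp_space hσ F ht
  suffices h : ∀ r ∈ Ioo (0 : ℝ) 1, 0 ≤ X.temp σ F r t by
    have hcl : IsClosed {r | 0 ≤ X.temp σ F r t} := isClosed_le continuous_const hcont
    have := hcl.closure_subset_iff.2 (show Ioo (0 : ℝ) 1 ⊆ _ from h)
    rw [closure_Ioo zero_ne_one] at this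
    exact this hr
  intro r₀ hr₀
  by_contra! hneg
  have hopen : {r | X.temp σ F r t < 0} ∩ Ioo 0 1 ∈ 𝓝 r₀ :=
    inter_mem ((isOpen_lt hcont continuous_const).mem_nhds hneg) (Ioo_mem_nhds hr₀.1 hr₀.2)
  obtain ⟨δ, hδ, hball⟩ := Metric.nhds_basis_closedBall.mem_iff.1 hopen
  -- Duality: pairing the evolution of F with a bump supported where the density is negative gives a
  -- negative number. By self-adjointness it is also the pairing of F with the nonnegative evolution
  -- of the bump.
  let ψ : ContDiffBump r₀ := ⟨δ / 2, δ, by positivity, by linarith⟩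
  have hout : ∀ x ∉ Metric.closedBall r₀ δ, ψ x = 0 := fun x hx =>
    ψ.zero_of_le_dist (not_le.1 hx).le
  have hev : ∀ y, y ∉ Metric.closedBall r₀ δ → (ψ : ℝ → ℝ) =ᶠ[𝓝 y] 0 := fun y hy => by
    filter_upwards [Metric.isClosed_closedBall.isOpen_compl.mem_nhds hy] with x hx using hout x hx
  have h0 := hev 0 fun h => (hball h).2.1.ne rfl
  have h1 := hev 1 fun h => (hball h).2.2.ne rfl
  have hψc : ContDiff ℝ 2 ψ := ψ.contDiff
  have hψm := memLp_of_continuous hψc.continuous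
  obtain ⟨p1, p2, p3⟩ := X.evolution_bump_nonneg hψc h0 h1 hσ (fun x => ψ.nonneg) ht
  have e1 := X.inner_state_flow hσ F 0 0 hψm ht
  have e2 := X.inner_state_flow hσ (X.state ψ 0 0) a b hf ht
  have hnonneg : 0 ≤ (∫ x in (0 : ℝ)..1, f x * X.temp σ (X.state ψ 0 0) x t) +
      a * X.resLeft σ (X.state ψ 0 0) t + b * X.resRight σ (X.state ψ 0 0) t := by
    refine add_nonneg (add_nonneg ?_ (mul_nonneg ha p2)) (mul_nonneg hb p3)
    rw [intervalIntegral.integral_of_le zero_le_one, integral_Ioc_eq_integral_Ioo]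
    exact setIntegral_nonneg measurableSet_Ioo fun x hx =>
      mul_nonneg (hf0 x hx) (p1 x (Ioo_subset_Icc_self hx))
  rw [← e2, ← hF, ← X.inner_flow_comm, real_inner_comm] at hnonneg
  -- The constant parts of the two pairings agree, both being a third of the product of the total
  -- contents.
  have e3 : X.mean (X.state ψ 0 0) * inner ℝ F X.one =
      X.mean F * inner ℝ (X.state ψ 0 0) X.one := by
    rw [mean, mean, real_inner_comm F, real_inner_comm (X.state ψ 0 0)]; ring
  have hlt : 0 < ∫ x in (0 : ℝ)..1, -(ψ x * X.temp σ F x t) := by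
    have hc : Continuous fun x => -(ψ x * X.temp σ F x t) := (hψc.continuous.mul hcont).neg
    refine intervalIntegral.integral_pos zero_lt_one hc.continuousOn (fun x hx => ?_)
      ⟨r₀, Ioo_subset_Icc_self hr₀, ?_⟩
    · by_cases hxb : x ∈ Metric.closedBall r₀ δ
      · have := (hball hxb).1
        have h2 : 0 ≤ ψ x := ψ.nonneg
        have h3 : X.temp σ F x t < 0 := this
        nlinarith
      · rw [hout x hxb]; simp
    · have : ψ r₀ = 1 := ψ.one_of_mem_closedBall (by simp; positivity)
      rw [this]; linarith
  rw [intervalIntegral.integral_neg] at hlt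
  rw [zero_mul, zero_mul, add_zero, add_zero] at e1
  linarith

end StateSpace

/-! ### Bounds and attainment of the initial datum. -/

theorem IsInitialDatum.memLp {u₀ : ℝ → ℝ} (h : IsInitialDatum u₀) :
    MemLp u₀ 2 (volume.restrict (Ioo (0 : ℝ) 1)) := by
  refine MemLp.of_bound (h.1.aestronglyMeasurable measurableSet_Ioo) 1 ?_
  filter_upwards [ae_restrict_mem measurableSet_Ioo] with x hx
  rw [Real.norm_eq_abs, abs_le]
  exact ⟨by linarith [(h.2 x hx).1], (h.2 x hx).2⟩

theorem IsInitialDatum.one_sub {u₀ : ℝ → ℝ} (h : IsInitialDatum u₀) :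
    IsInitialDatum (fun x => 1 - u₀ x) :=
  ⟨continuousOn_const.sub h.1, fun r hr => ⟨by linarith [(h.2 r hr).2], by linarith [(h.2 r hr).1]⟩⟩

namespace StateSpace

variable {H : Type*} [NormedAddCommGroup H] [InnerProductSpace ℂ H] [CompleteSpace H]
  (X : StateSpace H)

open InnerProductSpace ContinuousLinearMap

theorem _root_.MeasureTheory.MemLp.intervalIntegrable_unit {g : ℝ → ℝ}
    (hg : MemLp g 2 (volume.restrict (Ioo (0 : ℝ) 1))) {y : ℝ} (hy : y ∈ Icc (0 : ℝ) 1) :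
    IntervalIntegrable g volume y 1 := by
  have hi : IntervalIntegrable g volume 0 1 := by
    rw [intervalIntegrable_iff_integrableOn_Ioo_of_le zero_le_one]
    exact hg.integrable (by norm_num)
  refine hi.mono_set ?_
  rw [uIcc_of_le hy.2, uIcc_of_le zero_le_one]
  exact Icc_subset_Icc_left hy.1

theorem state_sub {g g' : ℝ → ℝ} (a b a' b' : ℝ)
    (hg : MemLp g 2 (volume.restrict (Ioo (0 : ℝ) 1)))
    (hg' : MemLp g' 2 (volume.restrict (Ioo (0 : ℝ) 1))) :
    X.state (fun x => g x - g' x) (a - a') (b - b') = X.state g a b - X.state g' a' b' := by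
  have hs : MemLp (fun x => g x - g' x) 2 (volume.restrict (Ioo (0 : ℝ) 1)) := hg.sub hg'
  refine X.ext (fun y hy => ?_) ?_
  · rw [inner_sub_right, X.inner_kap_state hy _ _ hs, X.inner_kap_state hy _ _ hg,
      X.inner_kap_state hy _ _ hg', ← Complex.ofReal_sub, intervalIntegral.integral_sub
      (hg.intervalIntegrable_unit hy) (hg'.intervalIntegrable_unit hy)]
    congr 1; ring
  · rw [inner_sub_right, X.inner_leftMass_state _ _ hs, X.inner_leftMass_state _ _ hg,
      X.inner_leftMass_state _ _ hg', ← Complex.ofReal_sub]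

theorem state_smul {g : ℝ → ℝ} (c a b : ℝ)
    (hg : MemLp g 2 (volume.restrict (Ioo (0 : ℝ) 1))) :
    X.state (fun x => c * g x) (c * a) (c * b) = (c : ℂ) • X.state g a b := by
  have hs : MemLp (fun x => c * g x) 2 (volume.restrict (Ioo (0 : ℝ) 1)) := hg.const_mul c
  refine X.ext (fun y hy => ?_) ?_
  · rw [inner_smul_right, X.inner_kap_state hy _ _ hs, X.inner_kap_state hy _ _ hg,
      ← Complex.ofReal_mul, intervalIntegral.integral_const_mul]
    congr 1; ring
  · rw [inner_smul_right, X.inner_leftMass_state _ _ hs, X.inner_leftMass_state _ _ hg,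
      ← Complex.ofReal_mul]

theorem temp_sub (σ : ℝ) (F G : H) (r t : ℝ) :
    X.temp σ (F - G) r t = X.temp σ F r t - X.temp σ G r t := by
  simp only [temp, mean, val, offset, flow, map_sub, inner_sub_right]; ring

theorem temp_smul (σ c : ℝ) (F : H) (r t : ℝ) :
    X.temp σ ((c : ℂ) • F) r t = c * X.temp σ F r t := by
  simp only [temp, mean, val, offset, flow, map_smul, inner_ofReal_smul]; ring

theorem val_zero_state (σ r : ℝ) : X.val σ 0 r = 0 := by
  simp only [val, offset, mean, map_zero, inner_zero_right]; ring

theorem temp_one {σ : ℝ} (hσ : 0 ≤ σ) (r : ℝ) {t : ℝ} (ht : 0 < t) : X.temp σ X.one r t = 1 := by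
  rw [temp, X.flow_one hσ ht, X.mean_one, X.val_zero_state, add_zero]

theorem temp_time_zero (σ : ℝ) (F : H) (r : ℝ) : X.temp σ F r 0 = X.mean F := by
  rw [temp, X.flow_time_zero, X.val_zero_state, add_zero]

section Datum

variable {u₀ : ℝ → ℝ} (hu : IsInitialDatum u₀) {vm vp : ℝ} (hvm : vm ∈ Icc (0 : ℝ) 1)
  (hvp : vp ∈ Icc (0 : ℝ) 1) {σ : ℝ} (hσ : 0 ≤ σ)

include hu

theorem state_one_sub (vm vp : ℝ) :
    X.state (fun x => 1 - u₀ x) (1 - vm) (1 - vp) = X.one - X.state u₀ vm vp :=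
  X.state_sub 1 1 vm vp memLp_one hu.memLp

include hσ

theorem temp_one_sub_datum (vm vp r : ℝ) {t : ℝ} (ht : 0 < t) :
    X.temp σ (X.state (fun x => 1 - u₀ x) (1 - vm) (1 - vp)) r t =
      1 - X.temp σ (X.state u₀ vm vp) r t := by
  rw [X.state_one_sub hu, X.temp_sub, X.temp_one hσ r ht]

include hvm hvp

theorem temp_mem {r t : ℝ} (hr : r ∈ Icc (0 : ℝ) 1) (ht : 0 < t) :
    X.temp σ (X.state u₀ vm vp) r t ∈ Icc (0 : ℝ) 1 := by
  refine ⟨X.temp_nonneg hσ hu.memLp (fun x hx => (hu.2 x hx).1) hvm.1 hvp.1 hr ht, ?_⟩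
  have h := X.temp_nonneg hσ hu.one_sub.memLp (fun x hx => (hu.one_sub.2 x hx).1)
    (sub_nonneg.2 hvm.2) (sub_nonneg.2 hvp.2) hr ht
  rw [X.temp_one_sub_datum hu hσ vm vp r ht] at h
  linarith

theorem eventually_temp_lt {r ε : ℝ} (hr : r ∈ Ioo (0 : ℝ) 1) (hε : 0 < ε) :
    ∀ᶠ t in 𝓝[>] 0, X.temp σ (X.state u₀ vm vp) r t < u₀ r + ε := by
  -- With ψ supported where u₀ < c and ψ ≤ 1, the datum 1 - u₀ dominates (1 - c)ψ. Positivity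
  -- preserves this, and the evolution of ψ at r tends to ψ(r) = 1. The reservoirs play no role
  -- since ψ puts nothing in them.
  set c := u₀ r + ε / 2 with hc
  have hcont : ContinuousAt u₀ r := hu.1.continuousAt (Ioo_mem_nhds hr.1 hr.2)
  have hnhds : {x | u₀ x < c} ∩ Ioo 0 1 ∈ 𝓝 r :=
    inter_mem (hcont.eventually (gt_mem_nhds (by rw [hc]; linarith))) (Ioo_mem_nhds hr.1 hr.2)
  obtain ⟨δ, hδ, hball⟩ := Metric.nhds_basis_closedBall.mem_iff.1 hnhds
  let ψ : ContDiffBump r := ⟨δ / 2, δ, by positivity, by linarith⟩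
  have hout : ∀ x ∉ Metric.closedBall r δ, ψ x = 0 := fun x hx =>
    ψ.zero_of_le_dist (not_le.1 hx).le
  have hev : ∀ y, y ∉ Metric.closedBall r δ → (ψ : ℝ → ℝ) =ᶠ[𝓝 y] 0 := fun y hy => by
    filter_upwards [Metric.isClosed_closedBall.isOpen_compl.mem_nhds hy] with x hx using hout x hx
  have h0 := hev 0 fun h => (hball h).2.1.ne rfl
  have h1 := hev 1 fun h => (hball h).2.2.ne rfl
  have hψc : ContDiff ℝ 2 ψ := ψ.contDiff
  have hψm := memLp_of_continuous hψc.continuous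
  have hψr : ψ r = 1 := ψ.one_of_mem_closedBall (by simp; positivity)
  have hlim := X.tendsto_temp_bump hψc h0 h1 hσ (Ioo_subset_Icc_self hr)
  rw [hψr] at hlim
  have hlim2 : Tendsto (fun t => 1 - (1 - c) * X.temp σ (X.state ψ 0 0) r t) (𝓝[>] 0)
      (𝓝 (1 - (1 - c) * 1)) := (hlim.const_mul _).const_sub _
  filter_upwards [hlim2.eventually (gt_mem_nhds (show 1 - (1 - c) * 1 < u₀ r + ε by
    rw [hc]; linarith)), self_mem_nhdsWithin] with t hlt ht
  refine lt_of_le_of_lt ?_ hlt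
  have hm1 : MemLp (fun x => (1 - c) * ψ x) 2 (volume.restrict (Ioo (0 : ℝ) 1)) :=
    hψm.const_mul _
  have hm2 : MemLp (fun x => (1 - u₀ x) - (1 - c) * ψ x) 2 (volume.restrict (Ioo (0 : ℝ) 1)) :=
    hu.one_sub.memLp.sub hm1
  have hpos := X.temp_nonneg (a := (1 - vm) - (1 - c) * 0) (b := (1 - vp) - (1 - c) * 0) hσ hm2
    (fun x hx => ?_) (by linarith [hvm.2]) (by linarith [hvp.2]) (Ioo_subset_Icc_self hr) ht
  · rw [X.state_sub _ _ _ _ hu.one_sub.memLp hm1, X.state_smul _ _ _ hψm, X.temp_sub, X.temp_smul,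
      X.temp_one_sub_datum hu hσ vm vp r ht] at hpos
    linarith
  · have hx1 := (hu.2 x hx).2
    have hψ0 : 0 ≤ ψ x := ψ.nonneg
    have hψ1 : ψ x ≤ 1 := ψ.le_one
    by_cases hxb : x ∈ Metric.closedBall r δ
    · have h2 : u₀ x < c := (hball hxb).1
      nlinarith
    · rw [hout x hxb]; linarith

/-- The lower bound is the upper bound for the complementary datum 1 - u₀. -/
theorem tendsto_temp {r : ℝ} (hr : r ∈ Ioo (0 : ℝ) 1) :
    Tendsto (fun t => X.temp σ (X.state u₀ vm vp) r t) (𝓝[>] 0) (𝓝 (u₀ r)) := by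
  refine tendsto_order.2 ⟨fun a ha => ?_, fun a ha => ?_⟩
  · have h := X.eventually_temp_lt hu.one_sub (vm := 1 - vm) (vp := 1 - vp)
      ⟨by linarith [hvm.2], by linarith [hvm.1]⟩ ⟨by linarith [hvp.2], by linarith [hvp.1]⟩ hσ hr
      (sub_pos.2 ha)
    filter_upwards [h, self_mem_nhdsWithin] with t h1 ht
    rw [X.temp_one_sub_datum hu hσ vm vp r ht] at h1
    linarith
  · filter_upwards [X.eventually_temp_lt hu hvm hvp hσ hr (sub_pos.2 ha)] with t h
    linarith

end Datum

/-! ### Regularity and existence for both problems. -/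

section Regularity

variable {σ : ℝ} (hσ : 0 ≤ σ) (f : H) {I : Set ℝ} (hI : UniqueDiffOn ℝ I) (hI01 : I ⊆ Icc 0 1)
include hσ

theorem timeDeriv_temp (r : ℝ) {t : ℝ} (ht : 0 < t) :
    timeDeriv (X.temp σ f) r t = -X.val σ (X.flow σ 2 f t) r :=
  (X.hasDerivAt_temp_time hσ f ht r).deriv

include hI

theorem spaceDeriv_temp {r : ℝ} (hr : r ∈ I) {t : ℝ} (ht : 0 < t) :
    spaceDeriv I (X.temp σ f) r t = 2 * X.current σ f r t :=
  (X.hasDerivAt_temp_space hσ f ht r).hasDerivWithinAt.derivWithin (hI r hr)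

include hI01

theorem hasDerivWithinAt_spaceDeriv_temp {r : ℝ} (hr : r ∈ I) {t : ℝ} (ht : 0 < t) :
    HasDerivWithinAt (fun x => spaceDeriv I (X.temp σ f) x t)
      (2 * -X.val σ (X.flow σ 2 f t) r) I r :=
  (((X.hasDerivWithinAt_current hσ f ht (hI01 hr)).mono hI01).const_mul 2).congr
    (fun _ hx => X.spaceDeriv_temp hσ f hI hx ht) (X.spaceDeriv_temp hσ f hI hr ht)

theorem spaceDeriv2_temp {r : ℝ} (hr : r ∈ I) {t : ℝ} (ht : 0 < t) :
    spaceDeriv2 I (X.temp σ f) r t = 2 * -X.val σ (X.flow σ 2 f t) r :=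
  (X.hasDerivWithinAt_spaceDeriv_temp hσ f hI hI01 hr ht).derivWithin (hI r hr)

theorem heat_temp {r : ℝ} (hr : r ∈ I) {t : ℝ} (ht : 0 < t) :
    timeDeriv (X.temp σ f) r t = 1 / 2 * spaceDeriv2 I (X.temp σ f) r t := by
  rw [X.timeDeriv_temp hσ f r ht, X.spaceDeriv2_temp hσ f hI hI01 hr ht]
  ring

theorem isC21_temp : IsC21 I (X.temp σ f) where
  diff_r r _ t ht := (X.hasDerivAt_temp_space hσ f ht r).differentiableAt.differentiableWithinAt
  diff_rr r hr t ht :=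
    (X.hasDerivWithinAt_spaceDeriv_temp hσ f hI hI01 hr ht).differentiableWithinAt
  diff_t r _ t ht := (X.hasDerivAt_temp_time hσ f ht r).differentiableAt
  cont := (X.continuousOn_temp hσ f).mono (prod_mono_left (subset_univ I))
  cont_r := (((X.continuousOn_current hσ f).mono (prod_mono_left (subset_univ I))).const_mul
    2).congr fun _ hp => X.spaceDeriv_temp hσ f hI hp.1 hp.2
  cont_rr := (((X.continuousOn_val_flow hσ f 2).mono
    (prod_mono_left (subset_univ I))).neg.const_mul 2).congr
    fun _ hp => X.spaceDeriv2_temp hσ f hI hI01 hp.1 hp.2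
  cont_t := ((X.continuousOn_val_flow hσ f 2).mono (prod_mono_left (subset_univ I))).neg.congr
    fun _ hp => X.timeDeriv_temp hσ f _ hp.2

end Regularity

theorem isStickySolution_temp {u₀ : ℝ → ℝ} (hu : IsInitialDatum u₀) {vm vp : ℝ}
    (hvm : vm ∈ Icc (0 : ℝ) 1) (hvp : vp ∈ Icc (0 : ℝ) 1) :
    IsStickySolution u₀ vm vp (X.temp 0 (X.state u₀ vm vp)) := by
  set F := X.state u₀ vm vp with hF
  have hI : UniqueDiffOn ℝ (Icc (0 : ℝ) 1) := uniqueDiffOn_Icc zero_lt_one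
  have hL : ∀ t, 0 < t → X.temp 0 F 0 t = X.resLeft 0 F t := fun t ht => by
    have := X.temp_zero_sub le_rfl F ht
    linarith
  have hR : ∀ t, 0 < t → X.temp 0 F 1 t = X.resRight 0 F t := fun t ht => by
    have := X.temp_one_sub le_rfl F ht
    linarith
  refine ⟨X.isC21_temp le_rfl F hI subset_rfl, ⟨1, fun r hr t ht => ?_⟩,
    fun r hr t ht => X.heat_temp le_rfl F hI subset_rfl (Ioo_subset_Icc_self hr) ht,
    fun r hr => X.tendsto_temp hu hvm hvp le_rfl hr, fun t ht => ?_, fun t ht => ?_, ?_, ?_⟩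
  · have := X.temp_mem hu hvm hvp le_rfl hr ht
    rw [abs_le]
    exact ⟨by linarith [this.1], this.2⟩
  · rw [X.spaceDeriv_temp le_rfl F hI zero_mem_unit ht]
    refine ((X.hasDerivAt_resLeft le_rfl F ht).congr_of_eventuallyEq ?_).congr_deriv (by ring)
    filter_upwards [lt_mem_nhds ht] with s hs using hL s hs
  · rw [X.spaceDeriv_temp le_rfl F hI one_mem_unit ht]
    refine ((X.hasDerivAt_resRight le_rfl F ht).congr_of_eventuallyEq ?_).congr_deriv (by ring)
    filter_upwards [lt_mem_nhds ht] with s hs using hR s hs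
  · have h := X.tendsto_resLeft le_rfl F
    rw [hF, X.inner_leftMass_state_real _ _ hu.memLp] at h
    refine h.congr' ?_
    filter_upwards [self_mem_nhdsWithin] with t ht using (hL t ht).symm
  · have h := X.tendsto_resRight le_rfl F
    rw [hF, X.inner_kap_state_real one_mem_unit _ _ hu.memLp, intervalIntegral.integral_same,
      zero_add] at h
    refine h.congr' ?_
    filter_upwards [self_mem_nhdsWithin] with t ht using (hR t ht).symm

theorem mean_mem {u₀ : ℝ → ℝ} (hu : IsInitialDatum u₀) {vm vp : ℝ}
    (hvm : vm ∈ Icc (0 : ℝ) 1) (hvp : vp ∈ Icc (0 : ℝ) 1) :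
    X.mean (X.state u₀ vm vp) ∈ Icc (0 : ℝ) 1 := by
  have h : ∀ w : ℝ → ℝ, IsInitialDatum w → 0 ≤ ∫ x in (0 : ℝ)..1, w x := by
    intro w hw
    rw [intervalIntegral.integral_of_le zero_le_one, integral_Ioc_eq_integral_Ioo]
    exact setIntegral_nonneg measurableSet_Ioo fun x hx => (hw.2 x hx).1
  have h1 := h _ hu
  have h2 := h _ hu.one_sub
  rw [intervalIntegral.integral_sub intervalIntegrable_const
    (hu.memLp.intervalIntegrable_unit zero_mem_unit), intervalIntegral.integral_const] at h2
  rw [X.mean_eq, X.inner_leftMass_state_real _ _ hu.memLp,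
    X.inner_kap_state_real zero_mem_unit _ _ hu.memLp]
  norm_num at h2
  constructor <;> linarith [hvm.1, hvm.2, hvp.1, hvp.2]

theorem integral_current {σ : ℝ} (hσ : 0 ≤ σ) (f : H) (l : ℝ) {s t : ℝ} (hs : 0 < s)
    (ht : 0 < t) : ∫ τ in s..t, X.current σ f l τ = -(X.mass σ f l t - X.mass σ f l s) := by
  have hsub : uIcc s t ⊆ Ioi (0 : ℝ) := fun x hx => (lt_min hs ht).trans_le hx.1
  have hc : ContinuousOn (fun τ => X.current σ f l τ) (uIcc s t) :=
    (X.continuousOn_current hσ f).comp (f := fun τ : ℝ => (l, τ))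
      (continuousOn_const.prodMk continuousOn_id) fun τ hτ => ⟨mem_univ _, hsub hτ⟩
  have h := intervalIntegral.integral_eq_sub_of_hasDerivAt
    (fun τ hτ => X.hasDerivAt_mass_time hσ f (hsub hτ) l) hc.neg.intervalIntegrable
  rw [intervalIntegral.integral_neg] at h
  linarith

theorem continuous_mass (σ : ℝ) (f : H) (t : ℝ) : Continuous fun y => X.mass σ f y t :=
  ((continuous_const.sub continuous_id).mul continuous_const).add
    (X.continuous_kap.inner (𝕜 := ℝ) continuous_const)

/-- The current through l integrates to the change of `mass` at l. As a pairing with `kap l`, this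
converges as t₀ ↓ 0 although the current may be singular there, and the result is continuous in l.
-/
theorem hasIteratedLimit_current {σ : ℝ} (hσ : 0 ≤ σ) (f : H) {t : ℝ} (ht : 0 < t) {L : Filter ℝ}
    {y : ℝ} (hL : L ≤ 𝓝 y) (hLI : Ioo (0 : ℝ) 1 ∈ L) :
    HasIteratedLimit (fun l t₀ => ∫ s in t₀..t, 1 / 2 * spaceDeriv (Ioo 0 1) (X.temp σ f) l s) L
      (-(X.mass σ f y t - inner ℝ (X.kap y) f)) := by
  refine ⟨fun l => -(X.mass σ f l t - inner ℝ (X.kap l) f), ?_, ?_⟩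
  · filter_upwards [hLI] with l hl
    have h := ((X.tendsto_mass hσ f (Ioo_subset_Icc_self hl)).const_sub (X.mass σ f l t)).neg
    refine h.congr' ?_
    filter_upwards [self_mem_nhdsWithin] with s hs
    rw [← X.integral_current hσ f l hs ht]
    refine intervalIntegral.integral_congr fun τ hτ => ?_
    have hτ0 : 0 < τ := (lt_min hs ht).trans_le hτ.1
    simp only [X.spaceDeriv_temp hσ f isOpen_Ioo.uniqueDiffOn hl hτ0]
    ring
  · have hc : Continuous fun l => -(X.mass σ f l t - inner ℝ (X.kap l) f) :=
      ((X.continuous_mass σ f t).sub (X.continuous_kap.inner (𝕜 := ℝ) continuous_const)).neg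
    exact (hc.tendsto y).mono_left hL

theorem continuousOn_Ici_ite {v : ℝ} {ρ : ℝ → ℝ} (h0 : Tendsto ρ (𝓝[>] 0) (𝓝 v))
    (hρ : ∀ t, 0 < t → ContinuousAt ρ t) :
    ContinuousOn (fun t => if t ≤ 0 then v else ρ t) (Ici 0) := by
  intro t ht
  rcases (show (0 : ℝ) ≤ t from ht).eq_or_lt with rfl | ht
  · rw [← continuousWithinAt_Ioi_iff_Ici, ContinuousWithinAt, if_pos le_rfl]
    refine h0.congr' ?_
    filter_upwards [self_mem_nhdsWithin] with s hs
    rw [if_neg (not_le.2 hs)]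
  · refine ((hρ t ht).congr ?_).continuousWithinAt
    filter_upwards [lt_mem_nhds ht] with s hs
    rw [if_neg (not_le.2 hs)]

theorem contDiffOn_one_of_hasDerivAt {ρ ρ' : ℝ → ℝ} (h : ∀ t, 0 < t → HasDerivAt ρ (ρ' t) t)
    (hc : ContinuousOn ρ' (Ioi 0)) : ContDiffOn ℝ 1 ρ (Ioi 0) := by
  rw [show (1 : WithTop ℕ∞) = 0 + 1 from rfl, contDiffOn_succ_iff_deriv_of_isOpen isOpen_Ioi]
  refine ⟨fun t ht => (h t ht).differentiableAt.differentiableWithinAt, by simp, ?_⟩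
  rw [contDiffOn_zero]
  exact hc.congr fun t ht => (h t ht).deriv

theorem isReservoirSolution_temp {u₀ : ℝ → ℝ} (hu : IsInitialDatum u₀) {vm vp : ℝ}
    (hvm : vm ∈ Icc (0 : ℝ) 1) (hvp : vp ∈ Icc (0 : ℝ) 1) {σ : ℝ} (hσ : 0 < σ) :
    IsReservoirSolution σ u₀ vm vp (X.temp σ (X.state u₀ vm vp))
      (fun t => if t ≤ 0 then vm else X.resLeft σ (X.state u₀ vm vp) t)
      (fun t => if t ≤ 0 then vp else X.resRight σ (X.state u₀ vm vp) t) := by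
  set F := X.state u₀ vm vp with hF
  have hI : UniqueDiffOn ℝ (Ioo (0 : ℝ) 1) := isOpen_Ioo.uniqueDiffOn
  have hmem : ∀ r ∈ Icc (0 : ℝ) 1, ∀ t, 0 ≤ t → X.temp σ F r t ∈ Icc (0 : ℝ) 1 := by
    intro r hr t ht
    rcases ht.eq_or_lt with rfl | ht
    -- The value at t = 0 is conventional: the mean of the data.
    · rw [X.temp_time_zero]; exact X.mean_mem hu hvm hvp
    · exact X.temp_mem hu hvm hvp hσ.le hr ht
  have hcur : ∀ r : ℝ, ContinuousOn (fun t => X.current σ F r t) (Ioi 0) := fun r =>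
    (X.continuousOn_current hσ.le F).comp (f := fun τ : ℝ => (r, τ))
      (continuousOn_const.prodMk continuousOn_id) fun τ hτ => ⟨mem_univ _, hτ⟩
  have hdL : ∀ t, 0 < t → HasDerivAt (fun t => if t ≤ 0 then vm else X.resLeft σ F t)
      (X.current σ F 0 t) t := fun t ht => by
    refine (X.hasDerivAt_resLeft hσ.le F ht).congr_of_eventuallyEq ?_
    filter_upwards [lt_mem_nhds ht] with s hs
    rw [if_neg (not_le.2 hs)]
  have hdR : ∀ t, 0 < t → HasDerivAt (fun t => if t ≤ 0 then vp else X.resRight σ F t)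
      (-X.current σ F 1 t) t := fun t ht => by
    refine (X.hasDerivAt_resRight hσ.le F ht).congr_of_eventuallyEq ?_
    filter_upwards [lt_mem_nhds ht] with s hs
    rw [if_neg (not_le.2 hs)]
  have hkap0 : inner ℝ (X.kap 1) F = vp := by
    rw [hF, X.inner_kap_state_real one_mem_unit _ _ hu.memLp, intervalIntegral.integral_same,
      zero_add]
  have hleft0 : inner ℝ X.leftMass F = vm := X.inner_leftMass_state_real _ _ hu.memLp
  have hlim0 := X.tendsto_resLeft hσ.le F
  rw [hleft0] at hlim0
  have hlim1 := X.tendsto_resRight hσ.le F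
  rw [hkap0] at hlim1
  refine ⟨X.isC21_temp hσ.le F hI Ioo_subset_Icc_self, ⟨1, fun r hr t ht => ?_⟩,
    (X.continuousOn_temp hσ.le F).mono (prod_mono_left (subset_univ _)),
    hmem 0 zero_mem_unit, hmem 1 one_mem_unit,
    continuousOn_Ici_ite hlim0 fun t ht => (X.hasDerivAt_resLeft hσ.le F ht).continuousAt,
    continuousOn_Ici_ite hlim1 fun t ht => (X.hasDerivAt_resRight hσ.le F ht).continuousAt,
    contDiffOn_one_of_hasDerivAt hdL (hcur 0), contDiffOn_one_of_hasDerivAt hdR (hcur 1).neg,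
    by simp, by simp, fun r hr t ht => X.heat_temp hσ.le F hI Ioo_subset_Icc_self hr ht,
    fun r hr => X.tendsto_temp hu hvm hvp hσ.le hr, fun t ht => ?_, fun t ht => ?_,
    fun t ht => ?_, fun t ht => ?_⟩
  · have := hmem r hr t ht.le
    rw [abs_le]
    exact ⟨by linarith [this.1], this.2⟩
  · refine (hdL t ht).congr_deriv ?_
    rw [if_neg (not_le.2 ht), X.temp_zero_sub hσ.le F ht, inv_mul_cancel_left₀ hσ.ne']
  · refine (hdR t ht).congr_deriv ?_
    rw [if_neg (not_le.2 ht), X.temp_one_sub hσ.le F ht, mul_neg, inv_mul_cancel_left₀ hσ.ne']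
  · have h := X.hasIteratedLimit_current hσ.le F ht (L := 𝓝[>] 0) (y := 0) nhdsWithin_le_nhds
      (Ioo_mem_nhdsGT zero_lt_one)
    convert h using 1
    have e1 := X.resLeft_add_mass hσ.le F ht
    rw [X.mean_eq, hleft0] at e1
    rw [if_neg (not_le.2 ht), if_pos le_rfl]
    linarith
  · have h := X.hasIteratedLimit_current hσ.le F ht (L := 𝓝[<] 1) (y := 1) nhdsWithin_le_nhds
      (Ioo_mem_nhdsLT zero_lt_one)
    convert h using 1
    rw [if_neg (not_le.2 ht), if_pos le_rfl, hkap0, mass, resRight]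
    ring

end StateSpace

/-! ### The integrated problem and its uniqueness. -/

/-- The common integrated form of both boundary value problems: `U` is the density, `J` the
current, `a` and `b` are the contents of the reservoirs. -/
structure IsFluxSolution (σ : ℝ) (u₀ : ℝ → ℝ) (vm vp : ℝ) (U J : ℝ → ℝ → ℝ) (a b : ℝ → ℝ) :
    Prop where
  cont : ContinuousOn (fun p : ℝ × ℝ => U p.1 p.2) (Icc 0 1 ×ˢ Ioi 0)
  bounded : IsBoundedSol U
  current_cont : ∀ y ∈ Ioo (0 : ℝ) 1, ContinuousOn (fun t => J y t) (Ioi 0)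
  current : ∀ r ∈ Ioo (0 : ℝ) 1, ∀ t, 0 < t → HasDerivAt (fun x => U x t) (2 * J r t) r
  flux : ∀ y ∈ Ioo (0 : ℝ) 1, ∀ s t, 0 < s → 0 < t →
    (∫ x in y..1, U x t) + b t - ((∫ x in y..1, U x s) + b s) = -∫ τ in s..t, J y τ
  mass : ∀ s t, 0 < s → 0 < t →
    a t + (∫ x in (0 : ℝ)..1, U x t) + b t = a s + (∫ x in (0 : ℝ)..1, U x s) + b s
  left_exchange : ∀ t, 0 < t → ∃ d, HasDerivAt a d t ∧ U 0 t - a t = σ * d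
  right_exchange : ∀ t, 0 < t → ∃ d, HasDerivAt b d t ∧ U 1 t - b t = σ * d
  initial : ∀ r ∈ Ioo (0 : ℝ) 1, Tendsto (fun t => U r t) (𝓝[>] 0) (𝓝 (u₀ r))
  left_initial : Tendsto a (𝓝[>] 0) (𝓝 vm)
  right_initial : Tendsto b (𝓝[>] 0) (𝓝 vp)

/-- Dominated convergence: D need only be bounded and continuous in time at each interior x. No
joint continuity at the corners is needed, which is the gain from integrating in space. -/
theorem continuousOn_integral_left {D : ℝ → ℝ → ℝ} {T C : ℝ}
    (hmeas : ∀ t ∈ Icc 0 T, ContinuousOn (fun x => D x t) (Ioo 0 1))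
    (hbound : ∀ x ∈ Ioo (0 : ℝ) 1, ∀ t ∈ Icc 0 T, |D x t| ≤ C)
    (hcont : ∀ x ∈ Ioo (0 : ℝ) 1, ContinuousOn (fun t => D x t) (Icc 0 T)) :
    ContinuousOn (fun p : ℝ × ℝ => ∫ x in p.1..1, D x p.2) (Icc 0 1 ×ˢ Icc 0 T) := by
  have key : ContinuousOn (fun p : ℝ × ℝ => ∫ x in Ioo (0 : ℝ) 1, (Ioi p.1).indicator
      (fun x => D x p.2) x) (Icc 0 1 ×ˢ Icc 0 T) := by
    intro p hp
    refine continuousWithinAt_of_dominated (bound := fun _ => C) ?_ ?_ (integrable_const C) ?_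
    · filter_upwards [self_mem_nhdsWithin] with q hq
      exact ((hmeas q.2 hq.2).aestronglyMeasurable measurableSet_Ioo).indicator measurableSet_Ioi
    · filter_upwards [self_mem_nhdsWithin] with q hq
      filter_upwards [ae_restrict_mem measurableSet_Ioo] with x hx
      have hC : 0 ≤ C := (abs_nonneg _).trans (hbound x hx q.2 hq.2)
      by_cases h : x ∈ Ioi q.1
      · rw [indicator_of_mem h]; exact hbound x hx q.2 hq.2
      · rw [indicator_of_notMem h, norm_zero]; exact hC
    · have hne : ∀ᵐ x ∂(volume.restrict (Ioo (0 : ℝ) 1)), x ≠ p.1 :=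
        ae_restrict_of_ae (by simp [ae_iff, measure_singleton])
      filter_upwards [ae_restrict_mem measurableSet_Ioo, hne] with x hx hxp
      rcases lt_or_gt_of_ne hxp with h | h
      · refine (continuousWithinAt_const (b := (0 : ℝ))).congr_of_eventuallyEq ?_ ?_
        · have : ∀ᶠ q : ℝ × ℝ in 𝓝[Icc 0 1 ×ˢ Icc 0 T] p, x < q.1 :=
            nhdsWithin_le_nhds (continuous_fst.continuousAt.eventually (lt_mem_nhds h))
          filter_upwards [this] with q hq
          exact indicator_of_notMem (not_lt.2 hq.le) _
        · exact indicator_of_notMem (not_lt.2 h.le) _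
      · have h2 : ContinuousWithinAt (fun q : ℝ × ℝ => D x q.2) (Icc 0 1 ×ˢ Icc 0 T) p :=
          (hcont x hx p.2 hp.2).comp continuous_snd.continuousWithinAt fun q hq => hq.2
        refine h2.congr_of_eventuallyEq ?_ ?_
        · have : ∀ᶠ q : ℝ × ℝ in 𝓝[Icc 0 1 ×ˢ Icc 0 T] p, q.1 < x :=
            nhdsWithin_le_nhds (continuous_fst.continuousAt.eventually (gt_mem_nhds h))
          filter_upwards [this] with q hq
          exact indicator_of_mem (mem_Ioi.2 hq) _
        · exact indicator_of_mem (mem_Ioi.2 h) _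
  refine key.congr fun p hp => ?_
  simp only
  rw [intervalIntegral.integral_of_le hp.1.2, integral_Ioc_eq_integral_Ioo,
    integral_indicator measurableSet_Ioi, Measure.restrict_restrict measurableSet_Ioi]
  congr 2
  ext x
  simp only [mem_Ioo, mem_inter_iff, mem_Ioi]
  exact ⟨fun h => ⟨h.1, hp.1.1.trans_lt h.1, h.2⟩, fun h => ⟨h.1, h.2.2⟩⟩

theorem hasDerivWithinAt_integral_left {g : ℝ → ℝ} (hg : ContinuousOn g (Icc 0 1)) {r : ℝ}
    (hr : r ∈ Icc (0 : ℝ) 1) :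
    HasDerivWithinAt (fun y => ∫ x in y..1, g x) (-g r) (Icc 0 1) r := by
  set G : ℝ → ℝ := IccExtend zero_le_one ((Icc (0 : ℝ) 1).domRestrict g) with hG
  have hGc : Continuous G := (continuousOn_iff_continuous_domRestrict.1 hg).Icc_extend'
  have hGe : ∀ x ∈ Icc (0 : ℝ) 1, G x = g x := fun x hx => by
    rw [hG, IccExtend_of_mem _ _ hx, domRestrict_apply]
  have h := (intervalIntegral.integral_hasDerivAt_left (hGc.intervalIntegrable r 1)
    (hGc.stronglyMeasurableAtFilter _ _) hGc.continuousAt).hasDerivWithinAt (s := Icc 0 1)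
  rw [hGe r hr] at h
  have he : ∀ y ∈ Icc (0 : ℝ) 1, ∫ x in y..1, g x = ∫ x in y..1, G x := fun y hy => by
    refine intervalIntegral.integral_congr fun x hx => ?_
    rw [uIcc_of_le hy.2] at hx
    exact (hGe x ⟨hy.1.trans hx.1, hx.2⟩).symm
  exact h.congr he (he r hr)

namespace IsFluxSolution

variable {σ : ℝ} {u₀ u₁ : ℝ → ℝ} {vm vp wm wp : ℝ} {U J V K : ℝ → ℝ → ℝ} {a b c d : ℝ → ℝ}

theorem continuousOn_space (h : IsFluxSolution σ u₀ vm vp U J a b) {t : ℝ} (ht : 0 < t) :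
    ContinuousOn (fun x => U x t) (Icc 0 1) :=
  h.cont.comp (f := fun x : ℝ => (x, t)) (continuousOn_id.prodMk continuousOn_const)
    fun _ hx => ⟨hx, ht⟩

theorem continuousOn_time (h : IsFluxSolution σ u₀ vm vp U J a b) {x : ℝ}
    (hx : x ∈ Icc (0 : ℝ) 1) : ContinuousOn (fun t => U x t) (Ioi 0) :=
  h.cont.comp (f := fun t : ℝ => (x, t)) (continuousOn_const.prodMk continuousOn_id)
    fun _ ht => ⟨hx, ht⟩

theorem intervalIntegrable_space (h : IsFluxSolution σ u₀ vm vp U J a b) {t : ℝ} (ht : 0 < t)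
    {y : ℝ} (hy : y ∈ Icc (0 : ℝ) 1) : IntervalIntegrable (fun x => U x t) volume y 1 := by
  refine ((h.continuousOn_space ht).mono ?_).intervalIntegrable
  rw [uIcc_of_le hy.2]
  exact Icc_subset_Icc_left hy.1

theorem intervalIntegrable_current (h : IsFluxSolution σ u₀ vm vp U J a b) {y : ℝ}
    (hy : y ∈ Ioo (0 : ℝ) 1) {s t : ℝ} (hs : 0 < s) (ht : 0 < t) :
    IntervalIntegrable (fun τ => J y τ) volume s t :=
  ((h.current_cont y hy).mono fun _ hx => (lt_min hs ht).trans_le hx.1).intervalIntegrable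

theorem sub (h : IsFluxSolution σ u₀ vm vp U J a b) (h' : IsFluxSolution σ u₁ wm wp V K c d) :
    IsFluxSolution σ (fun x => u₀ x - u₁ x) (vm - wm) (vp - wp) (fun r t => U r t - V r t)
      (fun r t => J r t - K r t) (fun t => a t - c t) (fun t => b t - d t) where
  cont := h.cont.sub h'.cont
  bounded := by
    obtain ⟨C, hC⟩ := h.bounded
    obtain ⟨C', hC'⟩ := h'.bounded
    exact ⟨C + C', fun r hr t ht => (abs_sub _ _).trans (add_le_add (hC r hr t ht) (hC' r hr t ht))⟩
  current_cont y hy := (h.current_cont y hy).sub (h'.current_cont y hy)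
  current r hr t ht := ((h.current r hr t ht).sub (h'.current r hr t ht)).congr_deriv (by ring)
  flux y hy s t hs ht := by
    have hy' := Ioo_subset_Icc_self hy
    have e1 := h.flux y hy s t hs ht
    have e2 := h'.flux y hy s t hs ht
    rw [intervalIntegral.integral_sub (h.intervalIntegrable_space ht hy')
      (h'.intervalIntegrable_space ht hy'),
      intervalIntegral.integral_sub (h.intervalIntegrable_space hs hy')
      (h'.intervalIntegrable_space hs hy'),
      intervalIntegral.integral_sub (h.intervalIntegrable_current hy hs ht)
      (h'.intervalIntegrable_current hy hs ht)]
    linarith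
  mass s t hs ht := by
    have hy' : (0 : ℝ) ∈ Icc (0 : ℝ) 1 := ⟨le_rfl, zero_le_one⟩
    have e1 := h.mass s t hs ht
    have e2 := h'.mass s t hs ht
    rw [intervalIntegral.integral_sub (h.intervalIntegrable_space ht hy')
      (h'.intervalIntegrable_space ht hy'),
      intervalIntegral.integral_sub (h.intervalIntegrable_space hs hy')
      (h'.intervalIntegrable_space hs hy')]
    linarith
  left_exchange t ht := by
    obtain ⟨x, hx, ex⟩ := h.left_exchange t ht
    obtain ⟨y, hy, ey⟩ := h'.left_exchange t ht
    exact ⟨x - y, hx.sub hy, by linarith⟩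
  right_exchange t ht := by
    obtain ⟨x, hx, ex⟩ := h.right_exchange t ht
    obtain ⟨y, hy, ey⟩ := h'.right_exchange t ht
    exact ⟨x - y, hx.sub hy, by linarith⟩
  initial r hr := (h.initial r hr).sub (h'.initial r hr)
  left_initial := h.left_initial.sub h'.left_initial
  right_initial := h.right_initial.sub h'.right_initial

/-- The density, extended by zero to `t ≤ 0`, is continuous in time when the datum vanishes. -/
theorem continuousOn_time_ite (h : IsFluxSolution σ u₀ vm vp U J a b) (h0 : ∀ r, u₀ r = 0)
    {x : ℝ} (hx : x ∈ Ioo (0 : ℝ) 1) :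
    ContinuousOn (fun t => if t ≤ 0 then 0 else U x t) (Ici 0) := by
  have h1 := h.initial x hx
  rw [h0] at h1
  exact StateSpace.continuousOn_Ici_ite h1 fun t ht =>
    (h.continuousOn_time (Ioo_subset_Icc_self hx)).continuousAt (Ioi_mem_nhds ht)

theorem continuousOn_mass (h : IsFluxSolution σ u₀ vm vp U J a b) (h0 : ∀ r, u₀ r = 0)
    (hp : vp = 0) (T : ℝ) :
    ContinuousOn (fun p : ℝ × ℝ => (∫ x in p.1..1, if p.2 ≤ 0 then 0 else U x p.2) +
      if p.2 ≤ 0 then 0 else b p.2) (Icc 0 1 ×ˢ Icc 0 T) := by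
  obtain ⟨C, hC⟩ := h.bounded
  have hC0 : 0 ≤ C := (abs_nonneg _).trans (hC 0 ⟨le_rfl, zero_le_one⟩ 1 one_pos)
  refine ContinuousOn.add ?_ ?_
  · refine continuousOn_integral_left (D := fun x t => if t ≤ 0 then 0 else U x t) (C := C) ?_ ?_ ?_
    · intro t ht
      rcases ht.1.eq_or_lt with rfl | h'
      · simp only [le_refl, if_true]; exact continuousOn_const
      · simp only [not_le.2 h', if_false]
        exact (h.continuousOn_space h').mono Ioo_subset_Icc_self
    · intro x hx t ht
      rcases ht.1.eq_or_lt with rfl | h'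
      · simpa using hC0
      · simp only [not_le.2 h', if_false]
        exact hC x (Ioo_subset_Icc_self hx) t h'
    · exact fun x hx => (h.continuousOn_time_ite h0 hx).mono Icc_subset_Ici_self
  · have h1 := h.right_initial
    rw [hp] at h1
    have h2 : ContinuousOn (fun t => if t ≤ 0 then 0 else b t) (Ici 0) :=
      StateSpace.continuousOn_Ici_ite h1 fun t ht => by
        obtain ⟨d, hd, -⟩ := h.right_exchange t ht
        exact hd.continuousAt
    exact h2.comp continuousOn_snd fun p hp => hp.2.1

/-- With vanishing data the total content vanishes. -/
theorem total_eq_zero (h : IsFluxSolution σ u₀ vm vp U J a b) (h0 : ∀ r, u₀ r = 0)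
    (hm : vm = 0) (hp : vp = 0) {t : ℝ} (ht : 0 < t) :
    a t + (∫ x in (0 : ℝ)..1, U x t) + b t = 0 := by
  have hc := h.continuousOn_mass h0 hp 1
  have hz : ((0 : ℝ), (0 : ℝ)) ∈ Icc (0 : ℝ) 1 ×ˢ Icc (0 : ℝ) 1 := by simp
  have hlim : Tendsto (fun s : ℝ => ((0 : ℝ), s)) (𝓝[>] 0)
      (𝓝[Icc (0 : ℝ) 1 ×ˢ Icc (0 : ℝ) 1] (0, 0)) := by
    refine tendsto_nhdsWithin_iff.2 ⟨?_, ?_⟩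
    · exact ((continuous_const.prodMk continuous_id).tendsto (0 : ℝ)).mono_left nhdsWithin_le_nhds
    · filter_upwards [Ioo_mem_nhdsGT (zero_lt_one (α := ℝ))] with s hs
      exact ⟨by simp, hs.1.le, hs.2.le⟩
  have h1 := (hc _ hz).tendsto.comp hlim
  simp only [le_refl, if_true, intervalIntegral.integral_zero, add_zero] at h1
  have h2 := h.left_initial.add h1
  rw [hm, add_zero] at h2
  refine tendsto_nhds_unique (tendsto_const_nhds.congr' ?_) h2
  filter_upwards [self_mem_nhdsWithin] with s hs
  simp only [Function.comp_def, not_le.2 (mem_Ioi.1 hs), if_false]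
  rw [h.mass s t hs ht]
  ring

/-- Put m(y,t) = ∫_y¹ U dx + b. Then m_y = -U and m_t = -J, while U_y = 2J. With zero total content
m(0,·) = -a, so the exchange laws become the Robin conditions U + m = -σm_t at 0 and U - m = σm_t at
1. -/
theorem integrated_nonpos (h : IsFluxSolution σ u₀ vm vp U J a b) (hσ : 0 ≤ σ)
    (h0 : ∀ r, u₀ r = 0) (hm : vm = 0) (hp : vp = 0) {r t : ℝ} (hr : r ∈ Icc (0 : ℝ) 1)
    (ht : 0 < t) : (∫ x in r..1, U x t) + b t ≤ 0 := by
  have hpos : ∀ y s, 0 < s → ((∫ x in y..1, if s ≤ 0 then 0 else U x s) +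
      if s ≤ 0 then 0 else b s) = (∫ x in y..1, U x s) + b s := fun y s hs => by
    simp only [not_le.2 hs, if_false]
  have hev : ∀ y s, 0 < s → (fun s => (∫ x in y..1, if s ≤ 0 then 0 else U x s) +
      if s ≤ 0 then 0 else b s) =ᶠ[𝓝 s] fun s => (∫ x in y..1, U x s) + b s := fun y s hs => by
    filter_upwards [lt_mem_nhds hs] with z hz using hpos y z hz
  have main := integrated_heat_nonpos (σ := σ) (T := t) hσ ht.le
    (m := fun y s => (∫ x in y..1, if s ≤ 0 then 0 else U x s) + if s ≤ 0 then 0 else b s)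
    (D := U) (J := J) (h.continuousOn_mass h0 hp t)
    (fun y hy s hs => by
      refine HasDerivAt.congr_of_eventuallyEq ?_ (hev y s hs.1)
      have h1 : HasDerivAt (fun z => (∫ x in y..1, U x s) + b s - ∫ τ in s..z, J y τ)
          (-J y s) s := by
        have hcs := (h.current_cont y hy).continuousAt (Ioi_mem_nhds hs.1)
        have h2 := intervalIntegral.integral_hasDerivAt_right
          (h.intervalIntegrable_current hy hs.1 hs.1)
          ((h.current_cont y hy).stronglyMeasurableAtFilter isOpen_Ioi s hs.1) hcs
        exact h2.const_sub _
      refine h1.congr_of_eventuallyEq ?_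
      filter_upwards [lt_mem_nhds hs.1] with z hz
      linarith [h.flux y hy s z hs.1 hz])
    (fun y hy s hs => by
      simp only [not_le.2 hs.1, if_false]
      exact (hasDerivWithinAt_integral_left (h.continuousOn_space hs.1) hy).add_const _)
    (fun y hy s hs => h.current y hy s hs.1)
    (fun s hs => by
      obtain ⟨d, hd, e⟩ := h.left_exchange s hs.1
      refine ⟨-d, ?_, ?_⟩
      · refine hd.neg.congr_of_eventuallyEq ?_
        filter_upwards [lt_mem_nhds hs.1] with z hz
        rw [hpos 0 z hz]
        linarith [h.total_eq_zero h0 hm hp hz, show (-a) z = -(a z) from rfl]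
      · rw [hpos 0 s hs.1]
        linarith [h.total_eq_zero h0 hm hp hs.1])
    (fun s hs => by
      obtain ⟨d, hd, e⟩ := h.right_exchange s hs.1
      refine ⟨d, ?_, ?_⟩
      · refine hd.congr_of_eventuallyEq ?_
        filter_upwards [lt_mem_nhds hs.1] with z hz
        rw [hpos 1 z hz, intervalIntegral.integral_same, zero_add]
      · rw [hpos 1 s hs.1, intervalIntegral.integral_same, zero_add, e])
    (fun y _ => by simp)
  have := main r hr t ⟨ht.le, le_rfl⟩
  rwa [hpos r t ht] at this

/-- Uniqueness for the integrated problem. -/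
theorem unique (h : IsFluxSolution σ u₀ vm vp U J a b) (h' : IsFluxSolution σ u₀ vm vp V K c d)
    (hσ : 0 ≤ σ) {t : ℝ} (ht : 0 < t) :
    (∀ r ∈ Icc (0 : ℝ) 1, U r t = V r t) ∧ a t = c t ∧ b t = d t := by
  have hs := h.sub h'
  have hs' := h'.sub h
  have hz : ∀ y ∈ Icc (0 : ℝ) 1, (∫ x in y..1, (U x t - V x t)) + (b t - d t) = 0 := by
    intro y hy
    have e1 := hs.integrated_nonpos hσ (fun r => sub_self _) (sub_self _) (sub_self _) hy ht
    have e2 := hs'.integrated_nonpos hσ (fun r => sub_self _) (sub_self _) (sub_self _) hy ht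
    have e3 : ∫ x in y..1, (V x t - U x t) = -∫ x in y..1, (U x t - V x t) := by
      rw [← intervalIntegral.integral_neg]; simp only [neg_sub]
    rw [e3] at e2
    linarith
  have hb : b t = d t := by
    have := hz 1 ⟨zero_le_one, le_rfl⟩
    rw [intervalIntegral.integral_same] at this
    linarith
  refine ⟨fun r hr => ?_, ?_, hb⟩
  · have h1 := (hasDerivWithinAt_integral_left (hs.continuousOn_space ht) hr).add_const (b t - d t)
    have h2 : HasDerivWithinAt (fun y => (∫ x in y..1, (U x t - V x t)) + (b t - d t)) 0
        (Icc 0 1) r :=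
      (hasDerivWithinAt_const r (Icc 0 1) (0 : ℝ)).congr hz (hz r hr)
    have h3 := (uniqueDiffOn_Icc zero_lt_one r hr).eq_deriv _ h1 h2
    linarith
  · have h1 := hs.total_eq_zero (fun r => sub_self _) (sub_self _) (sub_self _) ht
    have h2 := hz 0 ⟨le_rfl, zero_le_one⟩
    linarith

end IsFluxSolution

/-! ### Reduction of both problems to the integrated form. -/

namespace IsC21

variable {I : Set ℝ} {u : ℝ → ℝ → ℝ}

theorem continuousOn_slice {f : ℝ → ℝ → ℝ}
    (h : ContinuousOn (fun p : ℝ × ℝ => f p.1 p.2) (I ×ˢ Ioi 0)) {t : ℝ} (ht : 0 < t) :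
    ContinuousOn (fun x => f x t) I :=
  h.comp (f := fun x : ℝ => (x, t)) (continuousOn_id.prodMk continuousOn_const)
    fun _ hx => ⟨hx, ht⟩

theorem continuousOn_spaceDeriv (h : IsC21 I u) {x : ℝ} (hx : x ∈ I) :
    ContinuousOn (fun t => 1 / 2 * spaceDeriv I u x t) (Ioi 0) :=
  (h.cont_r.comp (f := fun t : ℝ => (x, t)) (continuousOn_const.prodMk continuousOn_id)
    fun _ ht => ⟨hx, ht⟩).const_mul _

theorem intervalIntegrable_spaceDeriv (h : IsC21 I u) {x : ℝ} (hx : x ∈ I) {s t : ℝ} (hs : 0 < s)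
    (ht : 0 < t) : IntervalIntegrable (fun τ => 1 / 2 * spaceDeriv I u x τ) volume s t :=
  ((h.continuousOn_spaceDeriv hx).mono fun _ hx => (lt_min hs ht).trans_le hx.1).intervalIntegrable

theorem hasDerivAt_spaceDeriv (h : IsC21 I u) {x t : ℝ} (hx : I ∈ 𝓝 x) (ht : 0 < t) :
    HasDerivAt (fun x => u x t) (2 * (1 / 2 * spaceDeriv I u x t)) x :=
  ((h.diff_r x (mem_of_mem_nhds hx) t ht).hasDerivWithinAt.hasDerivAt hx).congr_deriv
    (by rw [spaceDeriv]; ring)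

/-- The mass in `[y,l]` changes by the currents through `y` and `l`. -/
theorem hasDerivAt_integral (h : IsC21 I u)
    (heat : ∀ r ∈ Ioo (0 : ℝ) 1, ∀ t : ℝ, 0 < t → timeDeriv u r t = 1 / 2 * spaceDeriv2 I u r t)
    (hI : Ioo 0 1 ⊆ I) {y l : ℝ} (hyl : y ≤ l) (hyI : Icc y l ⊆ I) (hy : Ioo y l ⊆ Ioo 0 1)
    {t : ℝ} (ht : 0 < t) :
    HasDerivAt (fun t => ∫ x in y..l, u x t)
      (1 / 2 * spaceDeriv I u l t - 1 / 2 * spaceDeriv I u y t) t := by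
  have hu : uIoc y l ⊆ Icc y l := by rw [uIoc_of_le hyl]; exact Ioc_subset_Icc_self
  have hsub : Icc y l ×ˢ Icc (t / 2) (2 * t) ⊆ I ×ˢ Ioi 0 := fun p hp =>
    ⟨hyI hp.1, (half_pos ht).trans_le hp.2.1⟩
  obtain ⟨C, hC⟩ := (isCompact_Icc.prod isCompact_Icc).exists_bound_of_continuousOn
    (h.cont_t.mono hsub)
  have hslice : ∀ {f : ℝ → ℝ → ℝ}, ContinuousOn (fun p : ℝ × ℝ => f p.1 p.2) (I ×ˢ Ioi 0) →
      ∀ {s : ℝ}, 0 < s → IntervalIntegrable (fun x => f x s) volume y l := fun hf s hs =>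
    ((continuousOn_slice hf hs).mono (by rwa [uIcc_of_le hyl])).intervalIntegrable
  have hder := (intervalIntegral.hasDerivAt_integral_of_dominated_loc_of_deriv_le
    (F := fun t x => u x t) (F' := fun t x => timeDeriv u x t) (bound := fun _ => C) (μ := volume)
    (Icc_mem_nhds (half_lt_self ht) (by linarith : t < 2 * t))
    (by
      filter_upwards [lt_mem_nhds ht] with s hs
      exact (intervalIntegrable_iff.1 (hslice h.cont hs)).aestronglyMeasurable)
    (hslice h.cont ht)
    (intervalIntegrable_iff.1 (hslice h.cont_t ht)).aestronglyMeasurable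
    (.of_forall fun x hx s hs => hC (x, s) ⟨hu hx, hs⟩)
    intervalIntegrable_const
    (.of_forall fun x hx s hs =>
      (h.diff_t x (hyI (hu hx)) s ((half_pos ht).trans_le hs.1)).hasDerivAt)).2
  refine hder.congr_deriv ?_
  refine intervalIntegral.integral_eq_sub_of_hasDerivAt_of_le hyl
    (f := fun x => 1 / 2 * spaceDeriv I u x t)
    (((continuousOn_slice h.cont_r ht).mono hyI).const_mul _) (fun x hx => ?_)
    (hslice h.cont_t ht)
  have hx1 := hy hx
  have hIx : I ∈ 𝓝 x := mem_of_superset (isOpen_Ioo.mem_nhds hx1) hI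
  have h1 := ((h.diff_rr x (hI hx1) t ht).hasDerivWithinAt.hasDerivAt hIx).const_mul (1 / 2)
  exact h1.congr_deriv (by rw [heat x hx1 t ht, spaceDeriv2])

theorem integral_sub_integral (h : IsC21 I u)
    (heat : ∀ r ∈ Ioo (0 : ℝ) 1, ∀ t : ℝ, 0 < t → timeDeriv u r t = 1 / 2 * spaceDeriv2 I u r t)
    (hI : Ioo 0 1 ⊆ I) {y l : ℝ} (hyl : y ≤ l) (hyI : Icc y l ⊆ I) (hy : Ioo y l ⊆ Ioo 0 1)
    {s t : ℝ} (hs : 0 < s) (ht : 0 < t) :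
    (∫ x in y..l, u x t) - ∫ x in y..l, u x s =
      (∫ τ in s..t, 1 / 2 * spaceDeriv I u l τ) - ∫ τ in s..t, 1 / 2 * spaceDeriv I u y τ := by
  have i1 := h.intervalIntegrable_spaceDeriv (hyI (right_mem_Icc.2 hyl)) hs ht
  have i2 := h.intervalIntegrable_spaceDeriv (hyI (left_mem_Icc.2 hyl)) hs ht
  rw [← intervalIntegral.integral_sub i1 i2]
  exact (intervalIntegral.integral_eq_sub_of_hasDerivAt (fun τ hτ =>
    h.hasDerivAt_integral heat hI hyl hyI hy ((lt_min hs ht).trans_le hτ.1)) (i1.sub i2)).symm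

end IsC21

/-- The reservoirs are the boundary values themselves, so the exchange laws hold with σ = 0.
Regularity up to the boundary permits mass balance on intervals reaching 0 and 1. -/
theorem IsStickySolution.isFluxSolution {u₀ : ℝ → ℝ} {vm vp : ℝ} {u : ℝ → ℝ → ℝ}
    (h : IsStickySolution u₀ vm vp u) :
    IsFluxSolution 0 u₀ vm vp u (fun r t => 1 / 2 * spaceDeriv (Icc 0 1) u r t) (fun t => u 0 t)
      fun t => u 1 t := by
  have h0 : (0 : ℝ) ∈ Icc (0 : ℝ) 1 := left_mem_Icc.2 zero_le_one
  have h1 : (1 : ℝ) ∈ Icc (0 : ℝ) 1 := right_mem_Icc.2 zero_le_one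
  have hpos : ∀ {s t τ : ℝ}, 0 < s → 0 < t → τ ∈ uIcc s t → 0 < τ := fun hs ht hτ =>
    (lt_min hs ht).trans_le hτ.1
  have hL : ∀ s t, 0 < s → 0 < t →
      ∫ τ in s..t, 1 / 2 * spaceDeriv (Icc 0 1) u 0 τ = u 0 t - u 0 s := fun s t hs ht =>
    intervalIntegral.integral_eq_sub_of_hasDerivAt (fun τ hτ => h.left_flux τ (hpos hs ht hτ))
      (h.regular.intervalIntegrable_spaceDeriv h0 hs ht)
  have hR : ∀ s t, 0 < s → 0 < t →
      ∫ τ in s..t, 1 / 2 * spaceDeriv (Icc 0 1) u 1 τ = -(u 1 t - u 1 s) := fun s t hs ht => by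
    have := intervalIntegral.integral_eq_sub_of_hasDerivAt
      (fun τ hτ => h.right_flux τ (hpos hs ht hτ))
      (h.regular.intervalIntegrable_spaceDeriv h1 hs ht).neg
    rw [← this, intervalIntegral.integral_neg, neg_neg]
  have key : ∀ y ∈ Icc (0 : ℝ) 1, ∀ s t, 0 < s → 0 < t →
      (∫ x in y..1, u x t) - ∫ x in y..1, u x s = -(u 1 t - u 1 s) -
        ∫ τ in s..t, 1 / 2 * spaceDeriv (Icc 0 1) u y τ := fun y hy s t hs ht => by
    rw [← hR s t hs ht]
    exact h.regular.integral_sub_integral h.heat Ioo_subset_Icc_self hy.2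
      (Icc_subset_Icc_left hy.1) (Ioo_subset_Ioo_left hy.1) hs ht
  exact
  { cont := h.regular.cont
    bounded := h.bounded
    current_cont := fun y hy => h.regular.continuousOn_spaceDeriv (Ioo_subset_Icc_self hy)
    current := fun r hr t ht =>
      h.regular.hasDerivAt_spaceDeriv (Icc_mem_nhds hr.1 hr.2) ht
    flux := fun y hy s t hs ht => by linarith [key y (Ioo_subset_Icc_self hy) s t hs ht]
    mass := fun s t hs ht => by linarith [key 0 h0 s t hs ht, hL s t hs ht]
    left_exchange := fun t ht => ⟨_, h.left_flux t ht, by simp⟩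
    right_exchange := fun t ht => ⟨_, h.right_flux t ht, by simp⟩
    initial := h.initial
    left_initial := h.left_initial
    right_initial := h.right_initial }

/-- Subtracting the integrals up to t and up to s cancels the starting time t₀, so the inner limit
becomes trivial. -/
theorem HasIteratedLimit.tendsto_integral {J : ℝ → ℝ → ℝ} {L : Filter ℝ} {s t c d : ℝ} (hs : 0 < s)
    (ht : 0 < t) (hJ : ∀ᶠ l in L, ContinuousOn (fun τ => J l τ) (Ioi 0))
    (h1 : HasIteratedLimit (fun l t₀ => ∫ τ in t₀..s, J l τ) L c)
    (h2 : HasIteratedLimit (fun l t₀ => ∫ τ in t₀..t, J l τ) L d) :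
    Tendsto (fun l => ∫ τ in s..t, J l τ) L (𝓝 (d - c)) := by
  obtain ⟨Φ, hΦ, hΦ'⟩ := h1
  obtain ⟨Ψ, hΨ, hΨ'⟩ := h2
  refine (hΨ'.sub hΦ').congr' ?_
  filter_upwards [hJ, hΦ, hΨ] with l hJl hl hl'
  refine (tendsto_nhds_unique (tendsto_const_nhds.congr' ?_) (hl'.sub hl)).symm
  filter_upwards [self_mem_nhdsWithin] with τ hτ
  have hint : ∀ {a b : ℝ}, 0 < a → 0 < b → IntervalIntegrable (fun τ => J l τ) volume a b :=
    fun ha hb => (hJl.mono fun _ hx => (lt_min ha hb).trans_le hx.1).intervalIntegrable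
  have := intervalIntegral.integral_add_adjacent_intervals (hint hτ hs) (hint hs ht)
  linarith

/-- No space derivative is available at the endpoints. Mass balance is written on [y,l] with l < 1;
as l → 1 the iterated limit turns the current through l into the change of `ρp`. Letting y → 0
brings in `ρm` likewise. -/
theorem IsReservoirSolution.isFluxSolution {σ : ℝ} (hσ : 0 < σ) {u₀ : ℝ → ℝ} {vm vp : ℝ}
    {u : ℝ → ℝ → ℝ} {ρm ρp : ℝ → ℝ} (h : IsReservoirSolution σ u₀ vm vp u ρm ρp) :
    IsFluxSolution σ u₀ vm vp u (fun r t => 1 / 2 * spaceDeriv (Ioo 0 1) u r t) ρm ρp := by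
  have hcl : ∀ {t : ℝ}, 0 < t → ContinuousOn (fun x => u x t) (Icc 0 1) := fun ht =>
    IsC21.continuousOn_slice h.cont_closed ht
  have hint : ∀ {t : ℝ}, 0 < t → ∀ {y l : ℝ}, y ∈ Icc (0 : ℝ) 1 → l ∈ Icc (0 : ℝ) 1 →
      IntervalIntegrable (fun x => u x t) volume y l := fun ht y l hy hl =>
    ((hcl ht).mono (uIcc_subset_Icc hy hl)).intervalIntegrable
  have h1 : (1 : ℝ) ∈ Icc (0 : ℝ) 1 := right_mem_Icc.2 zero_le_one
  have h0 : (0 : ℝ) ∈ Icc (0 : ℝ) 1 := left_mem_Icc.2 zero_le_one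
  have htend : ∀ {t : ℝ}, 0 < t → ∀ {r : ℝ}, r ∈ Icc (0 : ℝ) 1 → ∀ {L : Filter ℝ},
      L ≤ 𝓝[Icc 0 1] r → Tendsto (fun y => ∫ x in y..1, u x t) L (𝓝 (∫ x in r..1, u x t)) :=
    fun ht r hr L hL =>
      (hasDerivWithinAt_integral_left (hcl ht) hr).continuousWithinAt.tendsto.mono_left hL
  have hL0 : 𝓝[>] (0 : ℝ) ≤ 𝓝[Icc 0 1] 0 := by
    rw [← nhdsWithin_Ioo_eq_nhdsGT (zero_lt_one (α := ℝ))]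
    exact nhdsWithin_mono _ Ioo_subset_Icc_self
  have hL1 : 𝓝[<] (1 : ℝ) ≤ 𝓝[Icc 0 1] 1 := by
    rw [← nhdsWithin_Ioo_eq_nhdsLT (zero_lt_one (α := ℝ))]
    exact nhdsWithin_mono _ Ioo_subset_Icc_self
  have flux : ∀ y ∈ Ioo (0 : ℝ) 1, ∀ s t, 0 < s → 0 < t →
      (∫ x in y..1, u x t) + ρp t - ((∫ x in y..1, u x s) + ρp s) =
        -∫ τ in s..t, 1 / 2 * spaceDeriv (Ioo 0 1) u y τ := by
    intro y hy s t hs ht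
    have hJ := HasIteratedLimit.tendsto_integral hs ht
      (by
        filter_upwards [Ioo_mem_nhdsLT (zero_lt_one (α := ℝ))] with l hl
        exact h.regular.continuousOn_spaceDeriv hl)
      (h.right_flux s hs) (h.right_flux t ht)
    have hM := ((htend ht h1 hL1).sub (htend hs h1 hL1)).const_sub
      ((∫ x in y..1, u x t) - ∫ x in y..1, u x s)
    simp only [intervalIntegral.integral_same, sub_zero] at hM
    have := tendsto_nhds_unique (hM.congr' ?_)
      (hJ.sub_const (∫ τ in s..t, 1 / 2 * spaceDeriv (Ioo 0 1) u y τ))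
    · linarith
    · filter_upwards [Ioo_mem_nhdsLT hy.2] with l hl
      have hl' : l ∈ Icc (0 : ℝ) 1 := ⟨(hy.1.trans hl.1).le, hl.2.le⟩
      rw [← h.regular.integral_sub_integral h.heat subset_rfl hl.1.le
        (fun x hx => ⟨hy.1.trans_le hx.1, hx.2.trans_lt hl.2⟩)
        (Ioo_subset_Ioo hy.1.le hl.2.le) hs ht,
        ← intervalIntegral.integral_add_adjacent_intervals
          (hint ht (Ioo_subset_Icc_self hy) hl') (hint ht hl' h1),
        ← intervalIntegral.integral_add_adjacent_intervals
          (hint hs (Ioo_subset_Icc_self hy) hl') (hint hs hl' h1)]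
      ring
  have hexch : ∀ {x y : ℝ}, x - y = σ * (σ⁻¹ * (x - y)) := fun {x y} => by
    rw [mul_inv_cancel_left₀ hσ.ne']
  exact
  { cont := h.cont_closed
    bounded := h.bounded
    current_cont := fun y hy => h.regular.continuousOn_spaceDeriv hy
    current := fun r hr t ht => h.regular.hasDerivAt_spaceDeriv (isOpen_Ioo.mem_nhds hr) ht
    flux := flux
    mass := fun s t hs ht => by
      have hJ := HasIteratedLimit.tendsto_integral hs ht
        (by
          filter_upwards [Ioo_mem_nhdsGT (zero_lt_one (α := ℝ))] with l hl
          exact h.regular.continuousOn_spaceDeriv hl)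
        (h.left_flux s hs) (h.left_flux t ht)
      have hM := ((htend ht h0 hL0).add_const (ρp t)).sub ((htend hs h0 hL0).add_const (ρp s))
      have := tendsto_nhds_unique (hM.congr' ?_) hJ.neg
      · linarith
      · filter_upwards [Ioo_mem_nhdsGT (zero_lt_one (α := ℝ))] with y hy
        exact flux y hy s t hs ht
    left_exchange := fun t ht => ⟨_, h.left_exchange t ht, hexch⟩
    right_exchange := fun t ht => ⟨_, h.right_exchange t ht, hexch⟩
    initial := h.initial
    left_initial := by
      have := (h.left_cont 0 self_mem_Ici).tendsto.mono_left
        (nhdsWithin_mono (0 : ℝ) Ioi_subset_Ici_self)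
      rwa [h.left_initial] at this
    right_initial := by
      have := (h.right_cont 0 self_mem_Ici).tendsto.mono_left
        (nhdsWithin_mono (0 : ℝ) Ioi_subset_Ici_self)
      rwa [h.right_initial] at this }

/-! ### Continuity in σ and in the data. -/

namespace StateSpace

variable {H : Type*} [NormedAddCommGroup H] [InnerProductSpace ℂ H] [CompleteSpace H]
  (X : StateSpace H) {ι : Type*} {l : Filter ι}

/-- Dominated convergence with |g - g₀| ≤ 1. Pointwise convergence suffices, so behaviour near the
endpoints is irrelevant. -/
theorem tendsto_state [l.IsCountablyGenerated] {g : ι → ℝ → ℝ} {g₀ : ℝ → ℝ} {a b : ι → ℝ}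
    {a₀ b₀ : ℝ} (hg : ∀ᶠ i in l, IsInitialDatum (g i)) (hg₀ : IsInitialDatum g₀)
    (h : ∀ x ∈ Ioo (0 : ℝ) 1, Tendsto (fun i => g i x) l (𝓝 (g₀ x))) (ha : Tendsto a l (𝓝 a₀))
    (hb : Tendsto b l (𝓝 b₀)) :
    Tendsto (fun i => X.state (g i) (a i) (b i)) l (𝓝 (X.state g₀ a₀ b₀)) := by
  have hI : Tendsto (fun i => ∫ x in Ioo (0 : ℝ) 1, (g i x - g₀ x) * (g i x - g₀ x)) l
      (𝓝 (∫ _ in Ioo (0 : ℝ) 1, 0)) := by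
    refine tendsto_integral_filter_of_dominated_convergence (l := l)
      (F := fun i x => (g i x - g₀ x) * (g i x - g₀ x)) (f := fun _ => (0 : ℝ)) (fun _ => 1)
      ?_ ?_ ?_ ?_
    · filter_upwards [hg] with i hi
      exact ((hi.1.sub hg₀.1).mul (hi.1.sub hg₀.1)).aestronglyMeasurable measurableSet_Ioo
    · filter_upwards [hg] with i hi
      filter_upwards [ae_restrict_mem measurableSet_Ioo] with x hx
      have h1 := hi.2 x hx
      have h2 := hg₀.2 x hx
      rw [norm_mul, ← one_mul (1 : ℝ)]
      have : ‖g i x - g₀ x‖ ≤ 1 := by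
        rw [Real.norm_eq_abs, abs_le]
        constructor <;> linarith [h1.1, h1.2, h2.1, h2.2]
      gcongr
    · exact integrable_const 1
    · filter_upwards [ae_restrict_mem measurableSet_Ioo] with x hx
      have h1 := (h x hx).sub_const (g₀ x)
      simpa using h1.mul h1
  have ha' := ha.sub_const a₀
  have hb' := hb.sub_const b₀
  have hn := (hI.add (ha'.mul ha')).add (hb'.mul hb')
  simp only [integral_zero, sub_self, mul_zero, add_zero] at hn
  rw [tendsto_iff_norm_sub_tendsto_zero]
  have hs := hn.sqrt
  rw [Real.sqrt_zero] at hs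
  refine hs.congr' ?_
  filter_upwards [hg] with i hi
  have hd : MemLp (fun x => g i x - g₀ x) 2 (volume.restrict (Ioo (0 : ℝ) 1)) :=
    hi.memLp.sub hg₀.memLp
  rw [← X.state_sub _ _ _ _ hi.memLp hg₀.memLp, norm_eq_sqrt_real_inner,
    X.inner_state_real _ _ _ _ hd hd, intervalIntegral.integral_of_le zero_le_one,
    integral_Ioc_eq_integral_Ioo]

variable {s : ι → ℝ} {f : ι → H} {σ : ℝ} {F : H}

theorem tendsto_flow [Nontrivial H] (hσ : 0 ≤ σ) (hs : ∀ᶠ i in l, 0 ≤ s i)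
    (h : Tendsto s l (𝓝 σ)) (hf : Tendsto f l (𝓝 F)) (j : ℕ) {t : ℝ} (ht : 0 < t) :
    Tendsto (fun i => X.flow (s i) j (f i) t) l (𝓝 (X.flow σ j F t)) := by
  -- The absolute value makes every operator of the family self-adjoint, not only eventually. The
  -- two families agree eventually.
  have h1 : Tendsto (fun i => X.green |s i|) l (𝓝 (X.green σ)) := by
    have := (X.continuous_green.tendsto _).comp h.abs
    rwa [abs_of_nonneg hσ] at this
  have h2 : Tendsto (fun i => heatOp (X.green |s i|) j t) l (𝓝 (heatOp (X.green σ) j t)) :=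
    tendsto_heatOp j ht (fun i => X.isSelfAdjoint_green (abs_nonneg (s i)))
      (X.isSelfAdjoint_green hσ) h1
  refine (((isBoundedBilinearMap_apply (𝕜 := ℂ)).continuous.tendsto (_, F)).comp
    (h2.prodMk_nhds hf)).congr' ?_
  filter_upwards [hs] with i hi
  rw [Function.comp_apply, abs_of_nonneg hi, flow]

theorem continuous_mean : Continuous X.mean :=
  continuous_const.mul (continuous_const.inner (𝕜 := ℝ) continuous_id)

theorem tendsto_val {G : ι → H} {G₀ : H} (h : Tendsto s l (𝓝 σ))
    (hG : Tendsto G l (𝓝 G₀)) (r : ℝ) :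
    Tendsto (fun i => X.val (s i) (G i) r) l (𝓝 (X.val σ G₀ r)) := by
  have h1 : Tendsto (fun i => (s i, G i, r)) l (𝓝 (σ, G₀, r)) :=
    h.prodMk_nhds (hG.prodMk_nhds tendsto_const_nhds)
  have h2 := Tendsto.comp (X.continuous_val_uncurry.tendsto (σ, G₀, r)) h1
  simp only [Function.comp_def] at h2
  exact h2

theorem tendsto_temp_param [Nontrivial H] (hσ : 0 ≤ σ) (hs : ∀ᶠ i in l, 0 ≤ s i)
    (h : Tendsto s l (𝓝 σ)) (hf : Tendsto f l (𝓝 F)) (r : ℝ) {t : ℝ} (ht : 0 < t) :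
    Tendsto (fun i => X.temp (s i) (f i) r t) l (𝓝 (X.temp σ F r t)) :=
  ((X.continuous_mean.tendsto F).comp hf).add
    (X.tendsto_val h (X.tendsto_flow hσ hs h hf 1 ht) r)

theorem tendsto_resLeft_param [Nontrivial H] (hσ : 0 ≤ σ) (hs : ∀ᶠ i in l, 0 ≤ s i)
    (h : Tendsto s l (𝓝 σ)) (hf : Tendsto f l (𝓝 F)) {t : ℝ} (ht : 0 < t) :
    Tendsto (fun i => X.resLeft (s i) (f i) t) l (𝓝 (X.resLeft σ F t)) :=
  ((X.continuous_mean.tendsto F).comp hf).add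
    (tendsto_const_nhds.inner (𝕜 := ℝ) (X.tendsto_flow hσ hs h hf 0 ht))

theorem tendsto_resRight_param [Nontrivial H] (hσ : 0 ≤ σ) (hs : ∀ᶠ i in l, 0 ≤ s i)
    (h : Tendsto s l (𝓝 σ)) (hf : Tendsto f l (𝓝 F)) {t : ℝ} (ht : 0 < t) :
    Tendsto (fun i => X.resRight (s i) (f i) t) l (𝓝 (X.resRight σ F t)) :=
  ((X.continuous_mean.tendsto F).comp hf).add
    (tendsto_const_nhds.inner (𝕜 := ℝ) (X.tendsto_flow hσ hs h hf 0 ht))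

end StateSpace

/-! ### The main theorem. -/

theorem theorem2 (u₀ : ℝ → ℝ) (hu₀ : IsInitialDatum u₀) (vm vp : ℝ)
    (hvm : vm ∈ Icc (0 : ℝ) 1) (hvp : vp ∈ Icc (0 : ℝ) 1) :
    ∃ u : ℝ → ℝ → ℝ,
      IsStickySolution u₀ vm vp u ∧
      (∀ w : ℝ → ℝ → ℝ, IsStickySolution u₀ vm vp w →
        ∀ r ∈ Icc (0 : ℝ) 1, ∀ t : ℝ, 0 < t → w r t = u r t) ∧
      (∀ (u₀σ : ℝ → ℝ → ℝ) (vmσ vpσ : ℝ → ℝ),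
        (∀ σ : ℝ, 0 < σ →
          IsInitialDatum (u₀σ σ) ∧ vmσ σ ∈ Icc (0 : ℝ) 1 ∧ vpσ σ ∈ Icc (0 : ℝ) 1) →
        (∀ K : Set ℝ, K ⊆ Ioo (0 : ℝ) 1 → IsCompact K →
          TendstoUniformlyOn u₀σ u₀ (𝓝[>] (0 : ℝ)) K) →
        Tendsto vmσ (𝓝[>] (0 : ℝ)) (𝓝 vm) →
        Tendsto vpσ (𝓝[>] (0 : ℝ)) (𝓝 vp) →
        (∀ σ : ℝ, 0 < σ → ∃ (U : ℝ → ℝ → ℝ) (ρm ρp : ℝ → ℝ),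
          IsReservoirSolution σ (u₀σ σ) (vmσ σ) (vpσ σ) U ρm ρp) ∧
        (∀ (U : ℝ → ℝ → ℝ → ℝ) (ρm ρp : ℝ → ℝ → ℝ),
          (∀ σ : ℝ, 0 < σ →
            IsReservoirSolution σ (u₀σ σ) (vmσ σ) (vpσ σ) (U σ) (ρm σ) (ρp σ)) →
          (∀ r ∈ Icc (0 : ℝ) 1, ∀ t : ℝ, 0 < t →
            Tendsto (fun σ => U σ r t) (𝓝[>] (0 : ℝ)) (𝓝 (u r t))) ∧
          (∀ t : ℝ, 0 < t →
            Tendsto (fun σ => ρm σ t) (𝓝[>] (0 : ℝ)) (𝓝 (u 0 t)) ∧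
            Tendsto (fun σ => ρp σ t) (𝓝[>] (0 : ℝ)) (𝓝 (u 1 t))))) := by
  set X := StateModel.stateSpace
  have hsol := X.isStickySolution_temp hu₀ hvm hvp
  refine ⟨X.temp 0 (X.state u₀ vm vp), hsol, fun w hw r hr t ht =>
    (hw.isFluxSolution.unique hsol.isFluxSolution le_rfl ht).1 r hr, ?_⟩
  intro g a b hdata hg ha hb
  have hres := fun (σ : ℝ) (hσ : 0 < σ) =>
    X.isReservoirSolution_temp (hdata σ hσ).1 (hdata σ hσ).2.1 (hdata σ hσ).2.2 hσ
  refine ⟨fun σ hσ => ⟨_, _, _, hres σ hσ⟩, fun U ρm ρp hU => ?_⟩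
  -- Uniqueness replaces arbitrary reservoir solutions by the constructed ones, for which
  -- convergence is continuity in σ at 0.
  have huniq := fun (σ : ℝ) (hσ : 0 < σ) (t : ℝ) (ht : 0 < t) =>
    ((hres σ hσ).isFluxSolution hσ).unique ((hU σ hσ).isFluxSolution hσ) hσ.le ht
  have hf : Tendsto (fun σ => X.state (g σ) (a σ) (b σ)) (𝓝[>] 0) (𝓝 (X.state u₀ vm vp)) :=
    X.tendsto_state (eventually_mem_nhdsWithin.mono fun σ hσ => (hdata σ hσ).1) hu₀
      (fun x hx => (hg {x} (singleton_subset_iff.2 hx) isCompact_singleton).tendsto_at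
        (mem_singleton x)) ha hb
  have hid : Tendsto (fun σ : ℝ => σ) (𝓝[>] 0) (𝓝 0) := nhdsWithin_le_nhds
  have hnn : ∀ᶠ σ : ℝ in 𝓝[>] 0, 0 ≤ σ := eventually_mem_nhdsWithin.mono fun σ hσ => le_of_lt hσ
  refine ⟨fun r hr t ht => ?_, fun t ht => ⟨?_, ?_⟩⟩
  · refine (X.tendsto_temp_param le_rfl hnn hid hf r ht).congr' ?_
    filter_upwards [self_mem_nhdsWithin] with σ hσ using (huniq σ hσ t ht).1 r hr
  -- At σ = 0 the boundary value is the reservoir content, so convergence of the contents suffices.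
  · have h0 := X.temp_zero_sub le_rfl (X.state u₀ vm vp) ht
    rw [zero_mul, sub_eq_zero] at h0
    rw [h0]
    refine (X.tendsto_resLeft_param le_rfl hnn hid hf ht).congr' ?_
    filter_upwards [self_mem_nhdsWithin] with σ hσ
    rw [← (huniq σ hσ t ht).2.1, if_neg (not_le.2 ht)]
  · have h1 := X.temp_one_sub le_rfl (X.state u₀ vm vp) ht
    rw [zero_mul, neg_zero, sub_eq_zero] at h1
    rw [h1]
    refine (X.tendsto_resRight_param le_rfl hnn hid hf ht).congr' ?_
    filter_upwards [self_mem_nhdsWithin] with σ hσ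
    rw [← (huniq σ hσ t ht).2.2, if_neg (not_le.2 ht)]
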